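/- For a real symmetric order-$d$ tensor $T\in(\mathbb R^p)^{\otimes d}$ (that is, $T_{i_1\dots i_d}=T_{i_{\pi(1)}\dots i_{\pi(d)}}$ for every permutation $\pi$) let $\|T\|_s=\sup_{\|x\|_2=1}|\langle T,x^{\otimes d}\rangle|$ be its spectral norm. A function $f:(\mathbb R^p)^{\otimes d}\to\mathbb R_+$ is said to approximate $\|\cdot\|_s$ with distortion $\gamma\ge1$ if one of the following holds: (i) (two-sided approximation) $\gamma=\rho\zeta$ for some $\rho,\zeta\ge1$ with $\rho^{-1}\|T\|_s\le f(T)\le\zeta\|T\|_s$ for all symmetric $T$; (ii) (lower certificate) $\gamma^{-1}\|T\|_s\le f(T)\le\|T\|_s$ for all symmetric $T$; (iii) (upper certificate) $\|T\|_s\le f(T)\le\gamma\|T\|_s$ for all symmetric $T$. A family $(f_p)_{p}$ of functions is a polynomial-time algorithm if a single real-RAM program (exact real arithmetic $+,-,\times,\div,\sqrt{\cdot}$ and comparisons at unit cost, no rounding of reals to integers, integer constants only) computes $f_p$ for every $p$ in a number of steps bounded by a polynomial in $p$. Low-degree conjecture. Let $n_p$ be bounded by a polynomial in $p$, let $Q_p$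 be the law of $n_p$ independent $N(0,I_p)$ vectors, and let $P_p$ be the law of $n_p$ vectors in $\mathbb R^p$ that are i.i.d. conditionally on a hidden random parameter. Suppose that $P_p$ is invariant under permutations of the $p$ coordinates and that for some $\varepsilon>0$ and $B$, for all large $p$, every polynomial $g$ in the data of degree at most $(\log p)^{1+\varepsilon}$ is $P_p$-integrable and satisfies $\mathbb E_{P_p}g\le B\,(\mathbb E_{Q_p}g^2)^{1/2}$. For $\delta\in(0,1)$ let $T_\delta P_p$ be the law of $\sqrt{1-\delta}\,Y+\sqrt\delta\,Z$ with independent $Y\sim P_p$ and $Z\sim Q_p$. Then for every $\delta\in(0,1)$, every polynomial-time computable real statistic $g_p$ and every real sequence $\tau_p$ there is $\eta>0$ such that $Q_p(g_p>\tau_p)+T_\delta P_p(g_p\le\tau_p)\ge\eta$ for all large $p$. Corollary. Assume the low-degree conjecture and fix $d\ge3$. There are constants $C_d,c>0$ depending only on $d$ such that for every polynomial-time algorithm $f=(f_p)_p$, $f_p:(\mathbb R^p)^{\otimes d}\to\mathbb R_+$, the following holds for all sufficiently large $p$: if $f_p$ approximates $\|\cdot\|_s$ with distortion $\gamma$ in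 one of the senses (i), (ii), (iii), then $$\gamma\ \ge\ c\,\frac{p^{d/4-1/2}}{(\log p)^{C_d}}.$$ -/

import Mathlib

open MeasureTheory ProbabilityTheory Filter

noncomputable section

/-! ### Polynomial time: the real RAM

Programs of a small imperative language over a random access machine with two kinds of data: natural
numbers (used for counting and addressing) and real numbers with exact arithmetic at unit cost. There
is no conversion from reals to naturals (no floor), and naturals can only be added and subtracted. A
program is finite, contains natural number constants only, and is the same for all input sizes. -/

namespace RealRAM

/-- A configuration: registers and addressable memory for naturals and for reals. -/
structure State where
  natReg : ℕ → ℕ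
  natMem : ℕ → ℕ
  realReg : ℕ → ℝ
  realMem : ℕ → ℝ

/-- Elementary instructions; the arguments are register numbers, except for the constant `k`. -/
inductive Instr where
  | natConst (x k : ℕ)
  | natAdd (x y z : ℕ)
  | natSub (x y z : ℕ)
  | natLoad (x a : ℕ)
  | natStore (a y : ℕ)
  | realConst (x k : ℕ)
  | realAdd (x y z : ℕ)
  | realSub (x y z : ℕ)
  | realMul (x y z : ℕ)
  | realDiv (x y z : ℕ)
  | realSqrt (x y : ℕ)
  | realOfNat (x y : ℕ)
  | realLoad (x a : ℕ)
  | realStore (a y : ℕ)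

/-- Effect of an elementary instruction. Subtraction of naturals is truncated, division by zero and
the square root of a negative number return `0`. In the load and store instructions `a` is the natural
register that holds the memory address. -/
def Instr.run : Instr → State → State
  | natConst x k, s => { s with natReg := Function.update s.natReg x k }
  | natAdd x y z, s => { s with natReg := Function.update s.natReg x (s.natReg y + s.natReg z) }
  | natSub x y z, s => { s with natReg := Function.update s.natReg x (s.natReg y - s.natReg z) }
  | natLoad x a, s => { s with natReg := Function.update s.natReg x (s.natMem (s.natReg a)) }
  | natStore a y, s => { s with natMem := Function.update s.natMem (s.natReg a) (s.natReg y) }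
  | realConst x k, s => { s with realReg := Function.update s.realReg x (k : ℝ) }
  | realAdd x y z, s => { s with realReg := Function.update s.realReg x (s.realReg y + s.realReg z) }
  | realSub x y z, s => { s with realReg := Function.update s.realReg x (s.realReg y - s.realReg z) }
  | realMul x y z, s => { s with realReg := Function.update s.realReg x (s.realReg y * s.realReg z) }
  | realDiv x y z, s => { s with realReg := Function.update s.realReg x (s.realReg y / s.realReg z) }
  | realSqrt x y, s => { s with realReg := Function.update s.realReg x (Real.sqrt (s.realReg y)) }
  | realOfNat x y, s => { s with realReg := Function.update s.realReg x (s.natReg y : ℝ) }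
  | realLoad x a, s => { s with realReg := Function.update s.realReg x (s.realMem (s.natReg a)) }
  | realStore a y, s => { s with realMem := Function.update s.realMem (s.natReg a) (s.realReg y) }

/-- Branching conditions: comparison of two natural or of two real registers. -/
inductive Cond where
  | natLT (x y : ℕ)
  | realLT (x y : ℕ)

def Cond.Holds : Cond → State → Prop
  | natLT x y, s => s.natReg x < s.natReg y
  | realLT x y, s => s.realReg x < s.realReg y

/-- Programs. -/
inductive Prog where
  | instr (i : Instr)
  | seq (c₁ c₂ : Prog)
  | ite (b : Cond) (c₁ c₂ : Prog)
  | while (b : Cond) (c : Prog)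

/-- `Exec c s t s'`: started in `s`, the program `c` halts in `s'` after exactly `t` steps, where every
elementary instruction and every evaluation of a condition is one step. -/
inductive Exec : Prog → State → ℕ → State → Prop where
  | instr (i : Instr) (s : State) : Exec (.instr i) s 1 (i.run s)
  | seq {c₁ c₂ : Prog} {s s' s'' : State} {t₁ t₂ : ℕ} :
      Exec c₁ s t₁ s' → Exec c₂ s' t₂ s'' → Exec (.seq c₁ c₂) s (t₁ + t₂) s''
  | iteTrue {b : Cond} {c₁ c₂ : Prog} {s s' : State} {t : ℕ} :
      b.Holds s → Exec c₁ s t s' → Exec (.ite b c₁ c₂) s (t + 1) s'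
  | iteFalse {b : Cond} {c₁ c₂ : Prog} {s s' : State} {t : ℕ} :
      ¬ b.Holds s → Exec c₂ s t s' → Exec (.ite b c₁ c₂) s (t + 1) s'
  | whileTrue {b : Cond} {c : Prog} {s s' s'' : State} {t₁ t₂ : ℕ} :
      b.Holds s → Exec c s t₁ s' → Exec (.while b c) s' t₂ s'' →
        Exec (.while b c) s (t₁ + t₂ + 1) s''
  | whileFalse {b : Cond} {c : Prog} {s : State} :
      ¬ b.Holds s → Exec (.while b c) s 1 s

/-- Initial configuration for the size parameter `p` and the input `x` of length `N`: natural registers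
`0` and `1` hold `p` and `N`, the real memory cells `0, …, N - 1` hold `x`, all the rest is `0`. -/
def initial (p N : ℕ) (x : Fin N → ℝ) : State where
  natReg k := if k = 0 then p else if k = 1 then N else 0
  natMem _ := 0
  realReg _ := 0
  realMem k := if h : k < N then x ⟨k, h⟩ else 0

/-- The family `g p : ℝ ^ (ι p) → ℝ`, whose inputs are listed in the order given by `e p`, is computed
by one program in a number of steps that is polynomial in `p`; the output is real register `0`. -/
def IsPolyTime {ι : ℕ → Type} (N : ℕ → ℕ) (e : ∀ p, ι p ≃ Fin (N p))
    (g : ∀ p, (ι p → ℝ) → ℝ) : Prop :=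
  ∃ (c : Prog) (q : Polynomial ℕ), ∀ (p : ℕ) (x : ι p → ℝ), ∃ (t : ℕ) (s : State),
    Exec c (initial p (N p) (fun k => x ((e p).symm k))) t s ∧ t ≤ q.eval p ∧ s.realReg 0 = g p x

end RealRAM

/-! ### The low-degree conjecture -/

/-- Null law: `n` independent standard Gaussian vectors in `ℝ ^ p`. -/
def nullLaw (n p : ℕ) : Measure (Fin n → Fin p → ℝ) :=
  Measure.pi fun _ => Measure.pi fun _ => gaussianReal 0 1

/-- Planted law: a hidden parameter `θ` is drawn from the prior `π`, and then `n` vectors in `ℝ ^ p` are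
drawn independently from `K θ`. -/
def plantedLaw {Θ : Type} [MeasurableSpace Θ] (n p : ℕ) (π : Measure Θ)
    (K : Kernel Θ (Fin p → ℝ)) : Measure (Fin n → Fin p → ℝ) :=
  π.bind fun θ => Measure.pi fun _ => K θ

/-- The law of the data is invariant under permutations of the `p` coordinates. (It is always invariant
under permutations of the samples.) -/
def CoordInvariant {n p : ℕ} (P : Measure (Fin n → Fin p → ℝ)) : Prop :=
  ∀ σ : Equiv.Perm (Fin p), P.map (fun Y i j => Y i (σ j)) = P

/-- Gaussian noise operator: the law of `√(1 - δ) Y + √δ Z` for independent `Y ∼ P` and `Z ∼` null. -/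
def noisy {n p : ℕ} (δ : ℝ) (P : Measure (Fin n → Fin p → ℝ)) : Measure (Fin n → Fin p → ℝ) :=
  (P.prod (nullLaw n p)).map fun YZ => Real.sqrt (1 - δ) • YZ.1 + Real.sqrt δ • YZ.2

/-- The degree-`D` likelihood ratio of `P` against the null law has `L²` norm at most `B`, that is,
`E_P g ≤ B (E_null g²) ^ (1/2)` for every polynomial `g` in the data of degree at most `D`. -/
def LowDegreeNormLE {n p : ℕ} (P : Measure (Fin n → Fin p → ℝ)) (D B : ℝ) : Prop :=
  ∀ g : MvPolynomial (Fin n × Fin p) ℝ, (g.totalDegree : ℝ) ≤ D →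
    Integrable (fun Y => MvPolynomial.eval (Function.uncurry Y) g) P ∧
    ∫ Y, MvPolynomial.eval (Function.uncurry Y) g ∂P ≤
      B * Real.sqrt (∫ Y, (MvPolynomial.eval (Function.uncurry Y) g) ^ 2 ∂(nullLaw n p))

/-- **The low-degree conjecture**, for testing Gaussian noise against planted i.i.d. samples with a
hidden parameter: if the planted law is invariant under permutations of the coordinates and its
likelihood ratio of degree `(log p) ^ (1 + ε)` stays bounded, then, for every noise level `δ`, the sum of
the type I and type II errors of every test `1{g > τ_p}` with a polynomial-time computable statistic `g`
stays bounded away from `0` when the planted law is perturbed by noise. -/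
def LowDegreeConjecture : Prop :=
  ∀ (n : ℕ → ℕ) (Θ : ℕ → Type) [∀ p, MeasurableSpace (Θ p)]
    (π : ∀ p, Measure (Θ p)) [∀ p, IsProbabilityMeasure (π p)]
    (K : ∀ p, Kernel (Θ p) (Fin p → ℝ)) [∀ p, IsMarkovKernel (K p)] (ε δ B : ℝ),
    (∃ q : Polynomial ℕ, ∀ p, n p ≤ q.eval p) →
    (∀ p, CoordInvariant (plantedLaw (n p) p (π p) (K p))) →
    0 < ε →
    (∀ᶠ p : ℕ in atTop,
      LowDegreeNormLE (plantedLaw (n p) p (π p) (K p)) (Real.log p ^ (1 + ε)) B) →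
    0 < δ → δ < 1 →
    ∀ g : ∀ p, (Fin (n p) × Fin p → ℝ) → ℝ,
      RealRAM.IsPolyTime (fun p => n p * p) (fun _ => finProdFinEquiv) g →
      ∀ τ : ℕ → ℝ, ∃ η : ℝ, 0 < η ∧ ∀ᶠ p : ℕ in atTop,
        η ≤ (nullLaw (n p) p).real {Y | τ p < g p (Function.uncurry Y)} +
          (noisy δ (plantedLaw (n p) p (π p) (K p))).real {Y | g p (Function.uncurry Y) ≤ τ p}

/-! ### Tensors and approximation of the spectral norm -/

/-- Real tensors of order `d` and dimension `p` in every mode. -/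
abbrev RealTensor (d p : ℕ) : Type := (Fin d → Fin p) → ℝ

def RealTensor.IsSymmetric {d p : ℕ} (T : RealTensor d p) : Prop :=
  ∀ (σ : Equiv.Perm (Fin d)) (i : Fin d → Fin p), T (i ∘ σ) = T i

/-- The inner product of `T` with the `d`-th tensor power of `x`. -/
def RealTensor.form {d p : ℕ} (T : RealTensor d p) (x : EuclideanSpace ℝ (Fin p)) : ℝ :=
  ∑ i : Fin d → Fin p, T i * ∏ k, x (i k)

/-- Spectral norm of a symmetric tensor. -/
def RealTensor.specNorm {d p : ℕ} (T : RealTensor d p) : ℝ :=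
  sSup {r : ℝ | ∃ x : EuclideanSpace ℝ (Fin p), ‖x‖ = 1 ∧ r = |T.form x|}

/-- Two-sided approximation with distortion `γ = ρ ζ`. -/
def TwoSidedApprox {d p : ℕ} (f : RealTensor d p → ℝ) (γ : ℝ) : Prop :=
  ∃ ρ ζ : ℝ, 1 ≤ ρ ∧ 1 ≤ ζ ∧ γ = ρ * ζ ∧
    ∀ T : RealTensor d p, T.IsSymmetric → ρ⁻¹ * T.specNorm ≤ f T ∧ f T ≤ ζ * T.specNorm

/-- Lower certificate with distortion `γ`. -/
def LowerCertificate {d p : ℕ} (f : RealTensor d p → ℝ) (γ : ℝ) : Prop :=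
  1 ≤ γ ∧ ∀ T : RealTensor d p, T.IsSymmetric → γ⁻¹ * T.specNorm ≤ f T ∧ f T ≤ T.specNorm

/-- Upper certificate with distortion `γ`. -/
def UpperCertificate {d p : ℕ} (f : RealTensor d p → ℝ) (γ : ℝ) : Prop :=
  1 ≤ γ ∧ ∀ T : RealTensor d p, T.IsSymmetric → T.specNorm ≤ f T ∧ f T ≤ γ * T.specNorm

end

/-! The proof builds a detection problem that is hard for polynomials of low degree and that a good
approximation of the spectral norm would solve.

A hidden sign vector u = sgn θ tilts the Gaussian density of each sample x by the factor 1 + ω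
e_d(u_1 sgn x_1, …, u_p sgn x_p). Under the Gaussian law the tilt is orthogonal to every product of
functions of fewer than d coordinates. Expand the likelihood ratio of n samples over the sets J of
samples: a polynomial of degree D sees only the terms with d|J| ≤ D. The second moment of this part
is the mean, over an independent copy u' of u, of the sum over J of (ω² e_d(u u'))^|J|. Newton's
identities (`abs_elemSymm_le`) bound e_d of a sign vector by M^d as soon as M dominates √p and the
absolute value of the sum of its entries. So the low-degree norm stays bounded when n ω² p^(d/2) is
at most a negative power of log p (`lowDegreeNormLE_plantedLaw`).

The statistic is f applied to T, the sum of the tensors (sgn Y_j)^⊗d with the entries with a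
repeated index removed; its form at x is d! Σ_j e_d(x sgn Y_j). Under the null law, exponential
moments and a grid bound ‖T‖ by √(np) up to logarithms (`nullLaw_specNorm_le`). Under the noisy
planted law the noise only costs a factor κ^d, where κ > 0 is the correlation of the signs of a
Gaussian variable and of its noisy copy. Evaluation at u/√p and Chebyshev's inequality then give ‖T‖
of order at least n ω p^(d/2) (`noisy_plantedLaw_specNorm_lt_le`). With ω close to n^(-1/2) p^(-d/4)
the ratio of the two norms is p^(d/4-1/2) up to logarithms, whatever n is. A smaller distortion
would give a consistent test (`le_mul_of_lowDegreeConjecture`).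

The choice n = p^(2d+1) serves two purposes: ω times the binomial coefficient is at most 1, so that
the tilt defines a density, and the exponential parameter √(p/n) = p^(-d) is small enough for
summands of size p^d. Signs are used because they are bounded and because the machine computes them
exactly, as x/√(x²); hence T is computable in polynomial time (`isPolyTime_signTensor`). -/

noncomputable section

/-! ### Signs of Gaussian variables and their correlation under noise -/

/-- The sign of a real number, in a form that uses only arithmetic and a square root. -/
def sgn (x : ℝ) : ℝ := x / |x|

lemma measurable_sgn : Measurable sgn := by unfold sgn; fun_prop

lemma sgn_neg (x : ℝ) : sgn (-x) = -sgn x := by simp [sgn, neg_div]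

lemma sgn_zero : sgn 0 = 0 := by simp [sgn]

lemma sgn_of_pos {x : ℝ} (h : 0 < x) : sgn x = 1 := by
  rw [sgn, abs_of_pos h, div_self h.ne']

lemma sgn_of_neg {x : ℝ} (h : x < 0) : sgn x = -1 := by
  rw [sgn, abs_of_neg h, div_neg, div_self h.ne]

lemma abs_sgn_le (x : ℝ) : |sgn x| ≤ 1 := by
  rcases lt_trichotomy x 0 with h | h | h
  · simp [sgn_of_neg h]
  · simp [h, sgn_zero]
  · simp [sgn_of_pos h]

lemma sgn_mul_self {x : ℝ} (h : x ≠ 0) : sgn x * sgn x = 1 := by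
  rcases lt_or_gt_of_ne h with h | h
  · simp [sgn_of_neg h]
  · simp [sgn_of_pos h]

lemma sgn_pow_three (x : ℝ) : sgn x ^ 3 = sgn x := by
  rcases lt_trichotomy x 0 with h | h | h
  · simp [sgn_of_neg h]; norm_num
  · simp [h, sgn_zero]
  · simp [sgn_of_pos h]

lemma integrable_of_abs_le {Ω : Type*} [MeasurableSpace Ω] {μ : Measure Ω} [IsFiniteMeasure μ]
    {f : Ω → ℝ} (hf : Measurable f) (C : ℝ) (h : ∀ x, |f x| ≤ C) : Integrable f μ :=
  Integrable.of_bound hf.aestronglyMeasurable C (ae_of_all _ h)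

/-- The standard Gaussian law on the line. -/
abbrev stdGauss : Measure ℝ := gaussianReal 0 1

instance : NullSingletonClass stdGauss := nullSingletonClass_gaussianReal one_ne_zero

lemma measurePreserving_neg_stdGauss :
    MeasurePreserving (fun x : ℝ => -x) stdGauss stdGauss :=
  ⟨by fun_prop, by rw [gaussianReal_map_neg, neg_zero]⟩

lemma ae_ne_zero_stdGauss : ∀ᵐ x ∂stdGauss, x ≠ 0 := by
  rw [ae_iff]; simp

/-- An odd function has mean zero under a measure invariant under negation. -/
lemma integral_eq_zero_of_odd {Ω : Type*} [MeasurableSpace Ω] {μ : Measure Ω} {s : Ω → Ω}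
    (hs : MeasurePreserving s μ μ) {f : Ω → ℝ} (hm : Measurable f)
    (hf : ∀ x, f (s x) = -f x) : ∫ x, f x ∂μ = 0 := by
  have h : ∫ x, f (s x) ∂μ = ∫ x, f x ∂μ := by
    rw [← integral_map hs.measurable.aemeasurable (by
      rw [hs.map_eq]; exact hm.aestronglyMeasurable), hs.map_eq]
  simp_rw [hf, integral_neg] at h
  linarith

lemma integral_sgn : ∫ x, sgn x ∂stdGauss = 0 :=
  integral_eq_zero_of_odd measurePreserving_neg_stdGauss measurable_sgn sgn_neg

lemma integral_sgn_mul_self : ∫ x, sgn x * sgn x ∂stdGauss = 1 := by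
  have : ∫ x, sgn x * sgn x ∂stdGauss = ∫ x, 1 ∂stdGauss :=
    integral_congr_ae (ae_ne_zero_stdGauss.mono fun x hx => sgn_mul_self hx)
  simpa using this

/-- Probability law of a pair of independent standard Gaussian variables. -/
abbrev gaussPair : Measure (ℝ × ℝ) := stdGauss.prod stdGauss

/-- Noisy copy of the first coordinate. -/
def mix (δ : ℝ) (q : ℝ × ℝ) : ℝ := Real.sqrt (1 - δ) * q.1 + Real.sqrt δ * q.2

lemma measurable_mix (δ : ℝ) : Measurable (mix δ) := by unfold mix; fun_prop

lemma mix_neg (δ : ℝ) (q : ℝ × ℝ) : mix δ (-q.1, -q.2) = -mix δ q := by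
  simp only [mix]; ring

lemma measurePreserving_neg_gaussPair :
    MeasurePreserving (fun q : ℝ × ℝ => (-q.1, -q.2)) gaussPair gaussPair :=
  measurePreserving_neg_stdGauss.prod measurePreserving_neg_stdGauss

lemma integral_sgn_mix (δ : ℝ) : ∫ q, sgn (mix δ q) ∂gaussPair = 0 :=
  integral_eq_zero_of_odd measurePreserving_neg_gaussPair
    (measurable_sgn.comp (measurable_mix δ)) fun q => by rw [mix_neg, sgn_neg]

lemma integral_sgn_fst : ∫ q, sgn q.1 ∂gaussPair = 0 :=
  integral_eq_zero_of_odd measurePreserving_neg_gaussPair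
    (measurable_sgn.comp measurable_fst) fun q => by simp [sgn_neg]

/-- Correlation of the signs of a Gaussian variable and of its noisy copy. -/
def signCorr (δ : ℝ) : ℝ := ∫ q, sgn q.1 * sgn (mix δ q) ∂gaussPair

lemma sgn_add_add_sgn_sub_nonneg {x : ℝ} (hx : 0 < x) (z : ℝ) :
    0 ≤ sgn (x + z) + sgn (x - z) := by
  rcases lt_or_ge 0 (x + z) with h | h
  · rw [sgn_of_pos h]
    have := (abs_le.1 (abs_sgn_le (x - z))).1
    linarith
  · rw [sgn_of_pos (show 0 < x - z by linarith)]
    have := (abs_le.1 (abs_sgn_le (x + z))).1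
    linarith

lemma sgn_mul_pos {c : ℝ} (hc : 0 < c) (x : ℝ) : sgn (c * x) = sgn x := by
  rw [sgn, sgn, abs_mul, abs_of_pos hc, mul_div_mul_left _ _ hc.ne']

lemma sgn_mul_add_sgn_nonneg (x z : ℝ) : 0 ≤ sgn x * (sgn (x + z) + sgn (x - z)) := by
  rcases lt_trichotomy x 0 with h | h | h
  · have := sgn_add_add_sgn_sub_nonneg (neg_pos.2 h) z
    rw [sgn_of_neg h]
    have e1 : sgn (-x + z) = -sgn (x - z) := by rw [← sgn_neg]; congr 1; ring
    have e2 : sgn (-x - z) = -sgn (x + z) := by rw [← sgn_neg]; congr 1; ring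
    linarith
  · simp [h, sgn_zero]
  · rw [sgn_of_pos h, one_mul]; exact sgn_add_add_sgn_sub_nonneg h z

lemma sgn_mul_add_sgn_eq_two {x z : ℝ} (h : |z| < |x|) :
    sgn x * (sgn (x + z) + sgn (x - z)) = 2 := by
  rcases lt_trichotomy x 0 with hx | hx | hx
  · rw [abs_of_neg hx, abs_lt] at h
    rw [sgn_of_neg hx, sgn_of_neg (by linarith), sgn_of_neg (by linarith)]; norm_num
  · rw [hx, abs_zero] at h; exact absurd h (not_lt.2 (abs_nonneg z))
  · rw [abs_of_pos hx, abs_lt] at h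
    rw [sgn_of_pos hx, sgn_of_pos (by linarith), sgn_of_pos (by linarith)]; norm_num

/-- At noise level 1/2 the noisy copy is a positive multiple of x + z. The reflection z ↦ -z
preserves the law, so twice the correlation is the mean of sgn x (sgn (x + z) + sgn (x - z)), which
is nonnegative everywhere and equals 2 where |z| < |x|. -/
lemma signCorr_half_pos : 0 < signCorr (1 / 2) := by
  have hpos : (0 : ℝ) < Real.sqrt (1 / 2) := by positivity
  have e1 : ∀ q : ℝ × ℝ, sgn (mix (1 / 2) q) = sgn (q.1 + q.2) := fun q => by
    rw [mix, show (1 : ℝ) - 1 / 2 = 1 / 2 by norm_num, ← mul_add, sgn_mul_pos hpos]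
  have hm : ∀ g : ℝ × ℝ → ℝ, Measurable g → Measurable fun q : ℝ × ℝ => sgn (g q) :=
    fun g hg => measurable_sgn.comp hg
  have hrefl : MeasurePreserving (fun q : ℝ × ℝ => (q.1, -q.2)) gaussPair gaussPair :=
    (MeasurePreserving.id stdGauss).prod measurePreserving_neg_stdGauss
  have hbd : ∀ a b : ℝ, |sgn a * sgn b| ≤ 1 := fun a b => by
    rw [abs_mul]; exact mul_le_one₀ (abs_sgn_le a) (abs_nonneg _) (abs_sgn_le b)
  have m1 : Measurable fun q : ℝ × ℝ => sgn q.1 * sgn (q.1 + q.2) :=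
    (hm _ measurable_fst).mul (hm _ (by fun_prop))
  have m2 : Measurable fun q : ℝ × ℝ => sgn q.1 * sgn (q.1 - q.2) :=
    (hm _ measurable_fst).mul (hm _ (by fun_prop))
  have i1 : Integrable (fun q : ℝ × ℝ => sgn q.1 * sgn (q.1 + q.2)) gaussPair :=
    integrable_of_abs_le m1 1 fun q => hbd _ _
  have i2 : Integrable (fun q : ℝ × ℝ => sgn q.1 * sgn (q.1 - q.2)) gaussPair :=
    integrable_of_abs_le m2 1 fun q => hbd _ _
  have e2 : ∫ q, sgn q.1 * sgn (q.1 - q.2) ∂gaussPair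
      = ∫ q, sgn q.1 * sgn (q.1 + q.2) ∂gaussPair := by
    have := integral_map (μ := gaussPair) hrefl.measurable.aemeasurable
      (f := fun q : ℝ × ℝ => sgn q.1 * sgn (q.1 + q.2)) m1.aestronglyMeasurable
    rw [hrefl.map_eq] at this
    rw [this]; simp [sub_eq_add_neg]
  have e3 : 2 * signCorr (1 / 2)
      = ∫ q, sgn q.1 * (sgn (q.1 + q.2) + sgn (q.1 - q.2)) ∂gaussPair := by
    simp_rw [mul_add]
    rw [integral_add i1 i2, e2, signCorr]
    simp_rw [e1]; ring
  -- Any set of positive measure inside {|z| < |x|} would do; a rectangle has an explicit product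
  -- measure.
  set U : Set (ℝ × ℝ) := Set.Ioo 1 2 ×ˢ Set.Ioo (0 : ℝ) 1 with hU
  have hUm : MeasurableSet U := measurableSet_Ioo.prod measurableSet_Ioo
  have hIoo : ∀ a b : ℝ, a < b → 0 < stdGauss (Set.Ioo a b) := fun a b hab => by
    rw [pos_iff_ne_zero]
    intro h0
    have := gaussianReal_absolutelyContinuous' 0 (v := 1) one_ne_zero h0
    simp [hab.not_ge] at this
  have hUpos : 0 < gaussPair.real U := by
    rw [measureReal_def, Measure.prod_prod, ENNReal.toReal_mul]
    exact mul_pos (ENNReal.toReal_pos (hIoo _ _ one_lt_two).ne' (measure_ne_top _ _))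
      (ENNReal.toReal_pos (hIoo _ _ one_pos).ne' (measure_ne_top _ _))
  have h4 : ∫ q, U.indicator (fun _ => (2 : ℝ)) q ∂gaussPair ≤ 2 * signCorr (1 / 2) := by
    rw [e3]
    refine integral_mono ((integrable_const _).indicator hUm) ?_ fun q => ?_
    · simp_rw [mul_add]; exact i1.add i2
    · by_cases hq : q ∈ U
      · have h1 := hq.1; have h2 := hq.2
        simp only [Set.mem_Ioo] at h1 h2
        rw [Set.indicator_of_mem hq]
        refine (sgn_mul_add_sgn_eq_two ?_).ge
        rw [abs_of_pos h2.1, abs_of_pos (by linarith [h1.1])]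
        linarith [h1.1, h2.2]
      · rw [Set.indicator_of_notMem hq]; exact sgn_mul_add_sgn_nonneg _ _
  rw [integral_indicator hUm] at h4
  simp at h4
  linarith

/-! ### Elementary symmetric polynomials -/

/-- The elementary symmetric polynomial of degree `d`, evaluated at a real vector. -/
def elemSymm (d : ℕ) {α : Type*} [Fintype α] (y : α → ℝ) : ℝ :=
  ∑ S ∈ Finset.powersetCard d Finset.univ, ∏ a ∈ S, y a

section Combinatorics

variable {α : Type*} [Fintype α]

lemma elemSymm_eq_eval (d : ℕ) (y : α → ℝ) :
    elemSymm d y = MvPolynomial.eval y (MvPolynomial.esymm α ℝ d) := by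
  simp [elemSymm, MvPolynomial.esymm]

lemma elemSymm_comp_equiv (d : ℕ) (y : α → ℝ) (σ : Equiv.Perm α) :
    elemSymm d (fun a => y (σ a)) = elemSymm d y := by
  rw [elemSymm_eq_eval, elemSymm_eq_eval]
  conv_rhs => rw [← MvPolynomial.rename_esymm α ℝ d σ, MvPolynomial.eval_rename]
  rfl

/-- The sum of a product over injective tuples is a multiple of an elementary symmetric
polynomial. -/
lemma sum_injective_prod [DecidableEq α] (d : ℕ) (y : α → ℝ) :
    ∑ i : Fin d → α, (if Function.Injective i then ∏ k, y (i k) else 0)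
      = (d.factorial : ℝ) * elemSymm d y := by
  classical
  rw [← Finset.sum_filter]
  have hmaps : ∀ i ∈ (Finset.univ : Finset (Fin d → α)).filter Function.Injective,
      Finset.univ.image i ∈ Finset.powersetCard d (Finset.univ : Finset α) := by
    intro i hi
    rw [Finset.mem_powersetCard]
    refine ⟨Finset.subset_univ _, ?_⟩
    rw [Finset.card_image_of_injective _ (Finset.mem_filter.1 hi).2]
    simp
  rw [← Finset.sum_fiberwise_of_maps_to hmaps, elemSymm, Finset.mul_sum]
  refine Finset.sum_congr rfl fun S hS => ?_
  have hScard : S.card = d := (Finset.mem_powersetCard.1 hS).2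
  have h1 : ∀ i ∈ ((Finset.univ : Finset (Fin d → α)).filter Function.Injective).filter
      (fun i => Finset.univ.image i = S), ∏ k, y (i k) = ∏ a ∈ S, y a := by
    intro i hi
    simp only [Finset.mem_filter, Finset.mem_univ, true_and] at hi
    rw [← hi.2, Finset.prod_image fun a _ b _ h => hi.1 h]
  rw [Finset.sum_congr rfl h1, Finset.sum_const, nsmul_eq_mul]
  congr 2
  have h2 : Fintype.card (Fin d ↪ S) = d.factorial := by
    rw [Fintype.card_embedding_eq]; simp [hScard, Nat.descFactorial_self]
  rw [← h2, ← Finset.card_univ]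
  symm
  refine Finset.card_bij (fun e _ k => (e k : α)) ?_ ?_ ?_
  · intro e _
    simp only [Finset.mem_filter, Finset.mem_univ, true_and]
    have hinj : Function.Injective fun k => (e k : α) :=
      Subtype.val_injective.comp e.injective
    refine ⟨hinj, Finset.eq_of_subset_of_card_le ?_ ?_⟩
    · intro a ha
      obtain ⟨k, _, rfl⟩ := Finset.mem_image.1 ha
      exact (e k).2
    · rw [Finset.card_image_of_injective _ hinj]; simp [hScard]
  · intro e _ e' _ h
    ext k
    exact congrFun h k
  · intro i hi
    simp only [Finset.mem_filter, Finset.mem_univ, true_and] at hi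
    have hmem : ∀ k, i k ∈ S := fun k => by
      rw [← hi.2]; exact Finset.mem_image_of_mem _ (Finset.mem_univ k)
    exact ⟨⟨fun k => ⟨i k, hmem k⟩, fun a b h => hi.1 (congrArg Subtype.val h)⟩,
      Finset.mem_univ _, rfl⟩

/-- For nonnegative entries, dropping the non-injective tuples from the expanded power only
decreases it. Applied to the squares of a vector in the unit ball, this gives the variance bound
under the null law. -/
lemma sum_injective_le (d : ℕ) [DecidableEq α] {y : α → ℝ} (hy : ∀ a, 0 ≤ y a) :
    (d.factorial : ℝ) * elemSymm d y ≤ (∑ a, y a) ^ d := by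
  rw [← sum_injective_prod, Fintype.sum_pow]
  refine Finset.sum_le_sum fun i _ => ?_
  split_ifs
  · exact le_rfl
  · exact Finset.prod_nonneg fun k _ => hy _

/-- For vectors with entries in `{-1, 0, 1}`, the elementary symmetric polynomials are controlled by
the sum of the entries. -/
lemma abs_elemSymm_le {y : α → ℝ} (hy : ∀ a, y a ^ 3 = y a) {M : ℝ} (hM : 1 ≤ M)
    (h1 : |∑ a, y a| ≤ M) (h2 : (Fintype.card α : ℝ) ≤ M ^ 2) (d : ℕ) :
    |elemSymm d y| ≤ M ^ d := by
  classical
  have hM0 : 0 ≤ M := zero_le_one.trans hM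
  have hy' : ∀ a, y a ^ 2 ≤ 1 := fun a => by
    have h := hy a
    have : y a * (y a - 1) * (y a + 1) = 0 := by linear_combination h
    rcases mul_eq_zero.1 this with h | h
    · rcases mul_eq_zero.1 h with h | h
      · simp [h]
      · rw [show y a = 1 by linarith]; norm_num
    · rw [show y a = -1 by linarith]; norm_num
  -- Since y³ = y, every odd power sum equals the sum of the entries, and every even one is at most
  -- the number of entries, hence at most M².
  have hps : ∀ i, 1 ≤ i → |∑ a, y a ^ i| ≤ M ^ i := by
    intro i hi
    rcases Nat.even_or_odd' i with ⟨j, rfl | rfl⟩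
    · calc |∑ a, y a ^ (2 * j)| ≤ ∑ a : α, (1 : ℝ) := by
            refine (Finset.abs_sum_le_sum_abs _ _).trans (Finset.sum_le_sum fun a _ => ?_)
            rw [pow_mul, abs_of_nonneg (by positivity)]
            exact pow_le_one₀ (by positivity) (hy' a)
        _ ≤ M ^ 2 := by simpa using h2
        _ ≤ M ^ (2 * j) := pow_le_pow_right₀ hM (by omega)
    · have : ∀ a, y a ^ (2 * j + 1) = y a := by
        intro a
        clear hi
        induction j with
        | zero => simp
        | succ j ih =>
          rw [show 2 * (j + 1) + 1 = (2 * j + 1) + 2 by ring, pow_add, ih, ← pow_succ']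
          exact hy a
      simp_rw [this]
      exact h1.trans (le_self_pow₀ hM (by omega))
  induction d using Nat.strong_induction_on with
  | _ d ih =>
    rcases Nat.eq_zero_or_pos d with rfl | hd
    · simp [elemSymm]
    -- Newton's identity writes d e_d as a signed sum of d products of some e_i with i < d and a
    -- power sum of order d - i. By induction each product is at most M^d, and the factor d cancels.
    have newton := congrArg (MvPolynomial.eval y) (MvPolynomial.mul_esymm_eq_sum α ℝ d)
    simp only [map_mul, map_natCast, ← elemSymm_eq_eval, map_sum, map_pow, map_neg, map_one,
      MvPolynomial.psum, MvPolynomial.eval_X] at newton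
    have hcard : ((Finset.HasAntidiagonal.antidiagonal d).filter (fun a => a.1 < d)).card = d := by
      have : (Finset.HasAntidiagonal.antidiagonal d).filter (fun a => a.1 < d)
          = (Finset.range d).map ⟨fun k => (k, d - k), fun a b h => (Prod.mk.inj h).1⟩ := by
        ext ⟨a, b⟩
        simp only [Finset.mem_filter, Finset.HasAntidiagonal.mem_antidiagonal, Finset.mem_map, Finset.mem_range]
        constructor
        · rintro ⟨h, h'⟩; exact ⟨a, h', Prod.ext rfl (show d - a = b by omega)⟩
        · rintro ⟨c, hc, h⟩
          obtain ⟨rfl, rfl⟩ := Prod.mk.inj h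
          omega
      rw [this]; simp
    have h3 : (d : ℝ) * |elemSymm d y| ≤ d * M ^ d := by
      rw [← abs_of_nonneg (Nat.cast_nonneg d : (0 : ℝ) ≤ d), ← abs_mul, newton, abs_mul, abs_pow,
        abs_neg, abs_one, one_pow, one_mul, abs_of_nonneg (Nat.cast_nonneg d : (0 : ℝ) ≤ d)]
      refine (Finset.abs_sum_le_sum_abs _ _).trans ?_
      calc _ ≤ ∑ a ∈ (Finset.HasAntidiagonal.antidiagonal d).filter (fun a => a.1 < d), M ^ d := by
            refine Finset.sum_le_sum fun a ha => ?_
            simp only [Finset.mem_filter, Finset.HasAntidiagonal.mem_antidiagonal] at ha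
            rw [abs_mul, abs_mul, abs_pow, abs_neg, abs_one, one_pow, one_mul, ← ha.1, pow_add]
            exact mul_le_mul (ih _ ha.2) (hps _ (by omega)) (abs_nonneg _) (by positivity)
        _ = d * M ^ d := by rw [Finset.sum_const, hcard, nsmul_eq_mul]
    exact le_of_mul_le_mul_left h3 (by exact_mod_cast hd)

end Combinatorics

/-! ### Exponential moments and orthogonality of sign polynomials -/

/-- Subgaussian bound for the exponential moment of a bounded centred variable. -/
lemma integral_exp_le {Ω : Type*} [MeasurableSpace Ω] {μ : Measure Ω} [IsProbabilityMeasure μ]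
    {X : Ω → ℝ} (hm : Measurable X) (hb : ∀ x, |X x| ≤ 1) (h0 : ∫ x, X x ∂μ = 0) {V : ℝ}
    (hV : ∫ x, X x ^ 2 ∂μ ≤ V) : ∫ x, Real.exp (X x) ∂μ ≤ Real.exp V := by
  have i1 : Integrable X μ := integrable_of_abs_le hm 1 hb
  have i2 : Integrable (fun x => X x ^ 2) μ :=
    integrable_of_abs_le (hm.pow_const 2) 1 fun x => by
      rw [abs_pow]; exact pow_le_one₀ (abs_nonneg _) (hb x)
  -- The pointwise bound e^x ≤ 1 + x + x² holds for |x| ≤ 1; the linear term integrates to zero.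
  calc ∫ x, Real.exp (X x) ∂μ ≤ ∫ x, (1 + X x + X x ^ 2) ∂μ := by
        refine integral_mono (integrable_of_abs_le hm.exp (Real.exp 1) fun x => ?_)
          (((integrable_const _).add i1).add i2) fun x => ?_
        · rw [Real.abs_exp]; exact Real.exp_le_exp.2 (abs_le.1 (hb x)).2
        · have := (abs_le.1 (Real.abs_exp_sub_one_sub_id_le (hb x))).2
          simp only; linarith
    _ = 1 + ∫ x, X x ^ 2 ∂μ := by
        have i3 : Integrable (fun x => 1 + X x) μ := (integrable_const _).add i1
        rw [integral_add i3 i2, integral_add (integrable_const _) i1, h0]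
        simp
    _ ≤ 1 + V := by linarith
    _ ≤ Real.exp V := by linarith [Real.add_one_le_exp V]

/-- Homogeneous multilinear polynomial in the variables `s (x a)` with product coefficients. -/
def signPoly (d : ℕ) {α Ω : Type*} [Fintype α] (u : α → ℝ) (s : Ω → ℝ) (x : α → Ω) : ℝ :=
  elemSymm d fun a => u a * s (x a)

section SignPoly

variable {α Ω : Type*} [Fintype α]

lemma signPoly_eq_sum (d : ℕ) (u : α → ℝ) (s : Ω → ℝ) (x : α → Ω) :
    signPoly d u s x
      = ∑ S ∈ Finset.powersetCard d Finset.univ, (∏ a ∈ S, u a) * ∏ a ∈ S, s (x a) := by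
  simp [signPoly, elemSymm, Finset.prod_mul_distrib]

lemma abs_elemSymm_le_choose (d : ℕ) {y : α → ℝ} (hy : ∀ a, |y a| ≤ 1) :
    |elemSymm d y| ≤ (Fintype.card α).choose d := by
  refine (Finset.abs_sum_le_sum_abs _ _).trans ?_
  calc _ ≤ ∑ S ∈ Finset.powersetCard d (Finset.univ : Finset α), (1 : ℝ) := by
        refine Finset.sum_le_sum fun S _ => ?_
        rw [Finset.abs_prod]
        exact Finset.prod_le_one (fun a _ => abs_nonneg _) fun a _ => hy a
    _ = _ := by simp [Finset.card_powersetCard]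

lemma abs_signPoly_le (d : ℕ) {u : α → ℝ} (hu : ∀ a, |u a| ≤ 1) {s : Ω → ℝ}
    (hs : ∀ q, |s q| ≤ 1) (x : α → Ω) : |signPoly d u s x| ≤ (Fintype.card α).choose d :=
  abs_elemSymm_le_choose d fun a => by
    rw [abs_mul]; exact mul_le_one₀ (hu a) (abs_nonneg _) (hs _)

variable [MeasurableSpace Ω]

lemma measurable_signPoly (d : ℕ) (u : α → ℝ) {s : Ω → ℝ} (hs : Measurable s) :
    Measurable (signPoly d u s) := by
  unfold signPoly elemSymm
  refine Finset.measurable_fun_sum _ fun S _ => Finset.measurable_fun_prod _ fun a _ => ?_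
  exact measurable_const.mul (hs.comp (measurable_pi_apply a))

variable {μ : Measure Ω} [IsProbabilityMeasure μ]

/-- A product of functions of the coordinates that omits some coordinate of `S` is orthogonal to the
product over `S` of centred variables. -/
lemma integral_prod_mul_prod_eq_zero [DecidableEq α] {s : Ω → ℝ} (h0 : ∫ q, s q ∂μ = 0)
    (f : α → Ω → ℝ) (S : Finset α) {a : α} (ha : a ∈ S) (hfa : ∀ q, f a q = 1) :
    ∫ x, (∏ b, f b (x b)) * ∏ b ∈ S, s (x b) ∂(Measure.pi fun _ : α => μ) = 0 := by
  have h : ∀ x : α → Ω, (∏ b, f b (x b)) * ∏ b ∈ S, s (x b)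
      = ∏ b, (fun q => f b q * if b ∈ S then s q else 1) (x b) := fun x => by
    rw [Finset.prod_mul_distrib, Finset.prod_ite_mem, Finset.univ_inter]
  rw [integral_congr_ae (ae_of_all _ h), integral_fintype_prod_eq_prod fun b q =>
    f b q * if b ∈ S then s q else 1]
  exact Finset.prod_eq_zero (Finset.mem_univ a) (by simp [ha, hfa, h0])

/-- By independence the integral factorizes over the coordinates, and a coordinate in exactly one of
the two sets contributes a vanishing mean. The lemma is used at two levels: for the signs of the
coordinates of a sample, and for the tilts of the samples. -/
lemma integral_prod_mul_prod [DecidableEq α] {s s' : Ω → ℝ} (h0 : ∫ q, s q ∂μ = 0)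
    (h0' : ∫ q, s' q ∂μ = 0) (S S' : Finset α) :
    ∫ x, (∏ b ∈ S, s (x b)) * ∏ b ∈ S', s' (x b) ∂(Measure.pi fun _ : α => μ)
      = if S = S' then (∫ q, s q * s' q ∂μ) ^ S.card else 0 := by
  have h : ∀ x : α → Ω, (∏ b ∈ S, s (x b)) * ∏ b ∈ S', s' (x b)
      = ∏ b, (fun q => (if b ∈ S then s q else 1) * if b ∈ S' then s' q else 1) (x b) :=
    fun x => by
      rw [Finset.prod_mul_distrib, Finset.prod_ite_mem, Finset.univ_inter, Finset.prod_ite_mem,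
        Finset.univ_inter]
  rw [integral_congr_ae (ae_of_all _ h), integral_fintype_prod_eq_prod fun b q =>
    (if b ∈ S then s q else 1) * if b ∈ S' then s' q else 1]
  split_ifs with hS
  · subst hS
    have : ∀ b, (∫ q, (if b ∈ S then s q else 1) * (if b ∈ S then s' q else 1) ∂μ)
        = if b ∈ S then ∫ q, s q * s' q ∂μ else 1 := fun b => by split_ifs <;> simp
    simp_rw [this]
    simp [Finset.prod_ite_mem]
  · by_cases hsub : S ⊆ S'
    · obtain ⟨a, ha, ha'⟩ : ∃ a ∈ S', a ∉ S := by
        by_contra hcon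
        push Not at hcon
        exact hS (hsub.antisymm hcon)
      exact Finset.prod_eq_zero (Finset.mem_univ a) (by simp [ha, ha', h0'])
    · obtain ⟨a, ha, ha'⟩ := Finset.not_subset.1 hsub
      exact Finset.prod_eq_zero (Finset.mem_univ a) (by simp [ha, ha', h0])

lemma integrable_prod_apply {s : Ω → ℝ} (hm : Measurable s) (hs : ∀ q, |s q| ≤ 1) (S : Finset α) :
    Integrable (fun x : α → Ω => ∏ b ∈ S, s (x b)) (Measure.pi fun _ : α => μ) := by
  refine integrable_of_abs_le (Finset.measurable_fun_prod _ fun a _ =>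
    hm.comp (measurable_pi_apply a)) 1 fun x => ?_
  rw [Finset.abs_prod]
  exact Finset.prod_le_one (fun a _ => abs_nonneg _) fun a _ => hs _

/-- The covariance of two sign polynomials. -/
lemma integral_signPoly_mul_signPoly {s s' : Ω → ℝ} (hm : Measurable s) (hm' : Measurable s')
    (hs : ∀ q, |s q| ≤ 1) (hs' : ∀ q, |s' q| ≤ 1) (h0 : ∫ q, s q ∂μ = 0)
    (h0' : ∫ q, s' q ∂μ = 0) (d : ℕ) (u u' : α → ℝ) :
    ∫ x, signPoly d u s x * signPoly d u' s' x ∂(Measure.pi fun _ : α => μ)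
      = (∫ q, s q * s' q ∂μ) ^ d * elemSymm d fun a => u a * u' a := by
  classical
  have hint : ∀ S S' : Finset α, Integrable (fun x : α → Ω =>
      ((∏ a ∈ S, u a) * ∏ a ∈ S, s (x a)) * ((∏ a ∈ S', u' a) * ∏ a ∈ S', s' (x a)))
      (Measure.pi fun _ : α => μ) := fun S S' => by
    refine ((integrable_prod_apply hm hs S).const_mul _).mul_bdd
      (c := |∏ a ∈ S', u' a|) ?_ (ae_of_all _ fun x => ?_)
    · exact ((integrable_prod_apply hm' hs' S').const_mul _).aestronglyMeasurable
    · rw [Real.norm_eq_abs, abs_mul, Finset.abs_prod S' (fun a => s' (x a))]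
      exact mul_le_of_le_one_right (abs_nonneg _)
        (Finset.prod_le_one (fun a _ => abs_nonneg _) fun a _ => hs' _)
  simp_rw [signPoly_eq_sum, Finset.sum_mul_sum]
  rw [integral_finsetSum _ fun S _ => integrable_finsetSum _ fun S' _ => hint S S']
  rw [elemSymm, Finset.mul_sum]
  refine Finset.sum_congr rfl fun S hS => ?_
  rw [integral_finsetSum _ fun S' _ => hint S S', Finset.sum_eq_single_of_mem S hS]
  · simp_rw [mul_mul_mul_comm]
    rw [integral_const_mul, integral_prod_mul_prod h0 h0' S S, if_pos rfl,
      (Finset.mem_powersetCard.1 hS).2, Finset.prod_mul_distrib, mul_comm]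
  · intro S' _ hne
    simp_rw [mul_mul_mul_comm]
    rw [integral_const_mul, integral_prod_mul_prod h0 h0' S S', if_neg hne.symm, mul_zero]

/-- A product of functions of the coordinates that involves fewer than `d` coordinates is orthogonal
to a sign polynomial of degree `d`. -/
lemma integral_prod_mul_signPoly_eq_zero {s : Ω → ℝ} (hm : Measurable s) (hs : ∀ q, |s q| ≤ 1)
    (h0 : ∫ q, s q ∂μ = 0) (d : ℕ) (u : α → ℝ) (f : α → Ω → ℝ) (hf : ∀ a, Integrable (f a) μ)
    (T : Finset α) (hT : T.card < d) (hfT : ∀ a ∉ T, ∀ q, f a q = 1) :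
    ∫ x, (∏ b, f b (x b)) * signPoly d u s x ∂(Measure.pi fun _ : α => μ) = 0 := by
  classical
  have hint : ∀ S : Finset α, Integrable (fun x : α → Ω =>
      (∏ b, f b (x b)) * ((∏ a ∈ S, u a) * ∏ a ∈ S, s (x a))) (Measure.pi fun _ : α => μ) := by
    intro S
    refine (Integrable.fintype_prod hf).mul_bdd (c := |∏ a ∈ S, u a|)
      ((integrable_prod_apply hm hs S).const_mul _).aestronglyMeasurable (ae_of_all _ fun x => ?_)
    rw [Real.norm_eq_abs, abs_mul, Finset.abs_prod S (fun a => s (x a))]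
    exact mul_le_of_le_one_right (abs_nonneg _)
      (Finset.prod_le_one (fun a _ => abs_nonneg _) fun a _ => hs _)
  simp_rw [signPoly_eq_sum, Finset.mul_sum]
  rw [integral_finsetSum _ fun S _ => hint S]
  refine Finset.sum_eq_zero fun S hS => ?_
  obtain ⟨a, ha, haT⟩ : ∃ a ∈ S, a ∉ T := by
    by_contra hcon
    push Not at hcon
    have := Finset.card_le_card (show S ⊆ T from hcon)
    rw [(Finset.mem_powersetCard.1 hS).2] at this
    omega
  simp_rw [mul_left_comm]
  rw [integral_const_mul, integral_prod_mul_prod_eq_zero h0 f S ha (hfT a haT), mul_zero]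

lemma integral_signPoly_eq_zero {s : Ω → ℝ} (hm : Measurable s) (hs : ∀ q, |s q| ≤ 1)
    (h0 : ∫ q, s q ∂μ = 0) {d : ℕ} (hd : 0 < d) (u : α → ℝ) :
    ∫ x, signPoly d u s x ∂(Measure.pi fun _ : α => μ) = 0 := by
  have := integral_prod_mul_signPoly_eq_zero (μ := μ) hm hs h0 d u (fun _ _ => 1)
    (fun _ => integrable_const _) ∅ (by simpa using hd) (by simp)
  simpa using this

end SignPoly

/-! ### The planted law and its likelihood ratio -/

/-- The standard Gaussian law on `ℝ ^ p`. -/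
abbrev gaussVec (p : ℕ) : Measure (Fin p → ℝ) := Measure.pi fun _ => stdGauss

instance (n p : ℕ) : IsProbabilityMeasure (nullLaw n p) := by unfold nullLaw; infer_instance

/-- Perturbation of the Gaussian density of a sample with hidden parameter `θ`. -/
def tilt (d : ℕ) {p : ℕ} (ω : ℝ) (θ x : Fin p → ℝ) : ℝ :=
  ω * signPoly d (fun a => sgn (θ a)) sgn x

/-- The law of a sample with hidden parameter `θ`. -/
def tiltKernel (d p : ℕ) (ω : ℝ) : Kernel (Fin p → ℝ) (Fin p → ℝ) :=
  (Kernel.const _ (gaussVec p)).withDensity fun θ x => ENNReal.ofReal (1 + tilt d ω θ x)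

/-- The likelihood ratio of `n` samples with hidden parameter `θ`. -/
def likelihood (d n p : ℕ) (ω : ℝ) (θ : Fin p → ℝ) (Y : Fin n → Fin p → ℝ) : ℝ :=
  ∏ j, (1 + tilt d ω θ (Y j))

section Planted

variable {d n p : ℕ} {ω : ℝ}

lemma measurable_tilt_uncurry (d p : ℕ) (ω : ℝ) :
    Measurable fun q : (Fin p → ℝ) × (Fin p → ℝ) => tilt d ω q.1 q.2 := by
  unfold tilt signPoly elemSymm
  refine measurable_const.mul (Finset.measurable_fun_sum _ fun S _ =>
    Finset.measurable_fun_prod _ fun a _ => ?_)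
  exact (measurable_sgn.comp ((measurable_pi_apply a).comp measurable_fst)).mul
    (measurable_sgn.comp ((measurable_pi_apply a).comp measurable_snd))

lemma measurable_tilt (d : ℕ) {p : ℕ} (ω : ℝ) (θ : Fin p → ℝ) : Measurable (tilt d ω θ) :=
  Measurable.of_uncurry_left (f := tilt d ω) (measurable_tilt_uncurry d p ω)

/-- The sign polynomial has `p.choose d` monomials, each of modulus at most 1. The density therefore
lies between 0 and 2. -/
lemma abs_tilt_le (h0 : 0 ≤ ω) (h1 : ω * p.choose d ≤ 1) (θ x : Fin p → ℝ) :
    |tilt d ω θ x| ≤ 1 := by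
  rw [tilt, abs_mul, abs_of_nonneg h0]
  refine (mul_le_mul_of_nonneg_left ?_ h0).trans h1
  simpa using abs_signPoly_le d (fun a => abs_sgn_le (θ a)) abs_sgn_le x

lemma one_add_tilt_nonneg (h0 : 0 ≤ ω) (h1 : ω * p.choose d ≤ 1) (θ x : Fin p → ℝ) :
    0 ≤ 1 + tilt d ω θ x := by
  linarith [(abs_le.1 (abs_tilt_le h0 h1 θ x)).1]

lemma one_add_tilt_le (h0 : 0 ≤ ω) (h1 : ω * p.choose d ≤ 1) (θ x : Fin p → ℝ) :
    1 + tilt d ω θ x ≤ 2 := by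
  linarith [(abs_le.1 (abs_tilt_le h0 h1 θ x)).2]

lemma integrable_tilt (h0 : 0 ≤ ω) (h1 : ω * p.choose d ≤ 1) (θ : Fin p → ℝ) :
    Integrable (tilt d ω θ) (gaussVec p) :=
  integrable_of_abs_le (measurable_tilt d ω θ) 1 (abs_tilt_le h0 h1 θ)

lemma integral_tilt (hd : 0 < d) (θ : Fin p → ℝ) : ∫ x, tilt d ω θ x ∂(gaussVec p) = 0 := by
  simp only [tilt]
  rw [integral_const_mul, integral_signPoly_eq_zero measurable_sgn abs_sgn_le integral_sgn hd,
    mul_zero]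

lemma integral_tilt_mul_tilt (θ θ' : Fin p → ℝ) :
    ∫ x, tilt d ω θ x * tilt d ω θ' x ∂(gaussVec p)
      = ω ^ 2 * elemSymm d fun a => sgn (θ a) * sgn (θ' a) := by
  simp only [tilt]
  simp_rw [mul_mul_mul_comm]
  rw [integral_const_mul, integral_signPoly_mul_signPoly measurable_sgn measurable_sgn abs_sgn_le
    abs_sgn_le integral_sgn integral_sgn, integral_sgn_mul_self]
  ring

lemma tiltKernel_apply (θ : Fin p → ℝ) :
    tiltKernel d p ω θ
      = (gaussVec p).withDensity fun x => ENNReal.ofReal (1 + tilt d ω θ x) := by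
  rw [tiltKernel, Kernel.withDensity_apply, Kernel.const_apply]
  exact ENNReal.measurable_ofReal.comp ((measurable_tilt_uncurry d p ω).const_add 1)

lemma isMarkovKernel_tiltKernel (hd : 0 < d) (h0 : 0 ≤ ω) (h1 : ω * p.choose d ≤ 1) :
    IsMarkovKernel (tiltKernel d p ω) := by
  refine ⟨fun θ => ⟨?_⟩⟩
  have hi : Integrable (fun x => 1 + tilt d ω θ x) (gaussVec p) :=
    (integrable_const 1).add (integrable_tilt h0 h1 θ)
  rw [tiltKernel_apply, withDensity_apply _ MeasurableSet.univ, setLIntegral_univ,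
    ← ofReal_integral_eq_lintegral_ofReal hi (ae_of_all _ (one_add_tilt_nonneg h0 h1 θ))]
  rw [integral_add (integrable_const 1) (integrable_tilt h0 h1 θ), integral_tilt hd]
  simp

/-- A product of measures with densities has the product density. -/
lemma pi_withDensity_ofReal {ι Ω : Type*} [Fintype ι] [MeasurableSpace Ω] (μ : Measure Ω)
    [IsProbabilityMeasure μ] {f : Ω → ℝ} (hf0 : ∀ x, 0 ≤ f x)
    (hfi : Integrable f μ) :
    Measure.pi (fun _ : ι => μ.withDensity fun x => ENNReal.ofReal (f x))
      = (Measure.pi fun _ : ι => μ).withDensity fun Y => ENNReal.ofReal (∏ j, f (Y j)) := by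
  have : IsFiniteMeasure (μ.withDensity fun x => ENNReal.ofReal (f x)) :=
    isFiniteMeasure_withDensity_ofReal hfi.2
  refine Measure.pi_eq fun s hs => ?_
  have hi : ∀ j, Integrable ((s j).indicator f) μ := fun j => hfi.indicator (hs j)
  have h0 : ∀ j x, 0 ≤ (s j).indicator f x := fun j x =>
    Set.indicator_nonneg (fun x _ => hf0 x) x
  have hind : ∀ Y : ι → Ω, (Set.univ.pi s).indicator (fun Y => ENNReal.ofReal (∏ j, f (Y j))) Y
      = ENNReal.ofReal (∏ j, (s j).indicator f (Y j)) := fun Y => by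
    by_cases hY : Y ∈ Set.univ.pi s
    · rw [Set.indicator_of_mem hY]
      congr 1
      exact Finset.prod_congr rfl fun j _ => (Set.indicator_of_mem (hY j trivial) _).symm
    · rw [Set.indicator_of_notMem hY]
      simp only [Set.mem_pi, Set.mem_univ, forall_true_left, not_forall] at hY
      obtain ⟨j, hj⟩ := hY
      rw [Finset.prod_eq_zero (Finset.mem_univ j) (Set.indicator_of_notMem hj _)]
      simp
  rw [withDensity_apply _ (MeasurableSet.univ_pi hs), ← lintegral_indicator
    (MeasurableSet.univ_pi hs), lintegral_congr hind,
    ← ofReal_integral_eq_lintegral_ofReal (Integrable.fintype_prod hi)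
      (ae_of_all _ fun Y => Finset.prod_nonneg fun j _ => h0 j _),
    integral_fintype_prod_eq_prod,
    ENNReal.ofReal_prod_of_nonneg fun j _ => integral_nonneg (h0 j)]
  refine Finset.prod_congr rfl fun j _ => ?_
  rw [withDensity_apply _ (hs j), ← lintegral_indicator (hs j),
    ofReal_integral_eq_lintegral_ofReal (hi j) (ae_of_all _ (h0 j))]
  refine lintegral_congr fun x => ?_
  by_cases hx : x ∈ s j
  · rw [Set.indicator_of_mem hx, Set.indicator_of_mem hx]
  · rw [Set.indicator_of_notMem hx, Set.indicator_of_notMem hx, ENNReal.ofReal_zero]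

lemma pi_tiltKernel (h0 : 0 ≤ ω) (h1 : ω * p.choose d ≤ 1) (θ : Fin p → ℝ) :
    Measure.pi (fun _ : Fin n => tiltKernel d p ω θ)
      = (nullLaw n p).withDensity fun Y => ENNReal.ofReal (likelihood d n p ω θ Y) := by
  rw [tiltKernel_apply]
  exact pi_withDensity_ofReal _ (one_add_tilt_nonneg h0 h1 θ) ((integrable_const 1).add (integrable_tilt h0 h1 θ))

lemma measurable_likelihood_uncurry (d n p : ℕ) (ω : ℝ) :
    Measurable fun q : (Fin p → ℝ) × (Fin n → Fin p → ℝ) => likelihood d n p ω q.1 q.2 := by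
  unfold likelihood
  refine Finset.measurable_fun_prod _ fun j _ => measurable_const.add ?_
  have h : Measurable fun q : (Fin p → ℝ) × (Fin n → Fin p → ℝ) => (q.1, q.2 j) := by fun_prop
  have h' := (measurable_tilt_uncurry d p ω).comp h
  simp only [Function.comp_def] at h'
  exact h'

lemma measurable_likelihood (θ : Fin p → ℝ) :
    Measurable (likelihood d n p ω θ) :=
  Measurable.of_uncurry_left (f := likelihood d n p ω) (measurable_likelihood_uncurry d n p ω)

lemma measurable_likelihood_left (Y : Fin n → Fin p → ℝ) :
    Measurable fun θ => likelihood d n p ω θ Y :=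
  Measurable.of_uncurry_right (f := likelihood d n p ω) (measurable_likelihood_uncurry d n p ω)

lemma likelihood_nonneg (h0 : 0 ≤ ω) (h1 : ω * p.choose d ≤ 1) (θ : Fin p → ℝ)
    (Y : Fin n → Fin p → ℝ) : 0 ≤ likelihood d n p ω θ Y :=
  Finset.prod_nonneg fun j _ => one_add_tilt_nonneg h0 h1 θ (Y j)

lemma abs_likelihood_le (h0 : 0 ≤ ω) (h1 : ω * p.choose d ≤ 1) (θ : Fin p → ℝ)
    (Y : Fin n → Fin p → ℝ) : |likelihood d n p ω θ Y| ≤ 2 ^ n := by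
  rw [abs_of_nonneg (likelihood_nonneg h0 h1 θ Y), likelihood]
  refine (Finset.prod_le_prod (fun j _ => one_add_tilt_nonneg h0 h1 θ (Y j))
    fun j _ => one_add_tilt_le h0 h1 θ (Y j)).trans ?_
  simp

/-- The planted law is a `bind`, whose integration formula requires this measurability; it is read
off from the joint measurability of the likelihood ratio. -/
lemma measurable_pi_tiltKernel (h0 : 0 ≤ ω) (h1 : ω * p.choose d ≤ 1) :
    Measurable fun θ => Measure.pi fun _ : Fin n => tiltKernel d p ω θ := by
  refine Measure.measurable_of_measurable_coe _ fun s hs => ?_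
  simp_rw [pi_tiltKernel h0 h1, withDensity_apply _ hs]
  exact Measurable.lintegral_prod_right'
    (ENNReal.measurable_ofReal.comp (measurable_likelihood_uncurry d n p ω))

lemma lintegral_plantedLaw (h0 : 0 ≤ ω) (h1 : ω * p.choose d ≤ 1)
    {g : (Fin n → Fin p → ℝ) → ENNReal} (hg : Measurable g) :
    ∫⁻ Y, g Y ∂(plantedLaw n p (gaussVec p) (tiltKernel d p ω))
      = ∫⁻ θ, ∫⁻ Y, ENNReal.ofReal (likelihood d n p ω θ Y) * g Y ∂(nullLaw n p) ∂(gaussVec p) := by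
  rw [plantedLaw, Measure.lintegral_bind (measurable_pi_tiltKernel h0 h1).aemeasurable
    hg.aemeasurable]
  refine lintegral_congr fun θ => ?_
  rw [pi_tiltKernel h0 h1, lintegral_withDensity_eq_lintegral_mul _ _ hg]
  · rfl
  · exact (measurable_likelihood θ).ennreal_ofReal

lemma measurePreserving_comp_perm {ι Ω : Type*} [Fintype ι] [MeasurableSpace Ω] (μ : Measure Ω)
    [SigmaFinite μ] (σ : Equiv.Perm ι) :
    MeasurePreserving (fun x : ι → Ω => fun a => x (σ a)) (Measure.pi fun _ => μ)
      (Measure.pi fun _ => μ) := by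
  refine ⟨by fun_prop, (Measure.pi_eq fun s hs => ?_).symm⟩
  rw [Measure.map_apply (by fun_prop) (MeasurableSet.univ_pi hs)]
  have : (fun x : ι → Ω => fun a => x (σ a)) ⁻¹' Set.univ.pi s
      = Set.univ.pi fun a => s (σ.symm a) := by
    ext x
    simp only [Set.mem_preimage, Set.mem_pi, Set.mem_univ, forall_true_left]
    exact ⟨fun h a => by simpa using h (σ.symm a), fun h a => by simpa using h (σ a)⟩
  rw [this, Measure.pi_pi]
  exact Equiv.prod_comp σ.symm fun a => μ (s a)

lemma likelihood_comp_perm (σ : Equiv.Perm (Fin p)) (θ : Fin p → ℝ) (Y : Fin n → Fin p → ℝ) :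
    likelihood d n p ω (fun a => θ (σ a)) (fun j a => Y j (σ a)) = likelihood d n p ω θ Y := by
  unfold likelihood tilt signPoly
  refine Finset.prod_congr rfl fun j _ => ?_
  rw [elemSymm_comp_equiv d (fun a => sgn (θ a) * sgn (Y j a)) σ]

/-- The likelihood ratio is unchanged when the coordinates of the samples and of θ are permuted
together, and both the prior and the null law are permutation invariant. -/
lemma coordInvariant_plantedLaw (h0 : 0 ≤ ω) (h1 : ω * p.choose d ≤ 1) :
    CoordInvariant (plantedLaw n p (gaussVec p) (tiltKernel d p ω)) := by
  intro σ
  have hS : Measurable fun (Y : Fin n → Fin p → ℝ) i j => Y i (σ j) := by fun_prop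
  have mY : MeasurePreserving (fun (Y : Fin n → Fin p → ℝ) i j => Y i (σ j))
      (nullLaw n p) (nullLaw n p) :=
    measurePreserving_pi _ _ fun _ => measurePreserving_comp_perm stdGauss σ
  have mθ := measurePreserving_comp_perm stdGauss σ
  refine Measure.ext_of_lintegral _ fun g hg => ?_
  have hgS : Measurable fun Y : Fin n → Fin p → ℝ => g fun i j => Y i (σ j) := hg.comp hS
  rw [lintegral_map hg hS, lintegral_plantedLaw h0 h1 hg, lintegral_plantedLaw h0 h1 hgS]
  have hm : ∀ θ, Measurable fun Y => ENNReal.ofReal (likelihood d n p ω θ Y) * g Y := fun θ =>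
    (measurable_likelihood θ).ennreal_ofReal.mul hg
  have hm2 : Measurable fun θ => ∫⁻ Y, ENNReal.ofReal (likelihood d n p ω θ Y) * g Y
      ∂(nullLaw n p) :=
    Measurable.lintegral_prod_right' (f := fun q : (Fin p → ℝ) × (Fin n → Fin p → ℝ) =>
      ENNReal.ofReal (likelihood d n p ω q.1 q.2) * g q.2)
      ((measurable_likelihood_uncurry d n p ω).ennreal_ofReal.mul (hg.comp measurable_snd))
  rw [← mθ.lintegral_comp hm2]
  refine lintegral_congr fun θ => ?_
  rw [← mY.lintegral_comp (hm _)]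
  simp_rw [likelihood_comp_perm]

/-- The likelihood ratio of the planted law. -/
def meanLikelihood (d n p : ℕ) (ω : ℝ) (Y : Fin n → Fin p → ℝ) : ℝ :=
  ∫ θ, likelihood d n p ω θ Y ∂(gaussVec p)

lemma integrable_likelihood_prod (h0 : 0 ≤ ω) (h1 : ω * p.choose d ≤ 1)
    {g : (Fin n → Fin p → ℝ) → ℝ} (hg : Integrable g (nullLaw n p)) :
    Integrable (fun q : (Fin p → ℝ) × (Fin n → Fin p → ℝ) => likelihood d n p ω q.1 q.2 * g q.2)
      ((gaussVec p).prod (nullLaw n p)) :=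
  (hg.comp_snd _).bdd_mul (measurable_likelihood_uncurry d n p ω).aestronglyMeasurable
    (ae_of_all _ fun q => abs_likelihood_le h0 h1 q.1 q.2)

lemma measurable_meanLikelihood : Measurable (meanLikelihood d n p ω) := by
  have : StronglyMeasurable fun q : (Fin n → Fin p → ℝ) × (Fin p → ℝ) =>
      likelihood d n p ω q.2 q.1 := by
    have h : Measurable fun q : (Fin n → Fin p → ℝ) × (Fin p → ℝ) => (q.2, q.1) :=
      measurable_snd.prodMk measurable_fst
    have h' := (measurable_likelihood_uncurry d n p ω).comp h
    simp only [Function.comp_def] at h'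
    exact h'.stronglyMeasurable
  exact this.integral_prod_right'.measurable

lemma meanLikelihood_nonneg (h0 : 0 ≤ ω) (h1 : ω * p.choose d ≤ 1) (Y : Fin n → Fin p → ℝ) :
    0 ≤ meanLikelihood d n p ω Y :=
  integral_nonneg fun θ => likelihood_nonneg h0 h1 θ Y

lemma abs_meanLikelihood_le (h0 : 0 ≤ ω) (h1 : ω * p.choose d ≤ 1) (Y : Fin n → Fin p → ℝ) :
    |meanLikelihood d n p ω Y| ≤ 2 ^ n := by
  have := norm_integral_le_of_norm_le_const (μ := gaussVec p)
    (f := fun θ => likelihood d n p ω θ Y) (C := 2 ^ n)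
    (ae_of_all _ fun θ => abs_likelihood_le h0 h1 θ Y)
  simpa [meanLikelihood] using this

lemma plantedLaw_eq_withDensity (h0 : 0 ≤ ω) (h1 : ω * p.choose d ≤ 1) :
    plantedLaw n p (gaussVec p) (tiltKernel d p ω)
      = (nullLaw n p).withDensity fun Y => ENNReal.ofReal (meanLikelihood d n p ω Y) := by
  refine Measure.ext_of_lintegral _ fun g hg => ?_
  rw [lintegral_plantedLaw h0 h1 hg, lintegral_withDensity_eq_lintegral_mul _
    measurable_meanLikelihood.ennreal_ofReal hg, lintegral_lintegral_swap]
  · refine lintegral_congr fun Y => ?_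
    have hm : Measurable fun θ => likelihood d n p ω θ Y := measurable_likelihood_left Y
    rw [lintegral_mul_const _ hm.ennreal_ofReal, Pi.mul_apply, meanLikelihood,
      ofReal_integral_eq_lintegral_ofReal
        (integrable_of_abs_le hm (2 ^ n) fun θ => abs_likelihood_le h0 h1 θ Y)
        (ae_of_all _ fun θ => likelihood_nonneg h0 h1 θ Y)]
  · exact ((measurable_likelihood_uncurry d n p ω).ennreal_ofReal.mul
      (hg.comp measurable_snd)).aemeasurable

/-- The density of the planted law is at most 2^n, so integrability passes over from the null law.
-/
lemma integrable_plantedLaw (h0 : 0 ≤ ω) (h1 : ω * p.choose d ≤ 1)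
    {g : (Fin n → Fin p → ℝ) → ℝ} (hg : Integrable g (nullLaw n p)) :
    Integrable g (plantedLaw n p (gaussVec p) (tiltKernel d p ω)) := by
  rw [plantedLaw_eq_withDensity h0 h1, integrable_withDensity_iff
    measurable_meanLikelihood.ennreal_ofReal (ae_of_all _ fun _ => ENNReal.ofReal_lt_top)]
  simp_rw [ENNReal.toReal_ofReal (meanLikelihood_nonneg h0 h1 _)]
  exact hg.mul_bdd measurable_meanLikelihood.aestronglyMeasurable
    (ae_of_all _ fun Y => abs_meanLikelihood_le h0 h1 Y)

lemma integral_plantedLaw (h0 : 0 ≤ ω) (h1 : ω * p.choose d ≤ 1)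
    {g : (Fin n → Fin p → ℝ) → ℝ} (hg : Integrable g (nullLaw n p)) :
    ∫ Y, g Y ∂(plantedLaw n p (gaussVec p) (tiltKernel d p ω))
      = ∫ θ, ∫ Y, likelihood d n p ω θ Y * g Y ∂(nullLaw n p) ∂(gaussVec p) := by
  rw [plantedLaw_eq_withDensity h0 h1, integral_withDensity_eq_integral_toReal_smul
    measurable_meanLikelihood.ennreal_ofReal (ae_of_all _ fun _ => ENNReal.ofReal_lt_top),
    integral_integral_swap (integrable_likelihood_prod h0 h1 hg)]
  refine integral_congr_ae (ae_of_all _ fun Y => ?_)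
  simp only [smul_eq_mul]
  rw [ENNReal.toReal_ofReal (meanLikelihood_nonneg h0 h1 Y), integral_mul_const, meanLikelihood]

end Planted

/-! ### The low-degree norm of the planted law -/

lemma integral_mul_le_sqrt_mul_sqrt {Ω : Type*} [MeasurableSpace Ω] {μ : Measure Ω} {f g : Ω → ℝ}
    (hf : Integrable (fun x => f x ^ 2) μ) (hg : Integrable (fun x => g x ^ 2) μ)
    (hfg : Integrable (fun x => f x * g x) μ) :
    ∫ x, f x * g x ∂μ ≤ Real.sqrt (∫ x, f x ^ 2 ∂μ) * Real.sqrt (∫ x, g x ^ 2 ∂μ) := by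
  have h : ∀ t : ℝ, 0 ≤ (∫ x, f x ^ 2 ∂μ) * (t * t) + 2 * (∫ x, f x * g x ∂μ) * t
      + ∫ x, g x ^ 2 ∂μ := fun t => by
    have e : ∫ x, (t * f x + g x) ^ 2 ∂μ = (∫ x, f x ^ 2 ∂μ) * (t * t)
        + 2 * (∫ x, f x * g x ∂μ) * t + ∫ x, g x ^ 2 ∂μ := by
      have : ∀ x, (t * f x + g x) ^ 2 = (t * t) * f x ^ 2 + (2 * t) * (f x * g x) + g x ^ 2 :=
        fun x => by ring
      simp_rw [this]
      have i1 : Integrable (fun x => (t * t) * f x ^ 2 + (2 * t) * (f x * g x)) μ :=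
        (hf.const_mul _).add (hfg.const_mul _)
      rw [integral_add i1 hg, integral_add (hf.const_mul _) (hfg.const_mul _),
        integral_const_mul, integral_const_mul]
      ring
    rw [← e]
    exact integral_nonneg fun x => sq_nonneg _
  have hd := discrim_le_zero h
  rw [discrim] at hd
  rw [← Real.sqrt_mul (integral_nonneg fun x => sq_nonneg _)]
  exact Real.le_sqrt_of_sq_le (by nlinarith)

lemma integrable_pow_stdGauss (k : ℕ) : Integrable (fun x : ℝ => x ^ k) stdGauss := by
  have := integrable_pow_of_mem_interior_integrableExpSet (X := id) (μ := stdGauss)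
    (by rw [integrableExpSet_id_gaussianReal]; simp) k
  simpa using this

section LowDegree

variable {d n p : ℕ} {ω : ℝ}

lemma eval_uncurry_eq_sum (g : MvPolynomial (Fin n × Fin p) ℝ) (Y : Fin n → Fin p → ℝ) :
    MvPolynomial.eval (Function.uncurry Y) g
      = ∑ m ∈ g.support, g.coeff m * ∏ j, ∏ a, Y j a ^ m (j, a) := by
  rw [MvPolynomial.eval_eq']
  simp [Fintype.prod_prod_type, Function.uncurry]

lemma integrable_monomial (m : Fin n × Fin p →₀ ℕ) :
    Integrable (fun Y : Fin n → Fin p → ℝ => ∏ j, ∏ a, Y j a ^ m (j, a)) (nullLaw n p) :=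
  Integrable.fintype_prod_dep (f := fun j (y : Fin p → ℝ) => ∏ a, y a ^ m (j, a))
    (μ := fun _ : Fin n => gaussVec p) fun j =>
    Integrable.fintype_prod_dep (f := fun a (y : ℝ) => y ^ m (j, a)) (μ := fun _ => stdGauss)
      fun _ => integrable_pow_stdGauss _

lemma integrable_eval_nullLaw (g : MvPolynomial (Fin n × Fin p) ℝ) :
    Integrable (fun Y => MvPolynomial.eval (Function.uncurry Y) g) (nullLaw n p) := by
  simp_rw [eval_uncurry_eq_sum]
  exact integrable_finsetSum _ fun m _ => (integrable_monomial m).const_mul _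

/-- A monomial of small degree is orthogonal to a product of perturbations over many samples. -/
lemma integral_monomial_mul_prod_tilt (m : Fin n × Fin p →₀ ℕ) (J : Finset (Fin n))
    (hJ : m.degree < d * J.card) (θ : Fin p → ℝ) :
    ∫ Y, (∏ j, ∏ a, Y j a ^ m (j, a)) * ∏ j ∈ J, tilt d ω θ (Y j) ∂(nullLaw n p) = 0 := by
  classical
  have hsum : ∑ j, ((Finset.univ : Finset (Fin p)).filter fun a => m (j, a) ≠ 0).card
      ≤ m.degree := by
    rw [Finsupp.degree_eq_sum, Fintype.sum_prod_type]
    refine Finset.sum_le_sum fun j _ => ?_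
    rw [Finset.card_filter]
    refine Finset.sum_le_sum fun a _ => ?_
    split_ifs with h <;> omega
  -- Pigeonhole: if the monomial involved at least d coordinates of every sample in J, its degree
  -- would be at least d|J|. For the sample found here, the tilt is orthogonal to the factor of the
  -- monomial.
  obtain ⟨j, hj, hcard⟩ : ∃ j ∈ J,
      ((Finset.univ : Finset (Fin p)).filter fun a => m (j, a) ≠ 0).card < d := by
    by_contra hcon
    push Not at hcon
    have h1 := Finset.card_nsmul_le_sum J _ d hcon
    have h2 := Finset.sum_le_univ_sum_of_nonneg (s := J)
      (f := fun j => ((Finset.univ : Finset (Fin p)).filter fun a => m (j, a) ≠ 0).card)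
      (fun _ => Nat.zero_le _)
    rw [smul_eq_mul, mul_comm] at h1
    omega
  have h : ∀ Y : Fin n → Fin p → ℝ, (∏ j, ∏ a, Y j a ^ m (j, a)) * ∏ j ∈ J, tilt d ω θ (Y j)
      = ∏ j, (fun i (y : Fin p → ℝ) => (∏ a, y a ^ m (i, a)) *
          if i ∈ J then tilt d ω θ y else 1) j (Y j) := fun Y => by
    rw [Finset.prod_mul_distrib, Finset.prod_ite_mem, Finset.univ_inter]
  rw [integral_congr_ae (ae_of_all _ h), nullLaw,
    integral_fintype_prod_eq_prod fun i (y : Fin p → ℝ) => (∏ a, y a ^ m (i, a)) *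
      if i ∈ J then tilt d ω θ y else 1]
  refine Finset.prod_eq_zero (Finset.mem_univ j) ?_
  simp only [if_pos hj, tilt]
  simp_rw [mul_left_comm _ ω]
  rw [integral_const_mul, integral_prod_mul_signPoly_eq_zero measurable_sgn abs_sgn_le integral_sgn
    d _ (fun a y => y ^ m (j, a)) (fun a => integrable_pow_stdGauss _) _ hcard, mul_zero]
  intro a ha y
  simp only [Finset.mem_filter, Finset.mem_univ, true_and, not_not] at ha
  rw [ha, pow_zero]

lemma abs_prod_tilt_le (h0 : 0 ≤ ω) (h1 : ω * p.choose d ≤ 1) (J : Finset (Fin n))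
    (θ : Fin p → ℝ) (Y : Fin n → Fin p → ℝ) : |∏ j ∈ J, tilt d ω θ (Y j)| ≤ 1 := by
  rw [Finset.abs_prod]
  exact Finset.prod_le_one (fun _ _ => abs_nonneg _) fun j _ => abs_tilt_le h0 h1 θ _

lemma measurable_prod_tilt (J : Finset (Fin n)) (θ : Fin p → ℝ) :
    Measurable fun Y : Fin n → Fin p → ℝ => ∏ j ∈ J, tilt d ω θ (Y j) :=
  Finset.measurable_fun_prod _ fun j _ => (measurable_tilt d ω θ).comp (measurable_pi_apply j)

lemma integral_eval_mul_prod_tilt (h0 : 0 ≤ ω) (h1 : ω * p.choose d ≤ 1)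
    (g : MvPolynomial (Fin n × Fin p) ℝ) (J : Finset (Fin n))
    (hJ : g.totalDegree < d * J.card) (θ : Fin p → ℝ) :
    ∫ Y, (∏ j ∈ J, tilt d ω θ (Y j)) * MvPolynomial.eval (Function.uncurry Y) g ∂(nullLaw n p)
      = 0 := by
  simp_rw [eval_uncurry_eq_sum, Finset.mul_sum]
  rw [integral_finsetSum]
  · refine Finset.sum_eq_zero fun m hm => ?_
    have hdeg : m.degree < d * J.card :=
      lt_of_le_of_lt (MvPolynomial.le_totalDegree hm) hJ
    have : ∀ Y : Fin n → Fin p → ℝ,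
        (∏ j ∈ J, tilt d ω θ (Y j)) * (g.coeff m * ∏ j, ∏ a, Y j a ^ m (j, a))
          = g.coeff m * ((∏ j, ∏ a, Y j a ^ m (j, a)) * ∏ j ∈ J, tilt d ω θ (Y j)) :=
      fun Y => by ring
    simp_rw [this]
    rw [integral_const_mul, integral_monomial_mul_prod_tilt m J hdeg, mul_zero]
  · intro m _
    exact ((integrable_monomial m).const_mul _).bdd_mul (c := 1)
      (measurable_prod_tilt J θ).aestronglyMeasurable
      (ae_of_all _ fun Y => abs_prod_tilt_le h0 h1 J θ Y)

/-- The part of the likelihood ratio that involves at most `D / d` samples. -/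
def truncLikelihood (d n p : ℕ) (ω : ℝ) (D : ℕ) (θ : Fin p → ℝ) (Y : Fin n → Fin p → ℝ) : ℝ :=
  ∑ J ∈ (Finset.univ : Finset (Fin n)).powerset.filter (fun J => d * J.card ≤ D),
    ∏ j ∈ J, tilt d ω θ (Y j)

/-- The product of the factors 1 + tilt expands over the sets J of samples, and the terms with d|J|
above the degree of the polynomial are orthogonal to it. -/
lemma integral_likelihood_mul_eval (h0 : 0 ≤ ω) (h1 : ω * p.choose d ≤ 1)
    (g : MvPolynomial (Fin n × Fin p) ℝ) (θ : Fin p → ℝ) :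
    ∫ Y, likelihood d n p ω θ Y * MvPolynomial.eval (Function.uncurry Y) g ∂(nullLaw n p)
      = ∫ Y, truncLikelihood d n p ω g.totalDegree θ Y *
          MvPolynomial.eval (Function.uncurry Y) g ∂(nullLaw n p) := by
  have hi : ∀ J : Finset (Fin n), Integrable (fun Y => (∏ j ∈ J, tilt d ω θ (Y j)) *
      MvPolynomial.eval (Function.uncurry Y) g) (nullLaw n p) := fun J =>
    (integrable_eval_nullLaw g).bdd_mul (c := 1) (measurable_prod_tilt J θ).aestronglyMeasurable
      (ae_of_all _ fun Y => abs_prod_tilt_le h0 h1 J θ Y)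
  simp_rw [likelihood, Finset.prod_one_add, truncLikelihood, Finset.sum_mul]
  rw [integral_finsetSum _ fun J _ => hi J, integral_finsetSum _ fun J _ => hi J,
    Finset.sum_filter]
  refine Finset.sum_congr rfl fun J _ => ?_
  split_ifs with h
  · rfl
  · exact integral_eval_mul_prod_tilt h0 h1 g J (not_le.1 h) θ

lemma measurable_truncLikelihood_uncurry (d n p : ℕ) (ω : ℝ) (D : ℕ) :
    Measurable fun q : (Fin p → ℝ) × (Fin n → Fin p → ℝ) =>
      truncLikelihood d n p ω D q.1 q.2 := by
  unfold truncLikelihood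
  refine Finset.measurable_fun_sum _ fun J _ => Finset.measurable_fun_prod _ fun j _ => ?_
  have h : Measurable fun q : (Fin p → ℝ) × (Fin n → Fin p → ℝ) => (q.1, q.2 j) := by fun_prop
  have h' := (measurable_tilt_uncurry d p ω).comp h
  simp only [Function.comp_def] at h'
  exact h'

lemma abs_truncLikelihood_le (h0 : 0 ≤ ω) (h1 : ω * p.choose d ≤ 1) (D : ℕ) (θ : Fin p → ℝ)
    (Y : Fin n → Fin p → ℝ) : |truncLikelihood d n p ω D θ Y| ≤ 2 ^ n := by
  refine (Finset.abs_sum_le_sum_abs _ _).trans ?_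
  calc _ ≤ ∑ J ∈ (Finset.univ : Finset (Fin n)).powerset.filter (fun J => d * J.card ≤ D),
        (1 : ℝ) := Finset.sum_le_sum fun J _ => abs_prod_tilt_le h0 h1 J θ Y
    _ ≤ ∑ J ∈ (Finset.univ : Finset (Fin n)).powerset, (1 : ℝ) :=
        Finset.sum_le_sum_of_subset_of_nonneg (Finset.filter_subset _ _) fun _ _ _ => zero_le_one
    _ = 2 ^ n := by simp

/-- The covariance of the truncated likelihood ratios for two hidden parameters. -/
lemma integral_truncLikelihood_mul (hd : 0 < d) (h0 : 0 ≤ ω) (h1 : ω * p.choose d ≤ 1) (D : ℕ)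
    (θ θ' : Fin p → ℝ) :
    ∫ Y, truncLikelihood d n p ω D θ Y * truncLikelihood d n p ω D θ' Y ∂(nullLaw n p)
      = ∑ J ∈ (Finset.univ : Finset (Fin n)).powerset.filter (fun J => d * J.card ≤ D),
          (ω ^ 2 * elemSymm d fun a => sgn (θ a) * sgn (θ' a)) ^ J.card := by
  have hi : ∀ J J' : Finset (Fin n), Integrable (fun Y => (∏ j ∈ J, tilt d ω θ (Y j)) *
      ∏ j ∈ J', tilt d ω θ' (Y j)) (nullLaw n p) := fun J J' =>
    integrable_of_abs_le ((measurable_prod_tilt J θ).mul (measurable_prod_tilt J' θ')) 1 fun Y => by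
      rw [abs_mul]
      exact mul_le_one₀ (abs_prod_tilt_le h0 h1 J θ Y) (abs_nonneg _)
        (abs_prod_tilt_le h0 h1 J' θ' Y)
  simp_rw [truncLikelihood, Finset.sum_mul_sum]
  rw [integral_finsetSum _ fun J _ => integrable_finsetSum _ fun J' _ => hi J J']
  refine Finset.sum_congr rfl fun J hJ => ?_
  rw [integral_finsetSum _ fun J' _ => hi J J', Finset.sum_eq_single_of_mem J hJ]
  · rw [nullLaw, integral_prod_mul_prod (integral_tilt hd θ) (integral_tilt hd θ'), if_pos rfl,
      integral_tilt_mul_tilt]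
  · intro J' _ hne
    rw [nullLaw, integral_prod_mul_prod (integral_tilt hd θ) (integral_tilt hd θ'),
      if_neg hne.symm]

/-- Normalized overlap of two hidden parameters. -/
def overlap {p : ℕ} (θ θ' : Fin p → ℝ) : ℝ := |∑ a, sgn (θ a) * sgn (θ' a)| / Real.sqrt p

/-- With w the overlap, `abs_elemSymm_le` applies to M = √p R e^(w/R), because w ≤ R e^(w/R). The
factor e^(w/R) occurs to the power d|J| ≤ D ≤ R, so it costs at most e^w in total, uniformly in J.
What remains is summed over all J by the binomial formula. Thus a large overlap only has to be
controlled through one exponential moment. -/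
lemma sum_pow_elemSymm_le (hp : 1 ≤ p) {R : ℝ} (hR : 1 ≤ R) {D : ℕ} (hD : (D : ℝ) ≤ R)
    (θ θ' : Fin p → ℝ) :
    ∑ J ∈ (Finset.univ : Finset (Fin n)).powerset.filter (fun J => d * J.card ≤ D),
        (ω ^ 2 * elemSymm d fun a => sgn (θ a) * sgn (θ' a)) ^ J.card
      ≤ (1 + ω ^ 2 * (Real.sqrt p * R) ^ d) ^ n * Real.exp (overlap θ θ') := by
  set w := overlap θ θ' with hw
  have hR0 : 0 < R := by linarith
  have hp1 : (1 : ℝ) ≤ p := by exact_mod_cast hp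
  have hs1 : 1 ≤ Real.sqrt p := Real.one_le_sqrt.2 hp1
  have hs0 : 0 < Real.sqrt p := by linarith
  have hw0 : 0 ≤ w := by rw [hw, overlap]; positivity
  have hexp1 : 1 ≤ Real.exp (w / R) := Real.one_le_exp (by positivity)
  have hexp2 : w ≤ R * Real.exp (w / R) := by
    have := Real.add_one_le_exp (w / R)
    have h : w = R * (w / R) := by field_simp
    calc w = R * (w / R) := h
      _ ≤ _ := mul_le_mul_of_nonneg_left (by linarith) hR0.le
  set M := Real.sqrt p * (R * Real.exp (w / R)) with hM
  have hM1 : Real.sqrt p ≤ M := le_mul_of_one_le_right hs0.le (one_le_mul_of_one_le_of_one_le hR hexp1)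
  have habs : |elemSymm d fun a => sgn (θ a) * sgn (θ' a)| ≤ M ^ d := by
    refine abs_elemSymm_le (fun a => by rw [mul_pow, sgn_pow_three, sgn_pow_three])
      (hs1.trans hM1) ?_ ?_ d
    · have : |∑ a, sgn (θ a) * sgn (θ' a)| = Real.sqrt p * w := by
        rw [hw, overlap]; field_simp
      rw [this]
      exact mul_le_mul_of_nonneg_left hexp2 hs0.le
    · rw [Fintype.card_fin]
      calc (p : ℝ) = Real.sqrt p ^ 2 := (Real.sq_sqrt (by positivity)).symm
        _ ≤ M ^ 2 := pow_le_pow_left₀ hs0.le hM1 2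
  calc _ ≤ ∑ J ∈ (Finset.univ : Finset (Fin n)).powerset.filter (fun J => d * J.card ≤ D),
        (ω ^ 2 * (Real.sqrt p * R) ^ d) ^ J.card * Real.exp w := by
        refine Finset.sum_le_sum fun J hJ => ?_
        have hJD : d * J.card ≤ D := (Finset.mem_filter.1 hJ).2
        calc _ ≤ |ω ^ 2 * elemSymm d fun a => sgn (θ a) * sgn (θ' a)| ^ J.card := by
              rw [← abs_pow]; exact le_abs_self _
          _ ≤ (ω ^ 2 * M ^ d) ^ J.card := by
              rw [abs_mul, abs_of_nonneg (sq_nonneg ω)]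
              exact pow_le_pow_left₀ (by positivity)
                (mul_le_mul_of_nonneg_left habs (sq_nonneg _)) _
          _ = (ω ^ 2 * (Real.sqrt p * R) ^ d) ^ J.card * Real.exp (w / R) ^ (d * J.card) := by
              rw [hM, ← mul_assoc, mul_pow (Real.sqrt p * R), ← mul_assoc, mul_pow (ω ^ 2 * _),
                ← pow_mul]
          _ ≤ _ := by
              refine mul_le_mul_of_nonneg_left ?_ (by positivity)
              rw [← Real.exp_nat_mul]
              refine Real.exp_le_exp.2 ?_
              rw [mul_div_assoc', div_le_iff₀ hR0, mul_comm]
              refine mul_le_mul_of_nonneg_left (le_trans ?_ hD) hw0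
              exact_mod_cast hJD
    _ ≤ ∑ J ∈ (Finset.univ : Finset (Fin n)).powerset,
        (ω ^ 2 * (Real.sqrt p * R) ^ d) ^ J.card * Real.exp w :=
        Finset.sum_le_sum_of_subset_of_nonneg (Finset.filter_subset _ _) fun _ _ _ => by positivity
    _ = _ := by
        rw [← Finset.sum_mul]
        congr 1
        have := Finset.prod_one_add (f := fun _ : Fin n => ω ^ 2 * (Real.sqrt p * R) ^ d)
          (s := Finset.univ)
        simpa using this.symm

lemma measurable_overlap_uncurry :
    Measurable fun q : (Fin p → ℝ) × (Fin p → ℝ) => overlap q.1 q.2 := by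
  unfold overlap
  refine Measurable.div_const (Measurable.abs ?_) _
  refine Finset.measurable_fun_sum _ fun a _ => ?_
  exact (measurable_sgn.comp ((measurable_pi_apply a).comp measurable_fst)).mul
    (measurable_sgn.comp ((measurable_pi_apply a).comp measurable_snd))

lemma abs_sgn_mul_sgn_le (x y : ℝ) : |sgn x * sgn y| ≤ 1 := by
  rw [abs_mul]; exact mul_le_one₀ (abs_sgn_le x) (abs_nonneg _) (abs_sgn_le y)

lemma overlap_le (θ θ' : Fin p → ℝ) : overlap θ θ' ≤ p / Real.sqrt p := by
  refine div_le_div_of_nonneg_right ?_ (Real.sqrt_nonneg _)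
  refine (Finset.abs_sum_le_sum_abs _ _).trans ?_
  calc _ ≤ ∑ _a : Fin p, (1 : ℝ) := Finset.sum_le_sum fun a _ => abs_sgn_mul_sgn_le _ _
    _ = p := by simp

lemma integrable_exp_overlap : Integrable (fun q : (Fin p → ℝ) × (Fin p → ℝ) =>
    Real.exp (overlap q.1 q.2)) ((gaussVec p).prod (gaussVec p)) :=
  integrable_of_abs_le measurable_overlap_uncurry.exp (Real.exp (p / Real.sqrt p)) fun q => by
    rw [Real.abs_exp]; exact Real.exp_le_exp.2 (overlap_le _ _)

/-- Integration of a product over the coordinates of a pair of vectors. -/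
lemma integral_prod_pair {Ω Ω' : Type*} [MeasurableSpace Ω] [MeasurableSpace Ω'] (μ : Measure Ω)
    (ν : Measure Ω') [IsProbabilityMeasure μ] [IsProbabilityMeasure ν] {ι : Type} [Fintype ι]
    (F : (ι → Ω × Ω') → ℝ) :
    ∫ q : (ι → Ω) × (ι → Ω'), F (fun a => (q.1 a, q.2 a))
        ∂((Measure.pi fun _ => μ).prod (Measure.pi fun _ => ν))
      = ∫ x, F x ∂(Measure.pi fun _ : ι => μ.prod ν) := by
  have h := measurePreserving_arrowProdEquivProdArrow Ω Ω' ι (fun _ => μ) (fun _ => ν)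
  rw [← h.integral_comp']
  rfl

lemma integral_exp_sum_sgn_le (t : ℝ) (ht : |t| ≤ 1) :
    ∫ q : (Fin p → ℝ) × (Fin p → ℝ), Real.exp (t * ∑ a, sgn (q.1 a) * sgn (q.2 a))
      ∂((gaussVec p).prod (gaussVec p)) ≤ Real.exp (p * t ^ 2) := by
  rw [integral_prod_pair stdGauss stdGauss
    fun x : Fin p → ℝ × ℝ => Real.exp (t * ∑ a, sgn (x a).1 * sgn (x a).2)]
  simp_rw [Finset.mul_sum, Real.exp_sum]
  rw [integral_fintype_prod_eq_prod fun _ (q : ℝ × ℝ) => Real.exp (t * (sgn q.1 * sgn q.2)),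
    Finset.prod_const, Finset.card_univ, Fintype.card_fin, Real.exp_nat_mul]
  have hm : Measurable fun q : ℝ × ℝ => t * (sgn q.1 * sgn q.2) :=
    ((measurable_sgn.comp measurable_fst).mul (measurable_sgn.comp measurable_snd)).const_mul t
  refine pow_le_pow_left₀ (integral_nonneg fun q => (Real.exp_pos _).le) ?_ p
  refine integral_exp_le hm (fun q => ?_) ?_ ?_
  · rw [abs_mul]; exact mul_le_one₀ ht (abs_nonneg _) (abs_sgn_mul_sgn_le _ _)
  · rw [integral_const_mul, integral_prod_mul sgn sgn, integral_sgn]; simp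
  · have hb : ∀ q : ℝ × ℝ, (t * (sgn q.1 * sgn q.2)) ^ 2 ≤ t ^ 2 := fun q => by
      rw [mul_pow]
      refine mul_le_of_le_one_right (sq_nonneg t) ?_
      rw [← sq_abs]
      exact pow_le_one₀ (abs_nonneg _) (abs_sgn_mul_sgn_le _ _)
    calc ∫ q : ℝ × ℝ, (t * (sgn q.1 * sgn q.2)) ^ 2 ∂gaussPair ≤ ∫ q : ℝ × ℝ, t ^ 2 ∂gaussPair := by
          refine integral_mono (integrable_of_abs_le (hm.pow_const 2) (t ^ 2) fun q => ?_)
            (integrable_const _) hb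
          rw [abs_of_nonneg (sq_nonneg _)]; exact hb q
      _ = t ^ 2 := by simp

/-- By e^|z| ≤ e^z + e^(-z) it suffices to bound the exponential moments of the sum of signs at the
parameters ±1/√p, for which the subgaussian bound is e. -/
lemma integral_exp_overlap_le (hp : 1 ≤ p) :
    ∫ q : (Fin p → ℝ) × (Fin p → ℝ), Real.exp (overlap q.1 q.2)
      ∂((gaussVec p).prod (gaussVec p)) ≤ 2 * Real.exp 1 := by
  have hp1 : (1 : ℝ) ≤ p := by exact_mod_cast hp
  have hs1 : 1 ≤ Real.sqrt p := Real.one_le_sqrt.2 hp1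
  have hs0 : 0 < Real.sqrt p := by linarith
  set t := 1 / Real.sqrt p with ht
  have ht1 : |t| ≤ 1 := by rw [ht, abs_of_pos (by positivity), div_le_one hs0]; exact hs1
  have hpt : (p : ℝ) * t ^ 2 = 1 := by
    rw [ht, div_pow, Real.sq_sqrt (by positivity)]; field_simp
  have hmS : ∀ t : ℝ, Measurable fun q : (Fin p → ℝ) × (Fin p → ℝ) =>
      Real.exp (t * ∑ a, sgn (q.1 a) * sgn (q.2 a)) := fun t => by
    refine (Measurable.const_mul (Finset.measurable_fun_sum _ fun a _ => ?_) _).exp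
    exact (measurable_sgn.comp ((measurable_pi_apply a).comp measurable_fst)).mul
      (measurable_sgn.comp ((measurable_pi_apply a).comp measurable_snd))
  have hi : ∀ t : ℝ, Integrable (fun q : (Fin p → ℝ) × (Fin p → ℝ) =>
      Real.exp (t * ∑ a, sgn (q.1 a) * sgn (q.2 a))) ((gaussVec p).prod (gaussVec p)) := fun t => by
    refine integrable_of_abs_le (hmS t) (Real.exp (|t| * p)) fun q => ?_
    rw [Real.abs_exp]
    refine Real.exp_le_exp.2 ((le_abs_self _).trans ?_)
    rw [abs_mul]
    refine mul_le_mul_of_nonneg_left ((Finset.abs_sum_le_sum_abs _ _).trans ?_) (abs_nonneg _)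
    calc _ ≤ ∑ _a : Fin p, (1 : ℝ) := Finset.sum_le_sum fun a _ => abs_sgn_mul_sgn_le _ _
      _ = p := by simp
  calc _ ≤ ∫ q : (Fin p → ℝ) × (Fin p → ℝ), (Real.exp (t * ∑ a, sgn (q.1 a) * sgn (q.2 a)) +
        Real.exp (-t * ∑ a, sgn (q.1 a) * sgn (q.2 a))) ∂((gaussVec p).prod (gaussVec p)) := by
        refine integral_mono integrable_exp_overlap ((hi t).add (hi (-t))) fun q => ?_
        simp only
        set z := ∑ a, sgn (q.1 a) * sgn (q.2 a) with hz
        have e : overlap q.1 q.2 = |t * z| := by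
          rw [overlap, abs_mul, abs_of_pos (show 0 < t by positivity), ht, ← hz]; field_simp
        rw [e, neg_mul]
        rcases abs_cases (t * z) with h | h <;> rw [h.1]
        · linarith [Real.exp_pos (-(t * z))]
        · linarith [Real.exp_pos (t * z)]
    _ ≤ Real.exp 1 + Real.exp 1 := by
        rw [integral_add (hi t) (hi (-t))]
        refine add_le_add ?_ ?_
        · exact (integral_exp_sum_sgn_le t ht1).trans (by rw [hpt])
        · exact (integral_exp_sum_sgn_le (-t) (by rwa [abs_neg])).trans (by rw [neg_sq, hpt])
    _ = _ := by ring

/-- The likelihood ratio of low degree of the planted law is bounded. -/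
theorem lowDegreeNormLE_plantedLaw (hd : 0 < d) (h0 : 0 ≤ ω) (h1 : ω * p.choose d ≤ 1)
    (hp : 1 ≤ p) {R : ℝ} (hR : 1 ≤ R) (hx : n * (ω ^ 2 * (Real.sqrt p * R) ^ d) ≤ 1) :
    LowDegreeNormLE (plantedLaw n p (gaussVec p) (tiltKernel d p ω)) R
      (Real.sqrt (Real.exp 1 * (2 * Real.exp 1))) := by
  intro g hg
  have hgi := integrable_eval_nullLaw g
  refine ⟨integrable_plantedLaw h0 h1 hgi, ?_⟩
  set D := g.totalDegree with hD
  set M : (Fin n → Fin p → ℝ) → ℝ := fun Y => ∫ θ, truncLikelihood d n p ω D θ Y ∂(gaussVec p)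
    with hM
  have hmT : Measurable fun q : (Fin n → Fin p → ℝ) × (Fin p → ℝ) =>
      truncLikelihood d n p ω D q.2 q.1 := by
    have h : Measurable fun q : (Fin n → Fin p → ℝ) × (Fin p → ℝ) => (q.2, q.1) :=
      measurable_snd.prodMk measurable_fst
    have h' := (measurable_truncLikelihood_uncurry d n p ω D).comp h
    simp only [Function.comp_def] at h'
    exact h'
  have hMm : Measurable M := hmT.stronglyMeasurable.integral_prod_right'.measurable
  have hMb : ∀ Y, |M Y| ≤ 2 ^ n := fun Y => by
    have := norm_integral_le_of_norm_le_const (μ := gaussVec p)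
      (f := fun θ => truncLikelihood d n p ω D θ Y) (C := 2 ^ n)
      (ae_of_all _ fun θ => abs_truncLikelihood_le h0 h1 D θ Y)
    simpa using this
  have hg2 : Integrable (fun Y => MvPolynomial.eval (Function.uncurry Y) g ^ 2) (nullLaw n p) := by
    have := integrable_eval_nullLaw (g ^ 2)
    simpa only [map_pow] using this
  have hM2 : Integrable (fun Y => M Y ^ 2) (nullLaw n p) :=
    integrable_of_abs_le (hMm.pow_const 2) ((2 ^ n) ^ 2) fun Y => by
      rw [abs_pow]; exact pow_le_pow_left₀ (abs_nonneg _) (hMb Y) 2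
  have hMg : Integrable (fun Y => M Y * MvPolynomial.eval (Function.uncurry Y) g) (nullLaw n p) :=
    hgi.bdd_mul hMm.aestronglyMeasurable (ae_of_all _ hMb)
  have e1 : ∫ Y, MvPolynomial.eval (Function.uncurry Y) g
      ∂(plantedLaw n p (gaussVec p) (tiltKernel d p ω))
      = ∫ Y, M Y * MvPolynomial.eval (Function.uncurry Y) g ∂(nullLaw n p) := by
    rw [integral_plantedLaw h0 h1 hgi]
    simp_rw [integral_likelihood_mul_eval h0 h1]
    rw [integral_integral_swap]
    · simp_rw [integral_mul_const, hM, hD]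
    · exact (hgi.comp_snd _).bdd_mul (c := 2 ^ n)
        (measurable_truncLikelihood_uncurry d n p ω D).aestronglyMeasurable
        (ae_of_all _ fun q => abs_truncLikelihood_le h0 h1 D q.1 q.2)
  -- The square of the averaged ratio is an average over two independent hidden parameters. After
  -- exchanging the integrals, the samples are integrated out first.
  have e2 : ∫ Y, M Y ^ 2 ∂(nullLaw n p) ≤ Real.exp 1 * (2 * Real.exp 1) := by
    have hsq : ∀ Y, M Y ^ 2 = ∫ q : (Fin p → ℝ) × (Fin p → ℝ), truncLikelihood d n p ω D q.1 Y *
        truncLikelihood d n p ω D q.2 Y ∂((gaussVec p).prod (gaussVec p)) := fun Y => by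
      rw [integral_prod_mul (fun θ => truncLikelihood d n p ω D θ Y)
        (fun θ => truncLikelihood d n p ω D θ Y), sq]
    have hmq : Measurable fun r : (Fin n → Fin p → ℝ) × ((Fin p → ℝ) × (Fin p → ℝ)) =>
        truncLikelihood d n p ω D r.2.1 r.1 * truncLikelihood d n p ω D r.2.2 r.1 := by
      have k1 : Measurable fun r : (Fin n → Fin p → ℝ) × ((Fin p → ℝ) × (Fin p → ℝ)) =>
        (r.1, r.2.1) := by fun_prop
      have k2 : Measurable fun r : (Fin n → Fin p → ℝ) × ((Fin p → ℝ) × (Fin p → ℝ)) =>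
        (r.1, r.2.2) := by fun_prop
      have m1 := hmT.comp k1
      have m2 := hmT.comp k2
      simp only [Function.comp_def] at m1 m2
      exact m1.mul m2
    simp_rw [hsq]
    have hint : Integrable (fun r : (Fin n → Fin p → ℝ) × ((Fin p → ℝ) × (Fin p → ℝ)) =>
        truncLikelihood d n p ω D r.2.1 r.1 * truncLikelihood d n p ω D r.2.2 r.1)
        ((nullLaw n p).prod ((gaussVec p).prod (gaussVec p))) := by
      refine integrable_of_abs_le hmq (2 ^ n * 2 ^ n) fun r => ?_
      rw [abs_mul]
      exact mul_le_mul (abs_truncLikelihood_le h0 h1 D _ _) (abs_truncLikelihood_le h0 h1 D _ _)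
        (abs_nonneg _) (by positivity)
    rw [integral_integral_swap hint]
    · calc _ ≤ ∫ q : (Fin p → ℝ) × (Fin p → ℝ), Real.exp 1 * Real.exp (overlap q.1 q.2)
            ∂((gaussVec p).prod (gaussVec p)) := by
            refine integral_mono hint.integral_prod_right (integrable_exp_overlap.const_mul _)
              fun q => ?_
            · simp only
              rw [integral_truncLikelihood_mul hd h0 h1]
              refine (sum_pow_elemSymm_le hp hR hg q.1 q.2).trans ?_
              refine mul_le_mul_of_nonneg_right ?_ (Real.exp_pos _).le
              set x := ω ^ 2 * (Real.sqrt p * R) ^ d with hxdef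
              calc (1 + x) ^ n ≤ Real.exp x ^ n :=
                    pow_le_pow_left₀ (by positivity) (by linarith [Real.add_one_le_exp x]) n
                _ = Real.exp (n * x) := (Real.exp_nat_mul x n).symm
                _ ≤ Real.exp 1 := Real.exp_le_exp.2 hx
        _ ≤ _ := by
            rw [integral_const_mul]
            exact mul_le_mul_of_nonneg_left (integral_exp_overlap_le hp) (Real.exp_pos _).le
  rw [e1]
  refine (integral_mul_le_sqrt_mul_sqrt hM2 hg2 hMg).trans ?_
  exact mul_le_mul_of_nonneg_right (Real.sqrt_le_sqrt e2) (Real.sqrt_nonneg _)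

end LowDegree

/-! ### The sign tensor and its spectral norm under the null law -/

/-- The sum over the samples of the tensor powers of the sign vectors, with the entries with a
repeated index removed. -/
def signTensor (d : ℕ) {n p : ℕ} (Y : Fin n → Fin p → ℝ) : RealTensor d p :=
  fun i => ∑ j, if Function.Injective i then ∏ k, sgn (Y j (i k)) else 0

/-- Factors are replaced one at a time, the others having modulus at most 1. This gives the
Lipschitz estimate for the form that controls the discretization error. -/
lemma abs_prod_sub_prod_le {ι : Type*} (s : Finset ι) {f g : ι → ℝ} (hf : ∀ i, |f i| ≤ 1)
    (hg : ∀ i, |g i| ≤ 1) : |∏ i ∈ s, f i - ∏ i ∈ s, g i| ≤ ∑ i ∈ s, |f i - g i| := by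
  classical
  induction s using Finset.induction_on with
  | empty => simp
  | insert a s ha ih =>
    rw [Finset.prod_insert ha, Finset.prod_insert ha, Finset.sum_insert ha]
    have h : f a * ∏ i ∈ s, f i - g a * ∏ i ∈ s, g i
        = (f a - g a) * ∏ i ∈ s, f i + g a * (∏ i ∈ s, f i - ∏ i ∈ s, g i) := by ring
    rw [h]
    refine (abs_add_le _ _).trans (add_le_add ?_ ?_)
    · rw [abs_mul, Finset.abs_prod]
      exact mul_le_of_le_one_right (abs_nonneg _)
        (Finset.prod_le_one (fun _ _ => abs_nonneg _) fun i _ => hf i)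
    · rw [abs_mul]
      exact (mul_le_of_le_one_left (abs_nonneg _) (hg a)).trans ih

lemma EuclideanSpace.abs_apply_le_norm {p : ℕ} (x : EuclideanSpace ℝ (Fin p)) (a : Fin p) :
    |x a| ≤ ‖x‖ := by
  simpa using PiLp.norm_apply_le x a

namespace RealTensor

variable {d p : ℕ}

lemma abs_form_le (T : RealTensor d p) {x : EuclideanSpace ℝ (Fin p)} (hx : ‖x‖ = 1) :
    |T.form x| ≤ ∑ i, |T i| := by
  refine (Finset.abs_sum_le_sum_abs _ _).trans (Finset.sum_le_sum fun i _ => ?_)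
  rw [abs_mul, Finset.abs_prod]
  refine mul_le_of_le_one_right (abs_nonneg _)
    (Finset.prod_le_one (fun _ _ => abs_nonneg _) fun k _ => ?_)
  exact (EuclideanSpace.abs_apply_le_norm x _).trans hx.le

lemma abs_form_le_specNorm (T : RealTensor d p) {x : EuclideanSpace ℝ (Fin p)} (hx : ‖x‖ = 1) :
    |T.form x| ≤ T.specNorm := by
  refine le_csSup ⟨∑ i, |T i|, ?_⟩ ⟨x, hx, rfl⟩
  rintro r ⟨y, hy, rfl⟩
  exact T.abs_form_le hy

lemma specNorm_le (T : RealTensor d p) {b : ℝ} (hb : 0 ≤ b)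
    (h : ∀ x : EuclideanSpace ℝ (Fin p), ‖x‖ = 1 → |T.form x| ≤ b) : T.specNorm ≤ b := by
  refine Real.sSup_le ?_ hb
  rintro r ⟨x, hx, rfl⟩
  exact h x hx

lemma abs_form_sub_form_le (T : RealTensor d p) {B ε : ℝ} (hB : ∀ i, |T i| ≤ B)
    {x y : EuclideanSpace ℝ (Fin p)} (hx : ∀ a, |x a| ≤ 1) (hy : ∀ a, |y a| ≤ 1)
    (hxy : ∀ a, |x a - y a| ≤ ε) : |T.form x - T.form y| ≤ p ^ d * (B * (d * ε)) := by
  rw [form, form, ← Finset.sum_sub_distrib]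
  refine (Finset.abs_sum_le_sum_abs _ _).trans ?_
  calc _ ≤ ∑ _i : Fin d → Fin p, B * (d * ε) := by
        refine Finset.sum_le_sum fun i _ => ?_
        rw [← mul_sub, abs_mul]
        refine mul_le_mul (hB i) ?_ (abs_nonneg _) ((abs_nonneg _).trans (hB i))
        refine (abs_prod_sub_prod_le _ (fun k => hx (i k)) fun k => hy (i k)).trans ?_
        calc _ ≤ ∑ _k : Fin d, ε := Finset.sum_le_sum fun k _ => hxy _
          _ = d * ε := by simp
    _ = _ := by simp

end RealTensor

section SignTensor

variable {d n p : ℕ}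

lemma signTensor_isSymmetric (Y : Fin n → Fin p → ℝ) : (signTensor d Y).IsSymmetric := by
  intro σ i
  unfold signTensor
  refine Finset.sum_congr rfl fun j _ => ?_
  have h : Function.Injective (i ∘ σ) ↔ Function.Injective i :=
    ⟨fun h => by simpa [Function.comp_assoc] using h.comp σ.symm.injective,
      fun h => h.comp σ.injective⟩
  simp only [h]
  split_ifs
  · exact Equiv.prod_comp σ fun k => sgn (Y j (i k))
  · rfl

lemma abs_signTensor_le (Y : Fin n → Fin p → ℝ) (i : Fin d → Fin p) :
    |signTensor d Y i| ≤ n := by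
  refine (Finset.abs_sum_le_sum_abs _ _).trans ?_
  calc _ ≤ ∑ _j : Fin n, (1 : ℝ) := by
        refine Finset.sum_le_sum fun j _ => ?_
        split_ifs
        · rw [Finset.abs_prod]
          exact Finset.prod_le_one (fun _ _ => abs_nonneg _) fun k _ => abs_sgn_le _
        · simp
    _ = n := by simp

/-- Only injective index tuples survive, and each set of d indices arises from d! of them. Without
repeated indices the form is multilinear in the signs, hence centred under the null law when d > 0.
-/
lemma form_signTensor (Y : Fin n → Fin p → ℝ) (x : EuclideanSpace ℝ (Fin p)) :
    (signTensor d Y).form x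
      = ∑ j, (d.factorial : ℝ) * signPoly d (fun a => x a) sgn (Y j) := by
  classical
  unfold RealTensor.form signTensor signPoly
  simp_rw [Finset.sum_mul]
  rw [Finset.sum_comm]
  refine Finset.sum_congr rfl fun j _ => ?_
  rw [← sum_injective_prod]
  refine Finset.sum_congr rfl fun i _ => ?_
  split_ifs
  · rw [← Finset.prod_mul_distrib]
    exact Finset.prod_congr rfl fun k _ => mul_comm _ _
  · rw [zero_mul]

lemma factorial_mul_choose_le (p d : ℕ) : (d.factorial : ℝ) * (p.choose d : ℝ) ≤ (p : ℝ) ^ d := by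
  rw [← Nat.cast_mul, ← Nat.descFactorial_eq_factorial_mul_choose]
  exact_mod_cast Nat.descFactorial_le_pow p d

/-- Exponential tail bound for a linear statistic of the null law. -/
lemma nullLaw_tail_le (hd : 0 < d) {u : Fin p → ℝ} (hu : ∑ a, u a ^ 2 ≤ 1) {l : ℝ}
    (hl : |l| * (p : ℝ) ^ d ≤ 1) (t : ℝ) :
    (nullLaw n p).real {Y | t ≤ l * ∑ j, (d.factorial : ℝ) * signPoly d u sgn (Y j)}
      ≤ Real.exp (n * (l ^ 2 * d.factorial) - t) := by
  have hu1 : ∀ a, |u a| ≤ 1 := fun a => by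
    rw [← sq_le_one_iff_abs_le_one]
    exact (Finset.single_le_sum (f := fun a => u a ^ 2) (fun _ _ => sq_nonneg _)
      (Finset.mem_univ a)).trans hu
  set X : (Fin p → ℝ) → ℝ := fun y => l * (d.factorial * signPoly d u sgn y) with hX
  have hXm : Measurable X := ((measurable_signPoly d u measurable_sgn).const_mul _).const_mul _
  have hXb : ∀ y, |X y| ≤ 1 := fun y => by
    rw [hX]
    simp only
    rw [abs_mul, abs_mul, Nat.abs_cast]
    refine le_trans ?_ hl
    refine mul_le_mul_of_nonneg_left (le_trans ?_ (factorial_mul_choose_le p d)) (abs_nonneg _)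
    refine mul_le_mul_of_nonneg_left ?_ (Nat.cast_nonneg _)
    simpa using abs_signPoly_le d hu1 abs_sgn_le y
  have hX0 : ∫ y, X y ∂(gaussVec p) = 0 := by
    simp only [hX]
    rw [integral_const_mul, integral_const_mul,
      integral_signPoly_eq_zero measurable_sgn abs_sgn_le integral_sgn hd]
    simp
  -- The second moment is l² (d!)² e_d(u²), and d! e_d(u²) is at most the d-th power of the sum of
  -- the u_a², hence at most 1.
  have hX2 : ∫ y, X y ^ 2 ∂(gaussVec p) ≤ l ^ 2 * d.factorial := by
    have e : ∀ y, X y ^ 2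
        = (l ^ 2 * (d.factorial : ℝ) ^ 2) * (signPoly d u sgn y * signPoly d u sgn y) := fun y => by
      simp only [hX]; ring
    simp_rw [e]
    rw [integral_const_mul, integral_signPoly_mul_signPoly measurable_sgn measurable_sgn abs_sgn_le
      abs_sgn_le integral_sgn integral_sgn, integral_sgn_mul_self, one_pow, one_mul, mul_assoc]
    refine mul_le_mul_of_nonneg_left ?_ (sq_nonneg l)
    rw [sq, mul_assoc]
    refine mul_le_of_le_one_right (Nat.cast_nonneg _) ?_
    refine (sum_injective_le d fun a => mul_self_nonneg (u a)).trans ?_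
    refine pow_le_one₀ (Finset.sum_nonneg fun a _ => mul_self_nonneg _) ?_
    simpa only [sq] using hu
  have hE : ∫ Y, Real.exp (∑ j, X (Y j)) ∂(nullLaw n p) ≤ Real.exp (n * (l ^ 2 * d.factorial)) := by
    simp_rw [Real.exp_sum]
    rw [nullLaw, integral_fintype_prod_eq_prod fun _ y => Real.exp (X y), Finset.prod_const,
      Finset.card_univ, Fintype.card_fin, Real.exp_nat_mul]
    exact pow_le_pow_left₀ (integral_nonneg fun _ => (Real.exp_pos _).le)
      (integral_exp_le hXm hXb hX0 hX2) n
  have hset : {Y : Fin n → Fin p → ℝ | t ≤ l * ∑ j, (d.factorial : ℝ) * signPoly d u sgn (Y j)}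
      = {Y | Real.exp t ≤ Real.exp (∑ j, X (Y j))} := by
    ext Y
    simp only [Set.mem_ofPred_eq, Real.exp_le_exp, hX, Finset.mul_sum]
  rw [hset]
  have hSm : Measurable fun Y : Fin n → Fin p → ℝ => ∑ j, X (Y j) :=
    Finset.measurable_fun_sum _ fun j _ => hXm.comp (measurable_pi_apply j)
  have hint : Integrable (fun Y : Fin n → Fin p → ℝ => Real.exp (∑ j, X (Y j))) (nullLaw n p) := by
    refine integrable_of_abs_le hSm.exp (Real.exp n) fun Y => ?_
    rw [Real.abs_exp]
    refine Real.exp_le_exp.2 ((le_abs_self _).trans ((Finset.abs_sum_le_sum_abs _ _).trans ?_))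
    calc _ ≤ ∑ _j : Fin n, (1 : ℝ) := Finset.sum_le_sum fun j _ => hXb _
      _ = n := by simp
  have hmarkov := mul_meas_ge_le_integral_of_nonneg
    (ae_of_all _ fun Y : Fin n → Fin p → ℝ => (Real.exp_pos (∑ j, X (Y j))).le) hint (Real.exp t)
  rw [Real.exp_sub, le_div_iff₀ (Real.exp_pos t), mul_comm]
  exact hmarkov.trans hE

/-- Points of a grid in the cube, in polar form. -/
def gridPoint (M : ℕ) {p : ℕ} (v : Fin p → Fin (M + 1) × Bool) (a : Fin p) : ℝ :=
  (if (v a).2 then 1 else -1) * (((v a).1 : ℕ) / M)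

/-- The coordinates are rounded towards zero, so that the grid point of a vector in the unit ball
stays in the unit ball, as the tail bound requires. -/
lemma exists_gridPoint {M : ℕ} (hM : 0 < M) {x : Fin p → ℝ} (hx : ∀ a, |x a| ≤ 1) :
    ∃ v : Fin p → Fin (M + 1) × Bool, ∀ a,
      |gridPoint M v a| ≤ |x a| ∧ |x a - gridPoint M v a| ≤ 1 / M := by
  have hM' : (0 : ℝ) < M := by exact_mod_cast hM
  have hlt : ∀ a, ⌊|x a| * M⌋₊ < M + 1 := fun a => by
    rw [Nat.lt_succ_iff]
    refine Nat.floor_le_of_le ?_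
    exact mul_le_of_le_one_left hM'.le (hx a)
  refine ⟨fun a => (⟨⌊|x a| * M⌋₊, hlt a⟩, decide (0 ≤ x a)), fun a => ?_⟩
  have h1 : (⌊|x a| * M⌋₊ : ℝ) / M ≤ |x a| := by
    rw [div_le_iff₀ hM']; exact Nat.floor_le (by positivity)
  have h2 : |x a| - (⌊|x a| * M⌋₊ : ℝ) / M ≤ 1 / M := by
    rw [sub_le_iff_le_add, ← add_div, le_div_iff₀ hM', add_comm]
    exact (Nat.lt_floor_add_one _).le
  have h3 : (0 : ℝ) ≤ (⌊|x a| * M⌋₊ : ℝ) / M := by positivity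
  by_cases hs : 0 ≤ x a
  · simp only [gridPoint, hs, decide_true, if_true, one_mul]
    rw [abs_of_nonneg h3]
    refine ⟨h1, ?_⟩
    rw [abs_of_nonneg hs] at h1 h2 ⊢
    rw [abs_of_nonneg (by linarith)]
    exact h2
  · simp only [gridPoint, hs, decide_false, Bool.false_eq_true, if_false, neg_one_mul]
    rw [abs_neg, abs_of_nonneg h3]
    refine ⟨h1, ?_⟩
    rw [abs_of_neg (not_le.1 hs)] at h1 h2 ⊢
    rw [abs_of_nonpos (by linarith)]
    linarith

/-- Tail bound for the spectral norm of the sign tensor under the null law. -/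
lemma nullLaw_specNorm_le (hd : 0 < d) (hp : 0 < p) {M : ℕ} (hM : 0 < M) {t : ℝ} (ht : 0 ≤ t) :
    (nullLaw n p).real {Y | t + p ^ d * (n * (d * (1 / M))) < (signTensor d Y).specNorm}
      ≤ 2 * (2 * (M + 1)) ^ p *
        Real.exp (n * (((p : ℝ) ^ d)⁻¹ ^ 2 * d.factorial) - ((p : ℝ) ^ d)⁻¹ * t) := by
  classical
  have hpd : (0 : ℝ) < (p : ℝ) ^ d := by positivity
  -- The largest exponential parameter allowed by the hypothesis of `nullLaw_tail_le`.
  set l := ((p : ℝ) ^ d)⁻¹ with hl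
  have hl0 : 0 < l := inv_pos.2 hpd
  set E := Real.exp (n * (l ^ 2 * d.factorial) - l * t) with hE
  set G : Finset (Fin p → Fin (M + 1) × Bool) :=
    Finset.univ.filter fun v => ∑ a, gridPoint M v a ^ 2 ≤ 1 with hG
  let A : ℝ → (Fin p → Fin (M + 1) × Bool) → Set (Fin n → Fin p → ℝ) := fun r v =>
    {Y | l * t ≤ r * ∑ j, (d.factorial : ℝ) * signPoly d (gridPoint M v) sgn (Y j)}
  have hsub : {Y : Fin n → Fin p → ℝ |
      t + p ^ d * (n * (d * (1 / M))) < (signTensor d Y).specNorm}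
      ⊆ ⋃ v ∈ G, (A l v ∪ A (-l) v) := by
    intro Y hY
    by_contra hcon
    simp only [Set.mem_iUnion, Set.mem_union, not_exists, not_or] at hcon
    refine absurd hY (not_lt.2 (RealTensor.specNorm_le _ (by positivity) fun x hx => ?_))
    have hx1 : ∀ a, |x a| ≤ 1 := fun a => (EuclideanSpace.abs_apply_le_norm x a).trans hx.le
    obtain ⟨v, hv⟩ := exists_gridPoint hM hx1
    have hsum : ∑ a, x a ^ 2 = 1 := by
      have := EuclideanSpace.real_norm_sq_eq x
      rw [← this, hx, one_pow]
    have hvG : v ∈ G := by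
      rw [hG, Finset.mem_filter]
      refine ⟨Finset.mem_univ _, hsum ▸ Finset.sum_le_sum fun a _ => ?_⟩
      exact sq_le_sq.2 (hv a).1
    have h := hcon v hvG
    have hdiff := (signTensor d Y).abs_form_sub_form_le (abs_signTensor_le Y) hx1
      (y := WithLp.toLp 2 (gridPoint M v)) (fun a => (hv a).1.trans (hx1 a)) fun a => (hv a).2
    have hgrid : |(signTensor d Y).form (WithLp.toLp 2 (gridPoint M v))| ≤ t := by
      rw [form_signTensor]
      simp only [A, Set.mem_ofPred_eq, not_le, neg_mul] at h
      have h1 := lt_of_mul_lt_mul_left h.1 hl0.le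
      rw [← mul_neg] at h
      have h2 := lt_of_mul_lt_mul_left h.2 hl0.le
      exact abs_le.2 ⟨by simpa using by linarith, h1.le⟩
    have := abs_sub_abs_le_abs_sub ((signTensor d Y).form x)
      ((signTensor d Y).form (WithLp.toLp 2 (gridPoint M v)))
    linarith
  have hA : ∀ r, |r| = l → ∀ v ∈ G, (nullLaw n p).real (A r v) ≤ E := fun r hr v hv => by
    have h := nullLaw_tail_le (n := n) hd (Finset.mem_filter.1 hv).2 (l := r)
      (by rw [hr, hl, inv_mul_cancel₀ hpd.ne']) (l * t)
    rwa [← sq_abs r, hr] at h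
  calc _ ≤ (nullLaw n p).real (⋃ v ∈ G, (A l v ∪ A (-l) v)) := measureReal_mono hsub (measure_ne_top _ _)
    _ ≤ ∑ v ∈ G, (nullLaw n p).real (A l v ∪ A (-l) v) := measureReal_biUnion_finset_le _ _
    _ ≤ ∑ v ∈ G, (E + E) := by
        refine Finset.sum_le_sum fun v hv => (measureReal_union_le _ _).trans ?_
        exact add_le_add (hA l (abs_of_pos hl0) v hv)
          (hA (-l) (by rw [abs_neg, abs_of_pos hl0]) v hv)
    _ ≤ ∑ v : Fin p → Fin (M + 1) × Bool, (E + E) :=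
        Finset.sum_le_sum_of_subset_of_nonneg (Finset.subset_univ _) fun _ _ _ => by positivity
    _ = _ := by
        simp only [Finset.sum_const, Finset.card_univ, Fintype.card_fun, Fintype.card_prod,
          Fintype.card_fin, Fintype.card_bool, nsmul_eq_mul]
        push_cast
        ring

end SignTensor

/-! ### The spectral norm under the noisy planted law -/

/-- Chebyshev's inequality for a sum of independent copies of a variable with positive mean. -/
lemma pi_sum_lt_le {Ω : Type*} [MeasurableSpace Ω] (ν : Measure Ω) [IsProbabilityMeasure ν]
    {G : Ω → ℝ} (hG : Measurable G) {C : ℝ} (hC : ∀ q, |G q| ≤ C) {V : ℝ}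
    (hm : 0 < ∫ q, G q ∂ν) (hV : ∫ q, G q ^ 2 ∂ν ≤ V) {n : ℕ} (hn : 0 < n) :
    (Measure.pi fun _ : Fin n => ν).real {q | ∑ j, G (q j) < n * (∫ q, G q ∂ν) / 2}
      ≤ 4 * V / (n * (∫ q, G q ∂ν) ^ 2) := by
  set m := ∫ q, G q ∂ν with hmdef
  have hn' : (0 : ℝ) < n := by exact_mod_cast hn
  have hL : MemLp G 2 ν := MemLp.of_bound hG.aestronglyMeasurable C (ae_of_all _ hC)
  have hGi : Integrable G ν := integrable_of_abs_le hG C hC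
  set X : (Fin n → Ω) → ℝ := ∑ j, fun q => G (q j) with hX
  have hXL : MemLp X 2 (Measure.pi fun _ : Fin n => ν) :=
    memLp_finsetSum' _ fun j _ => hL.comp_measurePreserving (measurePreserving_eval _ j)
  have hEX : ∫ q, X q ∂(Measure.pi fun _ : Fin n => ν) = n * m := by
    simp only [hX, Finset.sum_apply]
    rw [integral_finsetSum _ fun j _ => integrable_comp_eval hGi]
    simp_rw [integral_comp_eval (μ := fun _ : Fin n => ν) hG.aestronglyMeasurable]
    simp [hmdef]
  have hVar : Var[X; Measure.pi fun _ : Fin n => ν] ≤ n * V := by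
    rw [hX, variance_sum_pi (μ := fun _ : Fin n => ν) (X := fun _ => G) fun _ => hL]
    simp only [Finset.sum_const, Finset.card_univ, Fintype.card_fin, nsmul_eq_mul]
    refine mul_le_mul_of_nonneg_left ((variance_le_expectation_sq hG.aestronglyMeasurable).trans ?_)
      hn'.le
    simpa using hV
  have hc : 0 < n * m / 2 := by positivity
  have hcheb := meas_ge_le_variance_div_sq hXL hc
  rw [hEX] at hcheb
  have hsub : {q : Fin n → Ω | ∑ j, G (q j) < n * m / 2} ⊆ {q | n * m / 2 ≤ |X q - n * m|} := by
    intro q hq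
    have hXq : X q = ∑ j, G (q j) := by simp [hX]
    simp only [Set.mem_ofPred_eq] at hq ⊢
    rw [hXq, abs_sub_comm]
    refine le_trans ?_ (le_abs_self _)
    linarith
  calc _ ≤ (Measure.pi fun _ : Fin n => ν).real {q | n * m / 2 ≤ |X q - n * m|} :=
        measureReal_mono hsub (measure_ne_top _ _)
    _ ≤ Var[X; Measure.pi fun _ : Fin n => ν] / (n * m / 2) ^ 2 :=
        ENNReal.toReal_le_of_le_ofReal (div_nonneg (variance_nonneg _ _) (sq_nonneg _)) hcheb
    _ ≤ n * V / (n * m / 2) ^ 2 := div_le_div_of_nonneg_right hVar (sq_nonneg _)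
    _ = _ := by field_simp; ring

section Noisy

variable {d n p : ℕ} {ω : ℝ}

/-- The test statistic of a noisy sample. -/
def noisyStat (d : ℕ) {p : ℕ} (δ : ℝ) (u : Fin p → ℝ) (q : (Fin p → ℝ) × (Fin p → ℝ)) : ℝ :=
  signPoly d u sgn fun a => mix δ (q.1 a, q.2 a)

lemma measurable_noisyStat (δ : ℝ) (u : Fin p → ℝ) : Measurable (noisyStat d δ u) := by
  have h : Measurable fun (q : (Fin p → ℝ) × (Fin p → ℝ)) (a : Fin p) => mix δ (q.1 a, q.2 a) := by
    unfold mix; fun_prop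
  exact (measurable_signPoly d u measurable_sgn).comp h

lemma abs_noisyStat_le (δ : ℝ) {u : Fin p → ℝ} (hu : ∀ a, |u a| ≤ 1)
    (q : (Fin p → ℝ) × (Fin p → ℝ)) : |noisyStat d δ u q| ≤ p.choose d := by
  simpa [noisyStat] using abs_signPoly_le d hu abs_sgn_le fun a => mix δ (q.1 a, q.2 a)

lemma integral_tiltKernel_prod (h0 : 0 ≤ ω) (h1 : ω * p.choose d ≤ 1) (θ : Fin p → ℝ)
    (F : (Fin p → ℝ) × (Fin p → ℝ) → ℝ) :
    ∫ q, F q ∂((tiltKernel d p ω θ).prod (gaussVec p))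
      = ∫ q, (1 + tilt d ω θ q.1) * F q ∂((gaussVec p).prod (gaussVec p)) := by
  have hm : Measurable fun x => 1 + tilt d ω θ x := (measurable_tilt d ω θ).const_add 1
  have hm2 : Measurable fun q : (Fin p → ℝ) × (Fin p → ℝ) =>
      ENNReal.ofReal (1 + tilt d ω θ q.1) := hm.ennreal_ofReal.comp measurable_fst
  rw [tiltKernel_apply, prod_withDensity_left hm.ennreal_ofReal,
    integral_withDensity_eq_integral_toReal_smul hm2 (ae_of_all _ fun _ => ENNReal.ofReal_lt_top)]
  refine integral_congr_ae (ae_of_all _ fun q => ?_)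
  simp only [smul_eq_mul]
  rw [ENNReal.toReal_ofReal (one_add_tilt_nonneg h0 h1 θ q.1)]

lemma elemSymm_one (d p : ℕ) : elemSymm d (fun _ : Fin p => (1 : ℝ)) = p.choose d := by
  simp [elemSymm, Finset.card_powersetCard]

/-- The untilted part has mean zero by oddness. The tilt contributes ω times the covariance of two
sign polynomials, one in the clean and one in the noisy signs: each of the d factors of a monomial
contributes `signCorr δ`, and all squared coefficients are 1 because no θ_a vanishes. -/
lemma integral_noisyStat (hd : 0 < d) (h0 : 0 ≤ ω) (h1 : ω * p.choose d ≤ 1) (δ : ℝ)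
    {θ : Fin p → ℝ} (hθ : ∀ a, θ a ≠ 0) :
    ∫ q, noisyStat d δ (fun a => sgn (θ a)) q ∂((tiltKernel d p ω θ).prod (gaussVec p))
      = ω * (signCorr δ ^ d * p.choose d) := by
  set u : Fin p → ℝ := fun a => sgn (θ a) with hu
  have hu1 : ∀ a, |u a| ≤ 1 := fun a => abs_sgn_le _
  have hms : Measurable fun q : ℝ × ℝ => sgn q.1 := measurable_sgn.comp measurable_fst
  have hms' : Measurable fun q : ℝ × ℝ => sgn (mix δ q) := measurable_sgn.comp (measurable_mix δ)
  have hi : Integrable (noisyStat d δ u) ((gaussVec p).prod (gaussVec p)) :=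
    integrable_of_abs_le (measurable_noisyStat δ u) _ (abs_noisyStat_le δ hu1)
  have hi2 : Integrable (fun q : (Fin p → ℝ) × (Fin p → ℝ) =>
      tilt d ω θ q.1 * noisyStat d δ u q) ((gaussVec p).prod (gaussVec p)) :=
    hi.bdd_mul (c := 1) ((measurable_tilt d ω θ).comp measurable_fst).aestronglyMeasurable
      (ae_of_all _ fun q => abs_tilt_le h0 h1 θ q.1)
  rw [integral_tiltKernel_prod h0 h1]
  simp_rw [add_mul, one_mul]
  rw [integral_add hi hi2]
  have e1 : ∫ q, noisyStat d δ u q ∂((gaussVec p).prod (gaussVec p)) = 0 := by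
    have := integral_prod_pair stdGauss stdGauss
      fun x : Fin p → ℝ × ℝ => signPoly d u (fun q => sgn (mix δ q)) x
    rw [integral_signPoly_eq_zero hms' (fun q => abs_sgn_le _) (integral_sgn_mix δ) hd] at this
    exact this
  have e2 : ∫ q : (Fin p → ℝ) × (Fin p → ℝ), signPoly d u sgn q.1 * noisyStat d δ u q
      ∂((gaussVec p).prod (gaussVec p)) = signCorr δ ^ d * p.choose d := by
    have := integral_prod_pair stdGauss stdGauss
      fun x : Fin p → ℝ × ℝ => signPoly d u (fun q => sgn q.1) x *
        signPoly d u (fun q => sgn (mix δ q)) x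
    rw [integral_signPoly_mul_signPoly hms hms' (fun q => abs_sgn_le _) (fun q => abs_sgn_le _)
      integral_sgn_fst (integral_sgn_mix δ)] at this
    have huu : (fun a => u a * u a) = fun _ => 1 := funext fun a => sgn_mul_self (hθ a)
    rw [huu, elemSymm_one] at this
    exact this
  simp only [tilt]
  simp_rw [mul_assoc]
  rw [e1, integral_const_mul, e2, zero_add]

/-- The density is at most 2, and without the tilt the second moment is at most the number of
monomials. -/
lemma integral_noisyStat_sq_le (h0 : 0 ≤ ω) (h1 : ω * p.choose d ≤ 1) (δ : ℝ)
    {θ : Fin p → ℝ} (hθ : ∀ a, θ a ≠ 0) :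
    ∫ q, noisyStat d δ (fun a => sgn (θ a)) q ^ 2 ∂((tiltKernel d p ω θ).prod (gaussVec p))
      ≤ 2 * p.choose d := by
  set u : Fin p → ℝ := fun a => sgn (θ a) with hu
  have hu1 : ∀ a, |u a| ≤ 1 := fun a => abs_sgn_le _
  have hms' : Measurable fun q : ℝ × ℝ => sgn (mix δ q) := measurable_sgn.comp (measurable_mix δ)
  have hi : Integrable (fun q => noisyStat d δ u q ^ 2) ((gaussVec p).prod (gaussVec p)) :=
    integrable_of_abs_le ((measurable_noisyStat δ u).pow_const 2) ((p.choose d : ℝ) ^ 2) fun q => by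
      rw [abs_pow]; exact pow_le_pow_left₀ (abs_nonneg _) (abs_noisyStat_le δ hu1 q) 2
  rw [integral_tiltKernel_prod h0 h1]
  have e : ∫ q, noisyStat d δ u q ^ 2 ∂((gaussVec p).prod (gaussVec p)) ≤ p.choose d := by
    have := integral_prod_pair stdGauss stdGauss
      fun x : Fin p → ℝ × ℝ => signPoly d u (fun q => sgn (mix δ q)) x *
        signPoly d u (fun q => sgn (mix δ q)) x
    rw [integral_signPoly_mul_signPoly hms' hms' (fun q => abs_sgn_le _) (fun q => abs_sgn_le _)
      (integral_sgn_mix δ) (integral_sgn_mix δ)] at this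
    have huu : (fun a => u a * u a) = fun _ => 1 := funext fun a => sgn_mul_self (hθ a)
    rw [huu, elemSymm_one] at this
    have hsq : ∀ q : (Fin p → ℝ) × (Fin p → ℝ), noisyStat d δ u q ^ 2
        = signPoly d u (fun q => sgn (mix δ q)) (fun a => (q.1 a, q.2 a)) *
        signPoly d u (fun q => sgn (mix δ q)) (fun a => (q.1 a, q.2 a)) := fun q => sq _
    simp_rw [hsq]
    rw [this]
    refine mul_le_of_le_one_left (Nat.cast_nonneg _) (pow_le_one₀ ?_ ?_)
    · exact integral_nonneg fun q => mul_self_nonneg _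
    · calc ∫ q, sgn (mix δ q) * sgn (mix δ q) ∂gaussPair ≤ ∫ q, (1 : ℝ) ∂gaussPair := by
            refine integral_mono (integrable_of_abs_le (hms'.mul hms') 1 fun q =>
              abs_sgn_mul_sgn_le _ _) (integrable_const _) fun q => ?_
            exact (le_abs_self _).trans (abs_sgn_mul_sgn_le _ _)
        _ = 1 := by simp
  calc _ ≤ ∫ q, 2 * noisyStat d δ u q ^ 2 ∂((gaussVec p).prod (gaussVec p)) := by
        refine integral_mono (hi.bdd_mul (c := 2)
          (((measurable_tilt d ω θ).comp measurable_fst).const_add 1).aestronglyMeasurable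
          (ae_of_all _ fun q => ?_)) (hi.const_mul 2) fun q => ?_
        · rw [Real.norm_eq_abs]
          exact (abs_of_nonneg (one_add_tilt_nonneg h0 h1 θ q.1)).le.trans
            (one_add_tilt_le h0 h1 θ q.1)
        · exact mul_le_mul_of_nonneg_right (one_add_tilt_le h0 h1 θ q.1) (sq_nonneg _)
    _ ≤ _ := by rw [integral_const_mul]; linarith

/-- The statistic given the hidden parameter exceeds half of its mean with high probability. -/
lemma pi_tiltKernel_prod_le (hd : 0 < d) (h0 : 0 < ω) (h1 : ω * p.choose d ≤ 1) {δ : ℝ}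
    (hδ : 0 < signCorr δ) (hdp : d ≤ p) (hn : 0 < n) {θ : Fin p → ℝ} (hθ : ∀ a, θ a ≠ 0) :
    ((Measure.pi fun _ : Fin n => tiltKernel d p ω θ).prod (nullLaw n p)).real
      {q | ∑ j, noisyStat d δ (fun a => sgn (θ a)) (q.1 j, q.2 j)
        < n * (ω * (signCorr δ ^ d * p.choose d)) / 2}
      ≤ 4 * (2 * p.choose d) / (n * (ω * (signCorr δ ^ d * p.choose d)) ^ 2) := by
  have := isMarkovKernel_tiltKernel (p := p) hd h0.le h1
  have hE := integral_noisyStat hd h0.le h1 δ hθ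
  have hch : (0 : ℝ) < p.choose d := by exact_mod_cast Nat.choose_pos hdp
  have key := pi_sum_lt_le ((tiltKernel d p ω θ).prod (gaussVec p))
    (measurable_noisyStat (d := d) δ fun a => sgn (θ a))
    (abs_noisyStat_le δ fun a => abs_sgn_le (θ a)) (by rw [hE]; positivity)
    (integral_noisyStat_sq_le h0.le h1 δ hθ) hn
  rw [hE] at key
  refine le_trans (le_of_eq ?_) key
  have h := measurePreserving_arrowProdEquivProdArrow (Fin p → ℝ) (Fin p → ℝ) (Fin n)
    (fun _ => tiltKernel d p ω θ) (fun _ => gaussVec p)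
  rw [measureReal_def, measureReal_def, nullLaw, ← h.measure_preimage_equiv]
  rfl

/-- A vector of signs. -/
def signVec {p : ℕ} (v : Fin p → Bool) (a : Fin p) : ℝ := if v a then 1 else -1

lemma exists_signVec_eq {θ : Fin p → ℝ} (hθ : ∀ a, θ a ≠ 0) :
    ∃ v, signVec v = fun a => sgn (θ a) := by
  refine ⟨fun a => decide (0 < θ a), funext fun a => ?_⟩
  rcases lt_or_gt_of_ne (hθ a) with h | h
  · simp [signVec, sgn_of_neg h, h.le]
  · simp [signVec, sgn_of_pos h, h]

lemma signPoly_const_mul {α Ω : Type*} [Fintype α] (c : ℝ) (u : α → ℝ) (s : Ω → ℝ) (x : α → Ω) :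
    signPoly d (fun a => c * u a) s x = c ^ d * signPoly d u s x := by
  rw [signPoly_eq_sum, signPoly_eq_sum, Finset.mul_sum]
  refine Finset.sum_congr rfl fun S hS => ?_
  rw [Finset.prod_mul_distrib, Finset.prod_const, (Finset.mem_powersetCard.1 hS).2, mul_assoc]

/-- The form is evaluated at the unit vector v/√p; homogeneity of degree d produces the power of √p.
-/
lemma sum_signPoly_signVec_le (hp : 0 < p) (Y : Fin n → Fin p → ℝ) (v : Fin p → Bool) :
    (d.factorial : ℝ) * (Real.sqrt p ^ d)⁻¹ * ∑ j, signPoly d (signVec v) sgn (Y j)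
      ≤ (signTensor d Y).specNorm := by
  have hp' : (0 : ℝ) < p := by exact_mod_cast hp
  have hs0 : 0 < Real.sqrt p := Real.sqrt_pos.2 hp'
  have hx : ‖(WithLp.toLp 2 fun a => (Real.sqrt p)⁻¹ * signVec v a : EuclideanSpace ℝ (Fin p))‖
      = 1 := by
    rw [EuclideanSpace.norm_eq, Real.sqrt_eq_one]
    have : ∀ a, ‖(Real.sqrt p)⁻¹ * signVec v a‖ ^ 2 = (p : ℝ)⁻¹ := fun a => by
      rw [Real.norm_eq_abs, sq_abs, mul_pow, inv_pow, Real.sq_sqrt hp'.le]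
      have : signVec v a ^ 2 = 1 := by unfold signVec; split_ifs <;> norm_num
      rw [this, mul_one]
    simp only [this]
    simp [hp'.ne']
  refine le_trans (le_of_eq ?_) ((le_abs_self _).trans
    ((signTensor d Y).abs_form_le_specNorm hx))
  rw [form_signTensor, Finset.mul_sum]
  refine Finset.sum_congr rfl fun j _ => ?_
  simp only
  rw [signPoly_const_mul, inv_pow, mul_assoc]

lemma ae_gaussVec_ne_zero : ∀ᵐ θ ∂(gaussVec p), ∀ a, θ a ≠ 0 :=
  ae_all_iff.2 fun a =>
    (measurePreserving_eval (fun _ : Fin p => stdGauss) a).quasiMeasurePreserving.ae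
      ae_ne_zero_stdGauss

lemma isProbabilityMeasure_plantedLaw (hd : 0 < d) (h0 : 0 ≤ ω) (h1 : ω * p.choose d ≤ 1) :
    IsProbabilityMeasure (plantedLaw n p (gaussVec p) (tiltKernel d p ω)) := by
  have hK := isMarkovKernel_tiltKernel (p := p) hd h0 h1
  refine ⟨?_⟩
  rw [plantedLaw, Measure.bind_apply MeasurableSet.univ
    (measurable_pi_tiltKernel h0 h1).aemeasurable]
  simp

lemma isProbabilityMeasure_noisy (δ : ℝ) (P : Measure (Fin n → Fin p → ℝ))
    [IsProbabilityMeasure P] : IsProbabilityMeasure (noisy δ P) := by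
  have hφ : Measurable fun YZ : (Fin n → Fin p → ℝ) × (Fin n → Fin p → ℝ) =>
      Real.sqrt (1 - δ) • YZ.1 + Real.sqrt δ • YZ.2 := by fun_prop
  unfold noisy
  exact Measure.isProbabilityMeasure_map hφ.aemeasurable

/-- Under the noisy planted law the spectral norm of the sign tensor is large. -/
lemma noisy_plantedLaw_specNorm_lt_le (hd : 0 < d) (h0 : 0 < ω) (h1 : ω * p.choose d ≤ 1) {δ : ℝ}
    (hδ : 0 < signCorr δ) (hdp : d ≤ p) (hn : 0 < n) :
    (noisy δ (plantedLaw n p (gaussVec p) (tiltKernel d p ω))).real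
      {Y | (signTensor d Y).specNorm < (d.factorial : ℝ) * (Real.sqrt p ^ d)⁻¹ *
        (n * (ω * (signCorr δ ^ d * p.choose d)) / 2)}
      ≤ 4 * (2 * p.choose d) / (n * (ω * (signCorr δ ^ d * p.choose d)) ^ 2) := by
  have hK := isMarkovKernel_tiltKernel (p := p) hd h0.le h1
  have hp : 0 < p := hd.trans_le hdp
  have hs0 : 0 < Real.sqrt p := Real.sqrt_pos.2 (by exact_mod_cast hp)
  set r := n * (ω * (signCorr δ ^ d * p.choose d)) / 2 with hr
  set b := 4 * (2 * (p.choose d : ℝ)) / (n * (ω * (signCorr δ ^ d * p.choose d)) ^ 2) with hb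
  have hb0 : 0 ≤ b := by rw [hb]; positivity
  set P := plantedLaw n p (gaussVec p) (tiltKernel d p ω) with hP
  have hPp := isProbabilityMeasure_plantedLaw (n := n) hd h0.le h1
  -- Quantifying over all sign vectors makes the event independent of θ, and visibly measurable, so
  -- that the noisy mixture can be integrated. Given θ, only the instance v = sgn θ is used.
  set B : Set (Fin n → Fin p → ℝ) := {Y | ∀ v, ∑ j, signPoly d (signVec v) sgn (Y j) < r} with hB
  have hBm : MeasurableSet B := by
    rw [hB, Set.ofPred_forall]
    refine MeasurableSet.iInter fun v => measurableSet_lt ?_ measurable_const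
    exact Finset.measurable_fun_sum _ fun j _ =>
      (measurable_signPoly d _ measurable_sgn).comp (measurable_pi_apply j)
  have hφ : Measurable fun YZ : (Fin n → Fin p → ℝ) × (Fin n → Fin p → ℝ) =>
      Real.sqrt (1 - δ) • YZ.1 + Real.sqrt δ • YZ.2 := by fun_prop
  have hprob : IsProbabilityMeasure (noisy δ P) := isProbabilityMeasure_noisy δ P
  have hsub : {Y : Fin n → Fin p → ℝ |
      (signTensor d Y).specNorm < (d.factorial : ℝ) * (Real.sqrt p ^ d)⁻¹ * r} ⊆ B := by
    intro Y hY v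
    have h := (sum_signPoly_signVec_le (d := d) hp Y v).trans_lt hY
    exact lt_of_mul_lt_mul_left h (by positivity)
  refine (measureReal_mono hsub (measure_ne_top _ _)).trans ?_
  refine ENNReal.toReal_le_of_le_ofReal hb0 ?_
  rw [noisy, Measure.map_apply hφ hBm, Measure.prod_apply (hφ hBm), hP, plantedLaw,
    Measure.lintegral_bind (measurable_pi_tiltKernel h0.le h1).aemeasurable
      (measurable_measure_prodMk_left (hφ hBm)).aemeasurable]
  calc _ ≤ ∫⁻ _θ, ENNReal.ofReal b ∂(gaussVec p) := by
        refine lintegral_mono_ae (ae_gaussVec_ne_zero.mono fun θ hθ => ?_)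
        rw [← Measure.prod_apply (hφ hBm)]
        rw [← ofReal_measureReal (measure_ne_top _ _)]
        refine ENNReal.ofReal_le_ofReal ((measureReal_mono ?_ (measure_ne_top _ _)).trans
          (pi_tiltKernel_prod_le hd h0 h1 hδ hdp hn hθ))
        intro q hq
        obtain ⟨v, hv⟩ := exists_signVec_eq hθ
        have := hq v
        rw [hv] at this
        exact this
    _ = ENNReal.ofReal b := by simp

end Noisy

/-! ### Program logic and the program that computes the sign tensor -/

namespace RealRAM

/-- Total correctness with a time bound. -/
def Triple (P : State → Prop) (c : Prog) (t : ℕ) (Q : State → Prop) : Prop :=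
  ∀ s, P s → ∃ t' s', Exec c s t' s' ∧ t' ≤ t ∧ Q s'

lemma Triple.seq {P Q R : State → Prop} {c₁ c₂ : Prog} {t₁ t₂ : ℕ} (h₁ : Triple P c₁ t₁ Q)
    (h₂ : Triple Q c₂ t₂ R) : Triple P (.seq c₁ c₂) (t₁ + t₂) R := by
  intro s hs
  obtain ⟨a, s', e, ha, hs'⟩ := h₁ s hs
  obtain ⟨b, s'', e', hb, hs''⟩ := h₂ s' hs'
  exact ⟨a + b, s'', .seq e e', by omega, hs''⟩

lemma Triple.conseq {P P' Q Q' : State → Prop} {c : Prog} {t t' : ℕ} (h : Triple P c t Q)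
    (hP : ∀ s, P' s → P s) (ht : t ≤ t') (hQ : ∀ s, Q s → Q' s) : Triple P' c t' Q' := by
  intro s hs
  obtain ⟨a, s', e, ha, hs'⟩ := h s (hP s hs)
  exact ⟨a, s', e, ha.trans ht, hQ _ hs'⟩

/-- The invariant `I j` holds after j passes and the number m of passes is known in advance. Each
pass costs one test besides the body, and one last failing test ends the loop. -/
lemma Triple.loop {b : Cond} {c : Prog} {t m : ℕ} (I : ℕ → State → Prop)
    (hbody : ∀ j < m, Triple (I j) c t (I (j + 1))) (hb : ∀ j < m, ∀ s, I j s → b.Holds s)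
    (hend : ∀ s, I m s → ¬ b.Holds s) : Triple (I 0) (.while b c) (m * (t + 1) + 1) (I m) := by
  have key : ∀ r j, j + r = m → Triple (I j) (.while b c) (r * (t + 1) + 1) (I m) := by
    intro r
    induction r with
    | zero =>
      intro j hj s hs
      obtain rfl : j = m := by omega
      exact ⟨1, s, .whileFalse (hend s hs), by omega, hs⟩
    | succ r ih =>
      intro j hj s hs
      obtain ⟨a, s', e, ha, hs'⟩ := hbody j (by omega) s hs
      obtain ⟨a', s'', e', ha', hs''⟩ := ih (j + 1) (by omega) s' hs'
      refine ⟨a + a' + 1, s'', .whileTrue (hb j (by omega) s hs) e e', ?_, hs''⟩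
      rw [Nat.succ_mul]; omega
  exact key m 0 (by omega)

/-- A nonempty straight-line program. -/
def block : Instr → List Instr → Prog
  | i, [] => .instr i
  | i, j :: l => .seq (.instr i) (block j l)

lemma exec_block (i : Instr) (l : List Instr) (s : State) :
    Exec (block i l) s (l.length + 1) ((i :: l).foldl (fun s i => i.run s) s) := by
  induction l generalizing i s with
  | nil => exact .instr i s
  | cons j l ih =>
    have := Exec.seq (.instr i s) (ih j (i.run s))
    rw [Nat.add_comm 1] at this
    exact this

lemma Triple.block {P Q : State → Prop} (i : Instr) (l : List Instr)
    (h : ∀ s, P s → Q ((i :: l).foldl (fun s i => i.run s) s)) :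
    Triple P (block i l) (l.length + 1) Q :=
  fun s hs => ⟨_, _, exec_block i l s, le_rfl, h s hs⟩

/-- Multiplies real register `1` by the signs of the memory cells addressed by the first `m` digits,
relative to the offset in register `3`. -/
def mulSigns : ℕ → Prog
  | 0 => block (.realConst 2 0) []
  | m + 1 => .seq (mulSigns m) (block (.natAdd 4 3 (6 + m))
      [.realLoad 2 4, .realMul 3 2 2, .realSqrt 3 3, .realDiv 2 2 3, .realMul 1 1 2])

/-- Multiplies real register `1` by `0` if digit `k` agrees with one of the first `m` digits. -/
def mulDistinct (k : ℕ) : ℕ → Prog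
  | 0 => block (.realConst 2 0) []
  | m + 1 => .seq (mulDistinct k m) (block (.realOfNat 2 (6 + k))
      [.realOfNat 3 (6 + m), .realSub 2 2 3, .realDiv 2 2 2, .realMul 1 1 2])

/-- Multiplies real register `1` by `0` if the first `m` digits are not distinct. -/
def mulInjective : ℕ → Prog
  | 0 => block (.realConst 2 0) []
  | m + 1 => .seq (mulInjective m) (mulDistinct m m)

/-- Computes the entry of the sign tensor given by the digits, stores it and advances the address. -/
def entryProg (d : ℕ) : Prog :=
  .seq (block (.realConst 0 0) [.natConst 3 0])
    (.seq (.while (.natLT 3 1) (.seq (block (.realConst 1 1) []) (.seq (mulSigns d)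
      (.seq (mulInjective d) (block (.realAdd 0 0 1) [.natAdd 3 3 0])))))
      (block (.realStore 2 0) [.natAdd 2 2 5]))

/-- Runs through all values of the first `m` digits. -/
def nestProg (d : ℕ) : ℕ → Prog
  | 0 => entryProg d
  | m + 1 => .seq (.while (.natLT (6 + m) 0)
      (.seq (nestProg d m) (block (.natAdd (6 + m) (6 + m) 5) []))) (block (.natConst (6 + m) 0) [])

/-- Replaces the samples in the memory by their sign tensor. -/
def tensorProg (d : ℕ) : Prog :=
  .seq (block (.natConst 5 1) [.natAdd 2 1 4]) (.seq (nestProg d d)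
    (.seq (block (.natSub 3 2 1) [.natConst 4 0])
    (.seq (.while (.natLT 4 3) (block (.natAdd 2 4 1) [.realLoad 0 2, .realStore 4 0, .natAdd 4 4 5]))
    (.seq (block (.natAdd 2 3 1) [.realConst 0 0])
    (.seq (.while (.natLT 4 2) (block (.realStore 4 0) [.natAdd 4 4 5]))
    (block (.natConst 2 0) [.natAdd 1 3 2, .natConst 3 0, .natConst 4 0, .natConst 5 0,
      .realConst 0 0, .realConst 1 0, .realConst 2 0, .realConst 3 0]))))))

/-- Contents of the machine inside the loop over the samples; register `4` and the real registers `2`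
and `3` are scratch. -/
structure Core (p N A o : ℕ) (i : ℕ → ℕ) (M : ℕ → ℝ) (acc pr : ℝ) (s : State) : Prop where
  size : s.natReg 0 = p
  len : s.natReg 1 = N
  addr : s.natReg 2 = A
  offset : s.natReg 3 = o
  one : s.natReg 5 = 1
  digit : ∀ k, s.natReg (6 + k) = i k
  natMem : s.natMem = fun _ => 0
  reals : ∀ k, s.realReg (4 + k) = 0
  mem : s.realMem = M
  acc : s.realReg 0 = acc
  pr : s.realReg 1 = pr

lemma digit_register_ne (k : ℕ) : ¬ 6 + k = 1 ∧ ¬ 6 + k = 2 ∧ ¬ 6 + k = 3 ∧ ¬ 6 + k = 4 ∧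
    ¬ 6 + k = 5 := by omega

lemma idle_register_ne (k : ℕ) : ¬ 4 + k = 1 ∧ ¬ 4 + k = 2 ∧ ¬ 4 + k = 3 := by omega

section Spec

variable {p N A o : ℕ} {i : ℕ → ℕ} {M : ℕ → ℝ} {acc pr : ℝ}

/-- A sign is computed as x/√(x·x). There is no empty program, so the base case overwrites a scratch
register, which accounts for the 1 in the running time. -/
lemma triple_mulSigns (m : ℕ) : Triple (Core p N A o i M acc pr) (mulSigns m) (1 + 6 * m)
    (Core p N A o i M acc (pr * ∏ k ∈ Finset.range m, sgn (M (o + i k)))) := by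
  induction m with
  | zero =>
    refine Triple.block _ _ fun s h => ?_
    obtain ⟨h0, h1, h2, h3, h5, h6, h7, h8, h9, h10, h11⟩ := h
    constructor <;>
      simp [Instr.run, idle_register_ne, *]
  | succ m ih =>
    refine (ih.seq (Triple.block _ _ fun s h => ?_)).conseq (fun _ h => h) (by simp; omega)
      fun _ h => h
    obtain ⟨h0, h1, h2, h3, h5, h6, h7, h8, h9, h10, h11⟩ := h
    constructor <;>
      simp [Instr.run, digit_register_ne, idle_register_ne, *]
    rw [Finset.prod_range_succ, sgn, Real.sqrt_mul_self_eq_abs, mul_assoc]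

lemma triple_mulDistinct (k m : ℕ) : Triple (Core p N A o i M acc pr) (mulDistinct k m) (1 + 5 * m)
    (Core p N A o i M acc (pr * ∏ l ∈ Finset.range m, ((i k : ℝ) - i l) / ((i k : ℝ) - i l))) := by
  induction m with
  | zero =>
    refine Triple.block _ _ fun s h => ?_
    obtain ⟨h0, h1, h2, h3, h5, h6, h7, h8, h9, h10, h11⟩ := h
    constructor <;>
      simp [Instr.run, idle_register_ne, *]
  | succ m ih =>
    refine (ih.seq (Triple.block _ _ fun s h => ?_)).conseq (fun _ h => h) (by simp; omega)
      fun _ h => h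
    obtain ⟨h0, h1, h2, h3, h5, h6, h7, h8, h9, h10, h11⟩ := h
    constructor <;> simp [Instr.run, idle_register_ne,
      -Finset.prod_div_distrib, *]
    rw [Finset.prod_range_succ, mul_assoc]

/-- Indicator of the injectivity of the first `m` digits. -/
def distinctFactor (m : ℕ) (i : ℕ → ℕ) : ℝ :=
  ∏ k ∈ Finset.range m, ∏ l ∈ Finset.range k, ((i k : ℝ) - i l) / ((i k : ℝ) - i l)

lemma triple_mulInjective (m : ℕ) : Triple (Core p N A o i M acc pr) (mulInjective m)
    (1 + 6 * m * (m + 1)) (Core p N A o i M acc (pr * distinctFactor m i)) := by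
  induction m with
  | zero =>
    refine Triple.block _ _ fun s h => ?_
    obtain ⟨h0, h1, h2, h3, h5, h6, h7, h8, h9, h10, h11⟩ := h
    constructor <;> simp [Instr.run, idle_register_ne, distinctFactor, *]
  | succ m ih =>
    refine (ih.seq (triple_mulDistinct m m)).conseq (fun _ h => h) (by nlinarith) fun s h => ?_
    rwa [mul_assoc, distinctFactor, ← Finset.prod_range_succ
      (fun k => ∏ l ∈ Finset.range k, ((i k : ℝ) - i l) / ((i k : ℝ) - i l))] at h

/-- The contribution of one sample to an entry of the sign tensor. -/
def sampleTerm (d : ℕ) (M : ℕ → ℝ) (i : ℕ → ℕ) (o : ℕ) : ℝ :=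
  (∏ k ∈ Finset.range d, sgn (M (o + i k))) * distinctFactor d i

/-- An entry of the sign tensor. -/
def entry (d p n : ℕ) (M : ℕ → ℝ) (i : ℕ → ℕ) : ℝ :=
  ∑ j ∈ Finset.range n, sampleTerm d M i (j * p)

/-- Contents of the machine between the computations of the entries. -/
def Frame (p N A : ℕ) (i : ℕ → ℕ) (M : ℕ → ℝ) (s : State) : Prop :=
  ∃ o acc pr, Core p N A o i M acc pr s

/-- Running time of the computation of an entry. -/
def entryCost (d n : ℕ) : ℕ := n * (6 * d + 6 * d * (d + 1) + 6) + 5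

lemma triple_entryProg (d n : ℕ) (hp : 0 < p) : Triple (Frame p (n * p) A i M) (entryProg d)
    (entryCost d n)
    (Frame p (n * p) (A + 1) i (Function.update M A (entry d p n M i))) := by
  have h1 : Triple (Frame p (n * p) A i M) (block (.realConst 0 0) [.natConst 3 0]) 2
      (fun s => ∃ pr, Core p (n * p) A (0 * p) i M
        (∑ j ∈ Finset.range 0, sampleTerm d M i (j * p)) pr s) := by
    refine Triple.block _ _ fun s h => ?_
    obtain ⟨o, acc, pr, h0, h1, h2, h3, h5, h6, h7, h8, h9, h10, h11⟩ := h
    refine ⟨pr, ?_⟩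
    constructor <;>
      simp [Instr.run, digit_register_ne, *]
  have h2 : ∀ j < n, Triple (fun s => ∃ pr, Core p (n * p) A (j * p) i M
      (∑ j ∈ Finset.range j, sampleTerm d M i (j * p)) pr s)
      (.seq (block (.realConst 1 1) []) (.seq (mulSigns d)
        (.seq (mulInjective d) (block (.realAdd 0 0 1) [.natAdd 3 3 0]))))
      (6 * d + 6 * d * (d + 1) + 5)
      (fun s => ∃ pr, Core p (n * p) A ((j + 1) * p) i M
        (∑ j ∈ Finset.range (j + 1), sampleTerm d M i (j * p)) pr s) := by
    intro j _
    refine ((Triple.block (Q := Core p (n * p) A (j * p) i M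
      (∑ j ∈ Finset.range j, sampleTerm d M i (j * p)) 1) _ _ fun s h => ?_).seq
      ((triple_mulSigns d).seq ((triple_mulInjective d).seq
      (Triple.block _ _ fun s h => ?_)))).conseq (fun _ h => h)
      (by simp only [List.length_nil, List.length_cons]; omega) fun _ h => h
    · obtain ⟨pr, h0, h1, h2, h3, h5, h6, h7, h8, h9, h10, h11⟩ := h
      constructor <;>
      simp [Instr.run, idle_register_ne, *]
    · obtain ⟨h0, h1, h2, h3, h5, h6, h7, h8, h9, h10, h11⟩ := h
      refine ⟨sampleTerm d M i (j * p), ?_⟩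
      constructor <;> simp [Instr.run, digit_register_ne, Finset.sum_range_succ, sampleTerm, *]
      ring
  have h3 := Triple.loop (b := .natLT 3 1) _ h2
    (fun j hj s ⟨pr, h⟩ => by
      simp only [Cond.Holds, h.offset, h.len]
      exact Nat.mul_lt_mul_of_pos_right hj hp)
    (fun s ⟨pr, h⟩ => by simp only [Cond.Holds, h.offset, h.len]; omega)
  refine (h1.seq (h3.seq (Triple.block _ _ fun s h => ?_))).conseq (fun _ h => h)
    (by simp only [List.length_nil, List.length_cons, entryCost]; rw [add_assoc _ 5 1]; omega)
    fun _ h => h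
  obtain ⟨pr, h0, h1, h2, h3, h5, h6, h7, h8, h9, h10, h11⟩ := h
  refine ⟨n * p, entry d p n M i, pr, ?_⟩
  constructor <;> simp [Instr.run, digit_register_ne, entry, *]

/-- Replaces the first `m` digits by those of `c`. -/
def setDigits (p m : ℕ) (i : ℕ → ℕ) (c k : ℕ) : ℕ := if k < m then c / p ^ k % p else i k

/-- For c < p^m, the number q p^m + c has the first m base-p digits of c, followed by the digit q.
Hence the nested loops visit the index tuples in the order of their codes. -/
lemma setDigits_update {m q c : ℕ} (hq : q < p) (hc : c < p ^ m) :
    setDigits p m (Function.update i m q) c = setDigits p (m + 1) i (q * p ^ m + c) := by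
  funext k
  unfold setDigits
  rcases lt_trichotomy k m with h | rfl | h
  · rw [if_pos h, if_pos (by omega)]
    obtain ⟨r, rfl⟩ : ∃ r, m = k + 1 + r := ⟨m - k - 1, by omega⟩
    have e : q * p ^ (k + 1 + r) + c = p ^ k * (p * (q * p ^ r)) + c := by ring
    have hpk : 0 < p ^ k := pow_pos (by omega) k
    rw [e, Nat.mul_add_div hpk, Nat.mul_add_mod]
  · have hpk : 0 < p ^ k := pow_pos (by omega) k
    rw [if_neg (lt_irrefl _), if_pos (by omega), Function.update_self, mul_comm, Nat.mul_add_div hpk,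
      Nat.div_eq_of_lt hc, add_zero, Nat.mod_eq_of_lt hq]
  · rw [if_neg (by omega), if_neg (by omega), Function.update_of_ne (by omega)]

lemma sampleTerm_congr {d : ℕ} {M' : ℕ → ℝ} (h : ∀ k < d, M (o + i k) = M' (o + i k)) :
    sampleTerm d M i o = sampleTerm d M' i o := by
  unfold sampleTerm
  congr 1
  exact Finset.prod_congr rfl fun k hk => by rw [h k (Finset.mem_range.1 hk)]

lemma entry_congr {d n : ℕ} {M' : ℕ → ℝ} (hi : ∀ k < d, i k < p)
    (h : ∀ a < n * p, M a = M' a) : entry d p n M i = entry d p n M' i := by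
  refine Finset.sum_congr rfl fun j hj => sampleTerm_congr fun k hk => h _ ?_
  have : (j + 1) * p ≤ n * p := Nat.mul_le_mul_right p (Finset.mem_range.1 hj)
  have := hi k hk
  rw [add_mul] at *
  omega

/-- Running time of the nested loops. -/
def nestCost (d n p : ℕ) : ℕ → ℕ
  | 0 => entryCost d n
  | m + 1 => p * (nestCost d n p m + 2) + 2

/-- Induction on the number of digits, the last one belonging to the outermost loop. Address, digits
and memory are generalized because each pass starts with a new digit, a later address and a partly
filled table. The samples, recorded by M₀, are never overwritten since the table starts at or beyond
address n p. -/
lemma triple_nestProg (d n : ℕ) (hp : 0 < p) (M₀ : ℕ → ℝ) (m : ℕ) :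
    ∀ (A : ℕ) (i : ℕ → ℕ) (M : ℕ → ℝ), (∀ k < m, i k = 0) → (∀ k, i k < p) → n * p ≤ A →
      (∀ a < n * p, M a = M₀ a) →
      Triple (Frame p (n * p) A i M) (nestProg d m) (nestCost d n p m)
        (Frame p (n * p) (A + p ^ m) i (fun a =>
          if A ≤ a ∧ a < A + p ^ m then entry d p n M₀ (setDigits p m i (a - A)) else M a)) := by
  induction m with
  | zero =>
    intro A i M _ hi _ hM
    refine (triple_entryProg d n hp).conseq (fun _ h => h) le_rfl fun s h => ?_
    rw [pow_zero]
    convert h using 1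
    funext a
    have e : setDigits p 0 i (a - A) = i := by funext k; simp [setDigits]
    rw [e, Function.update_apply, entry_congr (fun k _ => hi k) hM]
    by_cases ha : a = A
    · rw [if_pos (by omega), if_pos ha]
    · rw [if_neg (by omega), if_neg ha]
  | succ m ih =>
    intro A i M hi0 hi hA hM
    -- The memory after q passes of the outermost loop: q blocks of p^m entries have been written.
    let M' : ℕ → ℕ → ℝ := fun q a => if A ≤ a ∧ a < A + q * p ^ m then
      entry d p n M₀ (setDigits p (m + 1) i (a - A)) else M a
    have hpm : 0 < p ^ m := pow_pos hp m
    have hbody : ∀ q < p, Triple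
        (Frame p (n * p) (A + q * p ^ m) (Function.update i m q) (M' q))
        (.seq (nestProg d m) (block (.natAdd (6 + m) (6 + m) 5) [])) (nestCost d n p m + 1)
        (Frame p (n * p) (A + (q + 1) * p ^ m) (Function.update i m (q + 1)) (M' (q + 1))) := by
      intro q hq
      refine (ih (A + q * p ^ m) (Function.update i m q) (M' q) ?_ ?_ ?_ ?_).seq
        (Triple.block _ _ fun s h => ?_)
      · intro k hk
        rw [Function.update_of_ne (by omega)]
        exact hi0 k (by omega)
      · intro k
        rw [Function.update_apply]
        split_ifs
        · exact hq
        · exact hi k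
      · exact le_add_right hA
      · intro a ha
        simp only [M']
        rw [if_neg (by omega)]
        exact hM a ha
      · obtain ⟨o, acc, pr, h0, h1, h2, h3, h5, h6, h7, h8, h9, h10, h11⟩ := h
        refine ⟨o, acc, pr, ?_⟩
        have hdig : ∀ k, (if 6 + k = 6 + m then s.natReg (6 + m) + s.natReg 5 else s.natReg (6 + k))
            = Function.update i m (q + 1) k := fun k => by
          rw [h6, h6, h5]
          by_cases hk : k = m
          · subst hk; simp
          · rw [if_neg (by omega), Function.update_of_ne hk, Function.update_of_ne hk]
        have e6 : ∀ r, r < 6 → ¬ r = 6 + m := fun r hr => by omega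
        refine ⟨?_, ?_, ?_, ?_, ?_, ?_, ?_, ?_, ?_, ?_, ?_⟩
        · simpa [Instr.run, Function.update_apply, e6] using h0
        · simpa [Instr.run, Function.update_apply, e6] using h1
        · simp only [List.foldl_cons, List.foldl_nil, Instr.run, Function.update_apply,
            e6 2 (by norm_num), if_false, h2]
          ring
        · simpa [Instr.run, Function.update_apply, e6] using h3
        · simpa [Instr.run, Function.update_apply, e6] using h5
        · intro k
          simpa only [List.foldl_cons, List.foldl_nil, Instr.run, Function.update_apply] using hdig k
        · exact h7
        · exact h8
        · refine h9.trans (funext fun a => ?_)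
          simp only [M']
          have e1 : (q + 1) * p ^ m = q * p ^ m + p ^ m := by ring
          rw [e1]
          by_cases ha : A + q * p ^ m ≤ a ∧ a < A + q * p ^ m + p ^ m
          · rw [if_pos ha, if_pos (by omega), setDigits_update hq (by omega)]
            congr 2
            omega
          · rw [if_neg ha]
            by_cases ha' : A ≤ a ∧ a < A + q * p ^ m
            · rw [if_pos ha', if_pos (by omega)]
            · rw [if_neg ha', if_neg (by omega)]
        · exact h10
        · exact h11
    have hloop := Triple.loop (b := .natLT (6 + m) 0) _ hbody
      (fun q hq s ⟨o, acc, pr, h⟩ => by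
        simp only [Cond.Holds, h.digit, h.size, Function.update_self]; exact hq)
      (fun s ⟨o, acc, pr, h⟩ => by
        simp only [Cond.Holds, h.digit, h.size, Function.update_self]; omega)
    refine (hloop.seq (Triple.block _ _ fun s h => ?_)).conseq (fun s h => ?_) ?_ fun _ h => h
    · obtain ⟨o, acc, pr, h0, h1, h2, h3, h5, h6, h7, h8, h9, h10, h11⟩ := h
      refine ⟨o, acc, pr, ?_⟩
      have e6 : ∀ r, r < 6 → ¬ r = 6 + m := fun r hr => by omega
      refine ⟨?_, ?_, ?_, ?_, ?_, ?_, ?_, ?_, ?_, ?_, ?_⟩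
      · simpa [Instr.run, Function.update_apply, e6] using h0
      · simpa [Instr.run, Function.update_apply, e6] using h1
      · simp only [List.foldl_cons, List.foldl_nil, Instr.run, Function.update_apply,
          e6 2 (by norm_num), if_false, h2]
        ring
      · simpa [Instr.run, Function.update_apply, e6] using h3
      · simpa [Instr.run, Function.update_apply, e6] using h5
      · intro k
        simp only [List.foldl_cons, List.foldl_nil, Instr.run, Function.update_apply]
        by_cases hk : k = m
        · subst hk; simp [hi0 k (by omega)]
        · rw [if_neg (by omega), h6, Function.update_of_ne hk]
      · exact h7
      · exact h8
      · refine h9.trans (funext fun a => ?_)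
        simp only [M']
        rw [pow_succ, mul_comm p]
      · exact h10
      · exact h11
    · have e1 : Function.update i m 0 = i := by
        rw [← hi0 m (by omega), Function.update_eq_self]
      have e2 : M' 0 = M := by
        funext a
        simp only [M']
        rw [if_neg (by omega)]
      rw [e1, e2, zero_mul, add_zero]
      exact h
    · simp only [nestCost, List.length_nil]
      ring_nf
      omega

/-- Contents of the machine while the tensor is moved to its place. -/
structure Moving (p N P c : ℕ) (M : ℕ → ℝ) (s : State) : Prop where
  size : s.natReg 0 = p
  len : s.natReg 1 = N
  total : s.natReg 3 = P
  counter : s.natReg 4 = c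
  one : s.natReg 5 = 1
  digit : ∀ k, s.natReg (6 + k) = 0
  natMem : s.natMem = fun _ => 0
  reals : ∀ k, s.realReg (4 + k) = 0
  mem : s.realMem = M

/-- Copying downwards in increasing order is safe even if source and target overlap: before step c
only cells below c have been overwritten, and the source cell N + c is not among them. -/
lemma triple_copy (p N P : ℕ) (M : ℕ → ℝ) :
    Triple (Moving p N P 0 M)
      (.while (.natLT 4 3) (block (.natAdd 2 4 1) [.realLoad 0 2, .realStore 4 0, .natAdd 4 4 5]))
      (P * 5 + 1) (Moving p N P P fun a => if a < P then M (N + a) else M a) := by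
  have h := Triple.loop (b := .natLT 4 3) (t := 4) (m := P)
    (c := block (.natAdd 2 4 1) [.realLoad 0 2, .realStore 4 0, .natAdd 4 4 5])
    (fun c => Moving p N P c fun a => if a < c then M (N + a) else M a)
    (fun c _ => Triple.block _ _ fun s h => ?_)
    (fun c hc s h => by simp only [Cond.Holds, h.counter, h.total]; exact hc)
    (fun s h => by simp only [Cond.Holds, h.counter, h.total]; omega)
  · simpa using h
  · obtain ⟨h0, h1, h3, h4, h5, h6, h7, h8, h9⟩ := h
    constructor <;> simp [Instr.run, digit_register_ne, h0, h1, h3, h4, h5, h6, h7, h8]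
    funext a
    simp only [Function.update_apply, h9]
    by_cases ha : a = c
    · subst ha
      have e1 : ¬ a + N < a := by omega
      rw [Nat.add_comm a N] at e1
      rw [Nat.add_comm a N, if_pos rfl, if_neg e1, if_pos le_rfl]
    · rw [if_neg ha]
      by_cases hc : a < c
      · rw [if_pos hc, if_pos (by omega)]
      · rw [if_neg hc, if_neg (by omega)]

lemma triple_clear (p N P : ℕ) (M : ℕ → ℝ) :
    Triple (fun s => Moving p N P P M s ∧ s.natReg 2 = P + N ∧ s.realReg 0 = 0)
      (.while (.natLT 4 2) (block (.realStore 4 0) [.natAdd 4 4 5]))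
      (N * 3 + 1)
      (Moving p N P (P + N) fun a => if P ≤ a ∧ a < P + N then 0 else M a) := by
  have h := Triple.loop (b := .natLT 4 2) (t := 2) (m := N)
    (c := block (.realStore 4 0) [.natAdd 4 4 5])
    (fun c s => Moving p N P (P + c) (fun a => if P ≤ a ∧ a < P + c then 0 else M a) s ∧
      s.natReg 2 = P + N ∧ s.realReg 0 = 0)
    (fun c _ => Triple.block _ _ fun s h => ?_)
    (fun c hc s h => by simp only [Cond.Holds, h.1.counter, h.2.1]; omega)
    (fun s h => by simp only [Cond.Holds, h.1.counter, h.2.1]; omega)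
  · refine h.conseq (fun s hs => ?_) le_rfl fun s hs => hs.1
    refine ⟨?_, hs.2⟩
    have e : (fun a => if P ≤ a ∧ a < P + 0 then 0 else M a) = M := by
      funext a; rw [if_neg (by omega)]
    rw [e]
    exact hs.1
  · obtain ⟨⟨h0, h1, h3, h4, h5, h6, h7, h8, h9⟩, hr, hz⟩ := h
    refine ⟨?_, by simp [Instr.run, hr],
      by simp [Instr.run, hz]⟩
    constructor <;> simp [Instr.run, digit_register_ne, h0, h1, h3, h4, h5, h6, h7, h8]
    · omega
    · funext a
      simp only [Function.update_apply, h9, hz]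
      by_cases ha : a = P + c
      · rw [if_pos ha, if_pos (by omega)]
      · rw [if_neg ha]
        by_cases hc : P ≤ a ∧ a < P + c
        · rw [if_pos hc, if_pos (by omega)]
        · rw [if_neg hc, if_neg (by omega)]

/-- The case p = 0 is separate, since a zero digit is then not below p. As d > 0, there is an
outermost loop, it makes no pass, and the table is empty. -/
lemma triple_nestProg_all {d : ℕ} (hd : 0 < d) (n p : ℕ) (M : ℕ → ℝ) :
    Triple (Frame p (n * p) (n * p) (fun _ => 0) M) (nestProg d d) (nestCost d n p d)
      (Frame p (n * p) (n * p + p ^ d) (fun _ => 0) (fun a =>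
        if n * p ≤ a ∧ a < n * p + p ^ d then
          entry d p n M (setDigits p d (fun _ => 0) (a - n * p)) else M a)) := by
  rcases Nat.eq_zero_or_pos p with rfl | hp
  · obtain ⟨m, rfl⟩ : ∃ m, d = m + 1 := ⟨d - 1, by omega⟩
    have hloop := Triple.loop (b := .natLT (6 + m) 0)
      (c := .seq (nestProg (m + 1) m) (block (.natAdd (6 + m) (6 + m) 5) [])) (t := 0) (m := 0)
      (fun _ => Frame 0 (n * 0) (n * 0) (fun _ => 0) M) (fun j hj => absurd hj (Nat.not_lt_zero j))
      (fun j hj => absurd hj (Nat.not_lt_zero j))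
      (fun s ⟨o, acc, pr, h⟩ => by simp only [Cond.Holds, h.digit, h.size]; omega)
    refine (hloop.seq (Triple.block _ _ fun s h => ?_)).conseq (fun _ h => h)
      (by simp [nestCost]) fun _ h => h
    obtain ⟨o, acc, pr, h0, h1, h2, h3, h5, h6, h7, h8, h9, h10, h11⟩ := h
    refine ⟨o, acc, pr, ?_⟩
    have hupd : Function.update s.natReg (6 + m) 0 = s.natReg := by
      rw [← h6 m, Function.update_eq_self]
    have e : (fun a => if n * 0 ≤ a ∧ a < n * 0 + 0 ^ (m + 1) then
        entry (m + 1) 0 n M (setDigits 0 (m + 1) (fun _ => 0) (a - n * 0)) else M a) = M := by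
      funext a
      rw [if_neg (by simp)]
    rw [e]
    constructor <;> simp only [List.foldl_cons, List.foldl_nil, Instr.run, hupd]
    all_goals assumption
  · exact triple_nestProg d n hp M d _ _ M (fun _ _ => rfl) (fun _ => hp) le_rfl fun _ _ => rfl

/-- Running time of the computation of the sign tensor. -/
def tensorCost (d n p : ℕ) : ℕ := nestCost d n p d + p ^ d * 5 + n * p * 3 + 21

/-- The table is written behind the samples, moved to address 0, and everything else is reset. The
final state has to be exactly an initial configuration, because the program for f is specified only
from such states. -/
lemma triple_tensorProg {d : ℕ} (hd : 0 < d) (n p : ℕ) (x : Fin (n * p) → ℝ)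
    (T : Fin (p ^ d) → ℝ)
    (hT : ∀ c : Fin (p ^ d), T c = entry d p n (initial p (n * p) x).realMem
      (setDigits p d (fun _ => 0) c)) :
    Triple (fun s => s = initial p (n * p) x) (tensorProg d) (tensorCost d n p)
      (fun s => s = initial p (p ^ d) T) := by
  set M := (initial p (n * p) x).realMem with hM
  have hM0 : ∀ a, n * p ≤ a → M a = 0 := fun a ha => by
    simp only [hM, initial]
    rw [dif_neg (by omega)]
  set M₁ : ℕ → ℝ := fun a => if n * p ≤ a ∧ a < n * p + p ^ d then
    entry d p n M (setDigits p d (fun _ => 0) (a - n * p)) else M a with hM₁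
  set M₂ : ℕ → ℝ := fun a => if a < p ^ d then M₁ (n * p + a) else M₁ a with hM₂
  have h1 : Triple (fun s => s = initial p (n * p) x) (block (.natConst 5 1) [.natAdd 2 1 4]) 2
      (Frame p (n * p) (n * p) (fun _ => 0) M) := by
    refine Triple.block _ _ fun s h => ?_
    subst h
    refine ⟨0, 0, 0, ?_⟩
    constructor <;> simp [Instr.run, initial, hM, digit_register_ne]
  have h2 := triple_nestProg_all hd n p M
  have h3 : Triple (Frame p (n * p) (n * p + p ^ d) (fun _ => 0) M₁)
      (block (.natSub 3 2 1) [.natConst 4 0]) 2 (Moving p (n * p) (p ^ d) 0 M₁) := by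
    refine Triple.block _ _ fun s h => ?_
    obtain ⟨o, acc, pr, h0, h1, h2, h3, h5, h6, h7, h8, h9, h10, h11⟩ := h
    constructor <;> simp [Instr.run, digit_register_ne, *]
  have h4 := triple_copy p (n * p) (p ^ d) M₁
  have h5 : Triple (Moving p (n * p) (p ^ d) (p ^ d) M₂)
      (block (.natAdd 2 3 1) [.realConst 0 0]) 2
      (fun s => Moving p (n * p) (p ^ d) (p ^ d) M₂ s ∧ s.natReg 2 = p ^ d + n * p ∧
        s.realReg 0 = 0) := by
    refine Triple.block _ _ fun s h => ?_
    obtain ⟨h0, h1, h3, h4, h5, h6, h7, h8, h9⟩ := h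
    refine ⟨?_, by simp [Instr.run, h1, h3], by simp [Instr.run]⟩
    constructor <;> simp [Instr.run, digit_register_ne, h0, h1, h3, h4, h5, h6, h7, h8, h9]
  have h6 := triple_clear p (n * p) (p ^ d) M₂
  refine (h1.seq (h2.seq (h3.seq (h4.seq (h5.seq (h6.seq (Triple.block _ _ fun s h => ?_))))))).conseq
    (fun _ h => h) (by simp only [tensorCost, List.length_nil, List.length_cons]; omega)
    fun _ h => h
  obtain ⟨h0, h1, h3, h4, h5, h6, h7, h8, h9⟩ := h
  simp only [List.foldl_cons, List.foldl_nil, Instr.run, initial]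
  congr 1
  · funext k
    rcases Nat.lt_or_ge k 6 with hk | hk
    · interval_cases k <;> simp [h0, h3]
    · obtain ⟨r, rfl⟩ := Nat.exists_eq_add_of_le hk
      simp [digit_register_ne, h6]
  · funext k
    rcases Nat.lt_or_ge k 4 with hk | hk
    · interval_cases k <;> simp
    · obtain ⟨r, rfl⟩ := Nat.exists_eq_add_of_le hk
      simp [idle_register_ne, h8]
  · rw [h9]
    funext a
    by_cases ha : a < p ^ d
    · rw [if_neg (by omega), dif_pos ha, hT]
      simp only [hM₂, hM₁]
      rw [if_pos ha, if_pos (by omega)]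
      simp
    · rw [dif_neg ha]
      by_cases ha' : a < p ^ d + n * p
      · rw [if_pos (by omega)]
      · rw [if_neg (by omega)]
        simp only [hM₂, hM₁]
        rw [if_neg ha, if_neg (by omega)]
        exact hM0 a (by omega)

end Spec

end RealRAM

/-! ### Correctness of the tensor program and polynomial running time -/

namespace RealRAM

/-- A quotient x/x is 1 for x ≠ 0 and 0 for x = 0 by the convention on division, so the product
vanishes exactly when two digits agree. -/
lemma distinctFactor_eq {d p : ℕ} {i : ℕ → ℕ} {e : Fin d → Fin p} (he : ∀ k : Fin d, i k = e k) :
    distinctFactor d i = if Function.Injective e then 1 else 0 := by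
  split_ifs with h
  · refine Finset.prod_eq_one fun k hk => Finset.prod_eq_one fun l hl => ?_
    rw [Finset.mem_range] at hk hl
    refine div_self (sub_ne_zero.2 fun heq => ?_)
    have h1 : i k = i l := by exact_mod_cast heq
    have hld : l < d := by omega
    rw [he ⟨k, hk⟩, he ⟨l, hld⟩] at h1
    have h2 := congrArg Fin.val (h (Fin.ext h1))
    simp only at h2
    omega
  · have hz : ∀ k l : Fin d, l < k → e k = e l → distinctFactor d i = 0 := fun k l hlk hkl => by
      refine Finset.prod_eq_zero (Finset.mem_range.2 k.2)
        (Finset.prod_eq_zero (Finset.mem_range.2 hlk) ?_)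
      rw [he k, he l, hkl, sub_self, zero_div]
    simp only [Function.Injective, not_forall] at h
    obtain ⟨k, l, hkl, hne⟩ := h
    rcases lt_or_gt_of_ne hne with hlt | hlt
    · exact hz l k hlt hkl.symm
    · exact hz k l hlt hkl

lemma entry_eq_signTensor {d n p : ℕ} (y : Fin n × Fin p → ℝ) (c : Fin (p ^ d)) :
    signTensor d (fun j a => y (j, a)) (finFunctionFinEquiv.symm c)
      = entry d p n (initial p (n * p) fun k => y (finProdFinEquiv.symm k)).realMem
        (setDigits p d (fun _ => 0) c) := by
  set e : Fin d → Fin p := finFunctionFinEquiv.symm c with he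
  have hdig : ∀ k : Fin d, setDigits p d (fun _ => 0) c k = e k := fun k => by
    rw [setDigits, if_pos k.2]
    rfl
  have hmem : ∀ (j : Fin n) (a : Fin p),
      (initial p (n * p) fun k => y (finProdFinEquiv.symm k)).realMem (j * p + a) = y (j, a) := by
    intro j a
    have hlt : (j : ℕ) * p + a < n * p :=
      calc (j : ℕ) * p + a < j * p + p := by have := a.2; omega
        _ = (j + 1) * p := by ring
        _ ≤ n * p := Nat.mul_le_mul_right p j.2
    simp only [initial]
    rw [dif_pos hlt]
    congr 1
    rw [Equiv.symm_apply_eq]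
    ext
    simp only [finProdFinEquiv_apply_val]
    ring
  rw [signTensor, entry, Finset.sum_range]
  refine Finset.sum_congr rfl fun j _ => ?_
  rw [sampleTerm, distinctFactor_eq hdig, Finset.prod_range]
  simp_rw [hdig, hmem]
  split_ifs <;> simp

lemma exists_polynomial_nestCost {n : ℕ → ℕ} {r : Polynomial ℕ} (hn : ∀ p, n p ≤ r.eval p)
    (d m : ℕ) : ∃ q : Polynomial ℕ, ∀ p, nestCost d (n p) p m ≤ q.eval p := by
  induction m with
  | zero =>
    refine ⟨r * Polynomial.C (6 * d + 6 * d * (d + 1) + 6) + Polynomial.C 5, fun p => ?_⟩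
    simp only [nestCost, entryCost, Polynomial.eval_add, Polynomial.eval_mul, Polynomial.eval_C]
    exact Nat.add_le_add_right (Nat.mul_le_mul_right _ (hn p)) 5
  | succ m ih =>
    obtain ⟨q, hq⟩ := ih
    refine ⟨Polynomial.X * (q + Polynomial.C 2) + Polynomial.C 2, fun p => ?_⟩
    simp only [nestCost, Polynomial.eval_add, Polynomial.eval_mul, Polynomial.eval_C,
      Polynomial.eval_X]
    exact Nat.add_le_add_right (Nat.mul_le_mul_left _ (Nat.add_le_add_right (hq p) 2)) 2

/-- A polynomial-time statistic of the sign tensor is a polynomial-time statistic of the samples. -/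
theorem isPolyTime_signTensor {d : ℕ} (hd : 0 < d) {n : ℕ → ℕ} {r : Polynomial ℕ}
    (hn : ∀ p, n p ≤ r.eval p) {f : ∀ p, RealTensor d p → ℝ}
    (hf : IsPolyTime (fun p => p ^ d) (fun _ => finFunctionFinEquiv) f) :
    IsPolyTime (fun p => n p * p) (fun _ => finProdFinEquiv)
      (fun p (y : Fin (n p) × Fin p → ℝ) => f p (signTensor d fun j a => y (j, a))) := by
  obtain ⟨c, q, hc⟩ := hf
  obtain ⟨q', hq'⟩ := exists_polynomial_nestCost hn d d
  refine ⟨.seq (tensorProg d) c, q' + Polynomial.X ^ d * Polynomial.C 5 +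
    r * Polynomial.X * Polynomial.C 3 + Polynomial.C 21 + q, fun p y => ?_⟩
  obtain ⟨t, s, hexec, ht, hs⟩ := triple_tensorProg hd (n p) p
    (fun k => y (finProdFinEquiv.symm k))
    (fun k => signTensor d (fun j a => y (j, a)) (finFunctionFinEquiv.symm k))
    (fun k => entry_eq_signTensor y k) _ rfl
  obtain ⟨t', s', hexec', ht', hs'⟩ := hc p (signTensor d fun j a => y (j, a))
  subst hs
  refine ⟨t + t', s', .seq hexec hexec', ?_, hs'⟩
  have h1 := hq' p
  have h2 := Nat.mul_le_mul_right 3 (Nat.mul_le_mul_right p (hn p))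
  simp only [tensorCost] at ht
  simp only [Polynomial.eval_add, Polynomial.eval_mul, Polynomial.eval_pow, Polynomial.eval_C,
    Polynomial.eval_X]
  omega

end RealRAM

/-! ### Choice of the parameters and asymptotics -/

/-- The strength of the planted tilt: the largest one for which the low-degree norm stays bounded. -/
def tiltStrength (d p : ℕ) : ℝ :=
  ((p : ℝ) ^ d * Real.sqrt p * Real.sqrt (Real.sqrt p ^ d) * (1 + Real.log p) ^ d)⁻¹

lemma tiltStrength_nonneg (d p : ℕ) : 0 ≤ tiltStrength d p := by
  have := Real.log_natCast_nonneg p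
  unfold tiltStrength; positivity

lemma tiltStrength_pos {d p : ℕ} (hp : 0 < p) : 0 < tiltStrength d p := by
  have := Real.log_natCast_nonneg p
  have : (0 : ℝ) < p := by exact_mod_cast hp
  unfold tiltStrength; positivity

/-- The factor p^d, which comes from the square root of the sample size p^(2d+1), already dominates
the binomial coefficient. -/
lemma tiltStrength_mul_choose_le {d : ℕ} (p : ℕ) : tiltStrength d p * p.choose d ≤ 1 := by
  rcases Nat.eq_zero_or_pos p with rfl | hp
  · simp [tiltStrength]
  have hl := Real.log_natCast_nonneg p
  have hp1 : (1 : ℝ) ≤ p := by exact_mod_cast hp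
  have hs : 1 ≤ Real.sqrt p := Real.one_le_sqrt.2 hp1
  have hu : 1 ≤ Real.sqrt (Real.sqrt p ^ d) := Real.one_le_sqrt.2 (one_le_pow₀ hs)
  have hL : 1 ≤ (1 + Real.log p) ^ d := one_le_pow₀ (by linarith)
  have hC : (p.choose d : ℝ) ≤ (p : ℝ) ^ d := by exact_mod_cast Nat.choose_le_pow p d
  rw [tiltStrength, inv_mul_le_one₀ (by positivity)]
  calc (p.choose d : ℝ) ≤ (p : ℝ) ^ d * 1 * 1 * 1 := by simpa using hC
    _ ≤ _ := by gcongr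

/-- With R = (1 + log p)², this makes the smallness condition n ω² (√p R)^d ≤ 1 of
`lowDegreeNormLE_plantedLaw` an equality. -/
lemma sampleSize_mul_tiltStrength_sq {d p : ℕ} (hp : 0 < p) :
    (p : ℝ) ^ (2 * d + 1) * tiltStrength d p ^ 2 =
      (Real.sqrt p ^ d * ((1 + Real.log p) ^ 2) ^ d)⁻¹ := by
  have hl := Real.log_natCast_nonneg p
  have hp0 : (0 : ℝ) < p := by exact_mod_cast hp
  have hs0 : 0 < Real.sqrt p := Real.sqrt_pos.2 hp0
  have hs : Real.sqrt p ^ 2 = p := Real.sq_sqrt hp0.le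
  have hu : Real.sqrt (Real.sqrt p ^ d) ^ 2 = Real.sqrt p ^ d := Real.sq_sqrt (by positivity)
  have h : ((p : ℝ) ^ d * Real.sqrt p * Real.sqrt (Real.sqrt p ^ d) * (1 + Real.log p) ^ d) ^ 2
      = (p : ℝ) ^ (2 * d + 1) * (Real.sqrt p ^ d * ((1 + Real.log p) ^ 2) ^ d) := by
    rw [mul_pow, mul_pow, mul_pow, hs, hu, ← pow_mul _ 2 d]; ring
  rw [tiltStrength, inv_pow, h]
  have : (0 : ℝ) < (p : ℝ) ^ (2 * d + 1) := by positivity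
  field_simp

lemma lowDegreeNormLE_tiltStrength {d p : ℕ} (hd : 0 < d) (hp : 0 < p) :
    LowDegreeNormLE
      (plantedLaw (p ^ (2 * d + 1)) p (gaussVec p) (tiltKernel d p (tiltStrength d p)))
      (Real.log p ^ (1 + 1 : ℝ)) (Real.sqrt (Real.exp 1 * (2 * Real.exp 1))) := by
  have hl := Real.log_natCast_nonneg p
  have hp0 : (0 : ℝ) < p := by exact_mod_cast hp
  have hs0 : 0 < Real.sqrt p := Real.sqrt_pos.2 hp0
  -- The conjecture is applied with ε = 1, that is, with degree (log p)². The bound (1 + log p)²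
  -- dominates this degree and is at least 1 for every p ≥ 1.
  have hR : 1 ≤ (1 + Real.log p) ^ 2 := one_le_pow₀ (by linarith)
  have key := lowDegreeNormLE_plantedLaw (n := p ^ (2 * d + 1)) hd (tiltStrength_nonneg d p)
    (tiltStrength_mul_choose_le p) hp hR (by
      push_cast
      rw [← mul_assoc, sampleSize_mul_tiltStrength_sq hp, mul_pow]
      exact (inv_mul_cancel₀ (by positivity)).le)
  intro g hg
  refine key g (hg.trans ?_)
  rw [show (1 + 1 : ℝ) = (2 : ℕ) by norm_num, Real.rpow_natCast]
  gcongr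
  linarith

lemma half_pow_le_factorial_mul_choose {d p : ℕ} (h : 2 * d ≤ p) :
    ((p : ℝ) / 2) ^ d ≤ d.factorial * p.choose d := by
  have h1 : ((p + 1 - d : ℕ) : ℝ) ^ d ≤ (p.descFactorial d : ℝ) := by
    exact_mod_cast Nat.pow_sub_le_descFactorial p d
  have h2 : (p : ℝ) / 2 ≤ ((p + 1 - d : ℕ) : ℝ) := by
    rw [Nat.cast_sub (by omega)]
    have : (2 * d : ℝ) ≤ p := by exact_mod_cast h
    push_cast; linarith
  rw [Nat.descFactorial_eq_factorial_mul_choose] at h1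
  push_cast at h1
  exact (pow_le_pow_left₀ (by positivity) h2 d).trans h1

lemma tendsto_log_natCast_atTop : Tendsto (fun p : ℕ => Real.log p) atTop atTop :=
  Real.tendsto_log_atTop.comp tendsto_natCast_atTop_atTop

/-- With high probability the spectral norm of the sign tensor is at most `2 p ^ (d + 1) (log p) ^ 2`
under the null law. -/
lemma tendsto_nullLaw_specNorm {d : ℕ} (hd : 0 < d) :
    Tendsto (fun p : ℕ => (nullLaw (p ^ (2 * d + 1)) p).real
      {Y | 2 * (p : ℝ) ^ (d + 1) * Real.log p ^ 2 < (signTensor d Y).specNorm}) atTop (nhds 0) := by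
  have hz : Tendsto (fun p : ℕ => 2 * Real.exp (-(p : ℝ))) atTop (nhds 0) := by
    simpa using (Real.tendsto_exp_neg_atTop_nhds_zero.comp
      tendsto_natCast_atTop_atTop).const_mul 2
  refine squeeze_zero' (Eventually.of_forall fun p => measureReal_nonneg) ?_ hz
  filter_upwards [tendsto_log_natCast_atTop.eventually_ge_atTop
    (3 * d + 2 + Real.log 4 + d.factorial + 1), eventually_ge_atTop (d + 1)] with p hlp hdp
  set l := Real.log p with hl
  have hp : 0 < p := by omega
  have hp0 : (0 : ℝ) < p := by exact_mod_cast hp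
  have hp1 : (1 : ℝ) ≤ p := by exact_mod_cast hp
  have hf : (0 : ℝ) < d.factorial := by exact_mod_cast d.factorial_pos
  have h4 : 0 ≤ Real.log 4 := Real.log_nonneg (by norm_num)
  have hd0 : (0 : ℝ) ≤ d := by positivity
  have hl1 : 1 ≤ l := by linarith
  -- With this mesh the discretization error p^d n d/M equals d, which is negligible.
  have hM : 0 < p ^ (3 * d + 1) := by positivity
  have key := nullLaw_specNorm_le (n := p ^ (2 * d + 1)) hd hp hM
    (t := (p : ℝ) ^ (d + 1) * l ^ 2) (by positivity)
  refine (measureReal_mono ?_ (measure_ne_top _ _)).trans (key.trans ?_)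
  · intro Y hY
    change 2 * (p : ℝ) ^ (d + 1) * l ^ 2 < (signTensor d Y).specNorm at hY
    refine lt_of_le_of_lt ?_ hY
    push_cast
    have e : (p : ℝ) ^ d * ((p : ℝ) ^ (2 * d + 1) * (d * (1 / (p : ℝ) ^ (3 * d + 1)))) = d := by
      have : (p : ℝ) ^ (3 * d + 1) = (p : ℝ) ^ d * (p : ℝ) ^ (2 * d + 1) := by ring
      rw [this]; field_simp
    rw [e]
    have h1 : (d : ℝ) ≤ (p : ℝ) ^ (d + 1) := by
      have : (d : ℝ) ≤ p := by exact_mod_cast (by omega : d ≤ p)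
      exact this.trans (le_self_pow₀ hp1 (by omega))
    have h2 : (p : ℝ) ^ (d + 1) * 1 ≤ (p : ℝ) ^ (d + 1) * l ^ 2 := by
      gcongr; exact one_le_pow₀ hl1
    linarith
  · push_cast
    have hM1 : (1 : ℝ) ≤ (p : ℝ) ^ (3 * d + 1) := one_le_pow₀ hp1
    have h1 : 2 * ((p : ℝ) ^ (3 * d + 1) + 1) ≤ Real.exp (Real.log 4 + (3 * d + 1) * l) := by
      rw [Real.exp_add, Real.exp_log (by norm_num),
        show (3 * (d : ℝ) + 1) * l = ((3 * d + 1 : ℕ) : ℝ) * l by push_cast; ring,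
        Real.exp_nat_mul, hl, Real.exp_log hp0]
      linarith
    -- At the exponential parameter p^(-d) and with n = p^(2d+1), both terms of the exponent are of
    -- order p up to logarithms. The gain p (log p)² beats the logarithm of the number of grid
    -- points, which is of order p log p.
    have h2 : (p : ℝ) ^ (2 * d + 1) * (((p : ℝ) ^ d)⁻¹ ^ 2 * d.factorial)
        - ((p : ℝ) ^ d)⁻¹ * ((p : ℝ) ^ (d + 1) * l ^ 2) = p * (d.factorial - l ^ 2) := by
      have : (p : ℝ) ^ (2 * d + 1) = ((p : ℝ) ^ d) ^ 2 * p := by ring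
      rw [this, pow_succ (p : ℝ) d]; field_simp
    rw [h2, mul_assoc]
    refine mul_le_mul_of_nonneg_left ?_ (by norm_num)
    calc _ ≤ Real.exp (Real.log 4 + (3 * d + 1) * l) ^ p * Real.exp (p * (d.factorial - l ^ 2)) := by
          gcongr
      _ = Real.exp (p * (Real.log 4 + (3 * d + 1) * l + d.factorial - l ^ 2)) := by
          rw [← Real.exp_nat_mul, ← Real.exp_add]; ring_nf
      _ ≤ _ := by
          refine Real.exp_le_exp.2 ?_
          have h3 : Real.log 4 + (3 * d + 1) * l + d.factorial - l ^ 2 ≤ -1 := by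
            have := mul_le_mul_of_nonneg_right hlp (by linarith : 0 ≤ l)
            have h5 : Real.log 4 + d.factorial + 1 ≤ (Real.log 4 + d.factorial + 1) * l :=
              le_mul_of_one_le_right (by linarith) hl1
            nlinarith
          nlinarith

/-- The spectral norm that the sign tensor reaches under the planted law. -/
def plantedSpecNorm (d p : ℕ) : ℝ :=
  (d.factorial : ℝ) * (Real.sqrt p ^ d)⁻¹ *
    (((p ^ (2 * d + 1) : ℕ) : ℝ) * (tiltStrength d p * (signCorr (1 / 2) ^ d * p.choose d)) / 2)

/-- In the Chebyshev bound n ω² is explicit, which leaves a constant times (√p)^d (1 + log p)^(2d)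
divided by the binomial coefficient. The latter is of order p^d, so the bound is of order ((log
p)²/√p)^d. -/
lemma tendsto_noisy_plantedLaw_specNorm {d : ℕ} (hd : 0 < d) :
    Tendsto (fun p : ℕ => (noisy (1 / 2)
      (plantedLaw (p ^ (2 * d + 1)) p (gaussVec p) (tiltKernel d p (tiltStrength d p)))).real
      {Y | (signTensor d Y).specNorm < plantedSpecNorm d p}) atTop (nhds 0) := by
  set κ := signCorr (1 / 2) with hκ
  have hκ0 : 0 < κ := signCorr_half_pos
  have hlim : Tendsto (fun p : ℕ => Real.log p ^ 2 / Real.sqrt p) atTop (nhds 0) := by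
    have h := (isLittleO_log_rpow_rpow_atTop 2 (by norm_num : (0 : ℝ) < 1 / 2)).tendsto_div_nhds_zero
    have h' := h.comp tendsto_natCast_atTop_atTop
    refine h'.congr fun p => ?_
    simp [Real.sqrt_eq_rpow]
  have hz : Tendsto (fun p : ℕ => 8 * d.factorial / (κ ^ 2) ^ d *
      (8 * (Real.log p ^ 2 / Real.sqrt p)) ^ d) atTop (nhds 0) := by
    simpa [hd.ne'] using ((hlim.const_mul 8).pow d).const_mul (8 * d.factorial / (κ ^ 2) ^ d)
  refine squeeze_zero' (Eventually.of_forall fun p => measureReal_nonneg) ?_ hz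
  filter_upwards [tendsto_log_natCast_atTop.eventually_ge_atTop 1,
    eventually_ge_atTop (2 * d)] with p hlp hdp
  set l := Real.log p with hl
  have hp : 0 < p := by omega
  have hp0 : (0 : ℝ) < p := by exact_mod_cast hp
  have hs0 : 0 < Real.sqrt p := Real.sqrt_pos.2 hp0
  have hf : (0 : ℝ) < d.factorial := by exact_mod_cast d.factorial_pos
  have hC : 0 < (p.choose d : ℝ) := by exact_mod_cast Nat.choose_pos (by omega)
  have hω := tiltStrength_pos (d := d) hp
  refine (noisy_plantedLaw_specNorm_lt_le (n := p ^ (2 * d + 1)) hd hω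
    (tiltStrength_mul_choose_le p) signCorr_half_pos (by omega) (by positivity)).trans ?_
  rw [← hκ]
  have e : ((p ^ (2 * d + 1) : ℕ) : ℝ) * (tiltStrength d p * (κ ^ d * p.choose d)) ^ 2
      = (Real.sqrt p ^ d * ((1 + l) ^ 2) ^ d)⁻¹ * ((κ ^ 2) ^ d * (p.choose d : ℝ) ^ 2) := by
    rw [hl, ← sampleSize_mul_tiltStrength_sq hp]; push_cast; ring
  rw [e]
  have e2 : 4 * (2 * (p.choose d : ℝ)) / ((Real.sqrt p ^ d * ((1 + l) ^ 2) ^ d)⁻¹ *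
      ((κ ^ 2) ^ d * (p.choose d : ℝ) ^ 2)) =
      8 * d.factorial / (κ ^ 2) ^ d * (Real.sqrt p ^ d * ((1 + l) ^ 2) ^ d /
        (d.factorial * p.choose d)) := by
    field_simp; ring
  rw [e2]
  gcongr
  calc _ ≤ Real.sqrt p ^ d * ((2 * l) ^ 2) ^ d / ((p : ℝ) / 2) ^ d := by
        gcongr
        · linarith
        · exact half_pow_le_factorial_mul_choose hdp
    _ = (8 * (l ^ 2 / Real.sqrt p)) ^ d := by
        rw [← mul_pow, ← div_pow]
        congr 1
        nth_rw 2 [← Real.sq_sqrt hp0.le]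
        field_simp; ring

/-- The ratio of the planted and the null spectral norms. -/
lemma le_plantedSpecNorm {d p : ℕ} (hlp : 1 ≤ Real.log p) (hdp : 2 * d ≤ p) (hp : 0 < p) :
    (signCorr (1 / 2) / 4) ^ d / 4 * ((p : ℝ) ^ ((d : ℝ) / 4 - 1 / 2) / Real.log p ^ ((d : ℝ) + 2))
      * (2 * (p : ℝ) ^ (d + 1) * Real.log p ^ 2) ≤ plantedSpecNorm d p := by
  set κ := signCorr (1 / 2) with hκ
  have hκ0 : 0 < κ := signCorr_half_pos
  set l := Real.log p with hl
  have hp0 : (0 : ℝ) < p := by exact_mod_cast hp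
  have hl0 : 0 < l := by linarith
  -- All powers of p are expressed through s = p^(1/2) and u = p^(d/4), so that the comparison
  -- becomes an identity of monomials; the real exponent enters only through u/s.
  set s := Real.sqrt p with hs
  set u := Real.sqrt (s ^ d) with hu
  have hs0 : 0 < s := Real.sqrt_pos.2 hp0
  have hu0 : 0 < u := Real.sqrt_pos.2 (by positivity)
  have hs2 : (p : ℝ) = s ^ 2 := (Real.sq_sqrt hp0.le).symm
  have hu2 : u ^ 2 = s ^ d := Real.sq_sqrt (by positivity)
  have hX : (p : ℝ) ^ ((d : ℝ) / 4 - 1 / 2) = u / s := by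
    rw [Real.rpow_sub hp0, ← Real.sqrt_eq_rpow, ← hs, hu, Real.sqrt_eq_rpow, ← Real.rpow_natCast s d,
      hs, Real.sqrt_eq_rpow, ← Real.rpow_mul hp0.le, ← Real.rpow_mul hp0.le]
    congr 2; ring
  have hL : l ^ ((d : ℝ) + 2) = l ^ d * l ^ 2 := by
    rw [← pow_add, ← Real.rpow_natCast]; push_cast; rfl
  have h1 : ((p : ℝ) / 2) ^ d * κ ^ d * (s * u) / (2 * (2 * l) ^ d) ≤ plantedSpecNorm d p := by
    have e : plantedSpecNorm d p =
        (d.factorial * p.choose d) * κ ^ d * (s * u) / (2 * (1 + l) ^ d) := by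
      unfold plantedSpecNorm tiltStrength
      rw [← hκ, ← hl, ← hs, ← hu, ← hu2]
      have : ((p ^ (2 * d + 1) : ℕ) : ℝ) = (p : ℝ) ^ d * u ^ 4 * s ^ 2 := by
        rw [← hs2, show u ^ 4 = (u ^ 2) ^ 2 by ring, hu2, ← pow_mul, mul_comm d 2, pow_mul, ← hs2]
        push_cast; ring
      rw [this]
      field_simp
    rw [e]
    gcongr
    · exact half_pow_le_factorial_mul_choose hdp
    · linarith
  refine le_trans (le_of_eq ?_) h1
  rw [hX, hL, pow_succ (p : ℝ) d, div_pow, div_pow, mul_pow, show (4 : ℝ) = 2 * 2 by norm_num, mul_pow]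
  nth_rw 2 [hs2]
  field_simp

/-! ### From an approximation to a test -/

/-- A two-sided approximation of the spectral norm with distortion less than the ratio of the planted
and the null spectral norms gives a consistent test; under the low-degree conjecture there is none. -/
lemma le_mul_of_lowDegreeConjecture (hLDC : LowDegreeConjecture) {d : ℕ} (hd : 0 < d)
    {f : ∀ p : ℕ, RealTensor d p → ℝ}
    (hf : RealRAM.IsPolyTime (fun p => p ^ d) (fun _ => finFunctionFinEquiv) f) :
    ∀ᶠ p : ℕ in atTop, ∀ ρ ζ : ℝ, 1 ≤ ρ → 1 ≤ ζ →
      (∀ T : RealTensor d p, T.IsSymmetric → ρ⁻¹ * T.specNorm ≤ f p T ∧ f p T ≤ ζ * T.specNorm) →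
      plantedSpecNorm d p ≤ ρ * ζ * (2 * (p : ℝ) ^ (d + 1) * Real.log p ^ 2) := by
  set b : ℕ → ℝ := fun p => 2 * (p : ℝ) ^ (d + 1) * Real.log p ^ 2 with hb
  -- The factors ρ and ζ may depend on p, whereas the conjecture needs a threshold sequence fixed in
  -- advance. For each p at which some pair violates the bound, the threshold ζ b_p of one such pair
  -- is chosen.
  let Bad : ℕ → ℝ → Prop := fun p ζ => 1 ≤ ζ ∧ ∃ ρ : ℝ, 1 ≤ ρ ∧
    (∀ T : RealTensor d p, T.IsSymmetric → ρ⁻¹ * T.specNorm ≤ f p T ∧ f p T ≤ ζ * T.specNorm) ∧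
    ρ * ζ * b p < plantedSpecNorm d p
  have hτ : ∀ p, ∃ τ : ℝ, (∃ ζ, Bad p ζ) → ∃ ζ, Bad p ζ ∧ τ = ζ * b p := by
    intro p
    by_cases h : ∃ ζ, Bad p ζ
    · obtain ⟨ζ, hζ⟩ := h
      exact ⟨ζ * b p, fun _ => ⟨ζ, hζ, rfl⟩⟩
    · exact ⟨0, fun h' => absurd h' h⟩
  choose τ hτ using hτ
  have hK : ∀ p, IsMarkovKernel (tiltKernel d p (tiltStrength d p)) := fun p =>
    isMarkovKernel_tiltKernel hd (tiltStrength_nonneg d p) (tiltStrength_mul_choose_le p)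
  have hpoly := RealRAM.isPolyTime_signTensor hd (n := fun p => p ^ (2 * d + 1))
    (r := Polynomial.X ^ (2 * d + 1)) (fun p => by simp) hf
  obtain ⟨η, hη, hev⟩ := hLDC (fun p => p ^ (2 * d + 1)) (fun p => Fin p → ℝ) gaussVec
    (fun p => tiltKernel d p (tiltStrength d p)) 1 (1 / 2)
    (Real.sqrt (Real.exp 1 * (2 * Real.exp 1))) ⟨Polynomial.X ^ (2 * d + 1), fun p => by simp⟩
    (fun p => coordInvariant_plantedLaw (tiltStrength_nonneg d p) (tiltStrength_mul_choose_le p))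
    one_pos ((eventually_gt_atTop 0).mono fun p hp => lowDegreeNormLE_tiltStrength hd hp)
    (by norm_num) (by norm_num) _ hpoly τ
  have hsum := (tendsto_nullLaw_specNorm hd).add (tendsto_noisy_plantedLaw_specNorm hd)
  rw [add_zero] at hsum
  filter_upwards [hev, hsum.eventually_lt_const hη] with p hle hlt ρ ζ hρ hζ happ
  by_contra! hbad
  -- The pair behind the threshold need not be the given one; it violates the bound as well. With
  -- it, a type I error forces a null spectral norm above b_p, and a type II error forces a planted
  -- one below `plantedSpecNorm d p`.
  obtain ⟨ζ', ⟨hζ', ρ', hρ', happ', hbad'⟩, hτp⟩ := hτ p ⟨ζ, hζ, ρ, hρ, happ, hbad⟩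
  refine absurd (hle.trans ?_) hlt.not_ge
  have hP := isProbabilityMeasure_plantedLaw (n := p ^ (2 * d + 1)) hd (tiltStrength_nonneg d p)
    (tiltStrength_mul_choose_le p)
  have hN := isProbabilityMeasure_noisy (1 / 2)
    (plantedLaw (p ^ (2 * d + 1)) p (gaussVec p) (tiltKernel d p (tiltStrength d p)))
  rw [hτp]
  refine add_le_add (measureReal_mono ?_ (measure_ne_top _ _))
    (measureReal_mono ?_ (measure_ne_top _ _))
  · intro Y hY
    have hY' : ζ' * b p < f p (signTensor d Y) := hY
    exact lt_of_mul_lt_mul_left (hY'.trans_le (happ' _ (signTensor_isSymmetric Y)).2)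
      (by linarith)
  · intro Y hY
    have hY' : f p (signTensor d Y) ≤ ζ' * b p := hY
    have h := ((happ' _ (signTensor_isSymmetric Y)).1).trans hY'
    rw [inv_mul_le_iff₀ (by linarith), ← mul_assoc] at h
    exact h.trans_lt hbad'

theorem corollary1 (hLDC : LowDegreeConjecture) (d : ℕ) (hd : 3 ≤ d) :
    ∃ C c : ℝ, 0 < C ∧ 0 < c ∧
      ∀ f : ∀ p : ℕ, RealTensor d p → ℝ,
        (∀ (p : ℕ) (T : RealTensor d p), 0 ≤ f p T) →
        RealRAM.IsPolyTime (fun p => p ^ d) (fun _ => finFunctionFinEquiv) f →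
        ∀ᶠ p : ℕ in atTop, ∀ γ : ℝ,
          TwoSidedApprox (f p) γ ∨ LowerCertificate (f p) γ ∨ UpperCertificate (f p) γ →
          c * ((p : ℝ) ^ ((d : ℝ) / 4 - 1 / 2) / Real.log p ^ C) ≤ γ := by
  have hd0 : 0 < d := by omega
  -- Of the logarithms, d come from the tilt strength and 2 from the null bound. In the constant,
  -- 4^(-d) combines d! `p.choose d` ≥ (p/2)^d with 1 + log p ≤ 2 log p, and 1/4 combines half of
  -- the planted mean with the factor 2 in the null bound.
  refine ⟨(d : ℝ) + 2, (signCorr (1 / 2) / 4) ^ d / 4, by positivity, ?_, fun f _ hf => ?_⟩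
  · have := signCorr_half_pos
    positivity
  filter_upwards [le_mul_of_lowDegreeConjecture hLDC hd0 hf, eventually_ge_atTop (2 * d),
    tendsto_log_natCast_atTop.eventually_ge_atTop 1] with p hmain hdp hlp γ hγ
  have hp0 : (0 : ℝ) < p := by exact_mod_cast (by omega : 0 < p)
  have htwo : TwoSidedApprox (f p) γ := by
    rcases hγ with h | ⟨h1, h⟩ | ⟨h1, h⟩
    · exact h
    · exact ⟨γ, 1, h1, le_rfl, (mul_one γ).symm, fun T hT => by simpa using h T hT⟩
    · exact ⟨1, γ, le_rfl, h1, (one_mul γ).symm, fun T hT => by simpa using h T hT⟩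
  obtain ⟨ρ, ζ, hρ, hζ, rfl, happ⟩ := htwo
  exact le_of_mul_le_mul_right
    ((le_plantedSpecNorm hlp hdp (by omega)).trans (hmain ρ ζ hρ hζ happ)) (by positivity)

end
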